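/- Let $n\ge 1$, $0<s<1$, and let $\Omega\subset\mathbb R^n$ be a bounded Lipschitz domain (with polyhedral boundary, so that it can be triangulated). Let $H=H^s_0(\Omega)$ be the Hilbert space of all $v\in H^s(\mathbb R^n)$ with $v=0$ a.e. outside $\Omega$, with the norm $$\|v\|_H^2=\|v\|_{L^2(\mathbb R^n)}^2+\iint_{\mathbb R^n\times\mathbb R^n}\frac{(v(x)-v(y))^2}{|x-y|^{n+2s}}\,dy\,dx ,$$ let $H^*$ be its dual with the dual norm and pairing $\langle\cdot,\cdot\rangle$, and let $$a(u,v)=\frac{c_{n,s}}{2}\iint_{(\Omega\times\mathbb R^n)\cup(\mathbb R^n\times\Omega)}\frac{(u(x)-u(y))(v(x)-v(y))}{|x-y|^{n+2s}}\,dy\,dx,\qquad c_{n,s}=\frac{2^{2s}s\,\Gamma(\frac{n+2s}{2})}{\pi^{n/2}\Gamma(1-s)},\qquad b(\mu,v)=\langle\mu,v\rangle .$$ A triangulation of $\Omega$ is a finite conforming simplicial complex with union $\overline\Omega$; its elements are its $n$-dimensional simplices, and $h_T$ is the diameter of an element $T$. It is $\kappa$-shape-regular ($\kappa>0$) if every element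 $T$ contains a closed ball of radius $h_T/\kappa$ and $h_T\le\kappa h_{T'}$ for any two elements $T,T'$ with a common vertex (for $n\ge2$ the second condition follows from the first one up to a change of $\kappa$). For triangulations $\mathcal T_h,\mathcal T_H$ let $\mathbb V_h\subset H$ be the space of continuous functions that are affine on each element of $\mathcal T_h$ and vanish on $\partial\Omega$ (extended by zero), and let $\mathbb M_H\subset H^*$ be the space of functions that are constant on each element of $\mathcal T_H$, with $\langle\mu,v\rangle=\int_\Omega\mu v\,dx$. For $C>0$ write $H\ge Ch$ if $h_K\ge C\,h_T$ for all elements $K$ of $\mathcal T_H$ and $T$ of $\mathcal T_h$ whose interiors intersect. **Theorem.** There is a constant $C_1>0$ depending only on $n,s,\Omega$, and for each $\kappa>0$ there are constants $C_0,C_2>0$ depending only on $n,s,\Omega,\kappa$, such that the following holds. Let $\mathcal T_h,\mathcal T_H$ be $\kappa$-shape-regular triangulations of $\Omega$, let $\Lambda\subset H^*$ and $\Lambda_H\subset\mathbb M_H$ be closed and convex with $\Lambda_H\subset\Lambda$, and let $f\in H^*$, $w\in H$. Let $(u,\lambda)\in H\times\Lambda$ satisfy $$a(u,v)+b(\lambda,v)=\langle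 f,v\rangle,\qquad b(\mu-\lambda,u)\le\langle\mu-\lambda,w\rangle\qquad\text{for all }(v,\mu)\in H\times\Lambda,$$ and let $(u_h,\lambda_H)\in\mathbb V_h\times\Lambda_H$ satisfy $$a(u_h,v_h)+b(\lambda_H,v_h)=\langle f,v_h\rangle,\qquad b(\mu_H-\lambda_H,u_h)\le\langle\mu_H-\lambda_H,w\rangle\qquad\text{for all }(v_h,\mu_H)\in\mathbb V_h\times\Lambda_H.$$ Then for all $(v_h,\mu_H)\in\mathbb V_h\times\Lambda_H$ $$\|u-u_h\|_H^2\le C_1\bigl(\|u-v_h\|_H^2+\|\lambda-\mu_H\|_{H^*}^2+\|\lambda-\lambda_H\|_{H^*}^2\bigr),$$ and, if $H\ge C_0h$, $$\|\lambda-\lambda_H\|_{H^*}\le C_2\bigl(\|u-u_h\|_H+\|\lambda-\mu_H\|_{H^*}\bigr).$$ -/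

import Mathlib

open MeasureTheory

/-- The standard local-graph definition: near every boundary point, after choosing a direction `ν`,
the set is the region strictly above the graph of a Lipschitz function of the component
orthogonal to `ν`. -/
structure IsBoundedLipschitzDomain {n : ℕ} (Ω : Set (EuclideanSpace ℝ (Fin n))) : Prop where
  isOpen : IsOpen Ω
  isConnected : IsConnected Ω
  isBounded : Bornology.IsBounded Ω
  graph : ∀ z ∈ frontier Ω, ∃ r > 0, ∃ ν : EuclideanSpace ℝ (Fin n), ‖ν‖ = 1 ∧
    ∃ (L : NNReal) (φ : EuclideanSpace ℝ (Fin n) → ℝ), LipschitzWith L φ ∧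
      ∀ x ∈ Metric.ball z r, x ∈ Ω ↔ φ (x - inner ℝ x ν • ν) < inner ℝ x ν

/-- The ambient Hilbert space `L²(ℝⁿ) × L²(ℝⁿ × ℝⁿ)`, with norm `(‖v‖² + ‖g‖²)^{1/2}`. -/
abbrev FracAmbient (n : ℕ) : Type :=
  WithLp 2
    (Lp ℝ 2 (volume : Measure (EuclideanSpace ℝ (Fin n))) ×
      Lp ℝ 2 (volume : Measure (EuclideanSpace ℝ (Fin n) × EuclideanSpace ℝ (Fin n))))

/-- The fractional difference quotient `(v(x) - v(y)) / |x - y|^{(n+2s)/2}`. -/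
noncomputable def fracQuotient (n : ℕ) (s : ℝ) (v : EuclideanSpace ℝ (Fin n) → ℝ)
    (p : EuclideanSpace ℝ (Fin n) × EuclideanSpace ℝ (Fin n)) : ℝ :=
  (v p.1 - v p.2) / ‖p.1 - p.2‖ ^ (((n : ℝ) + 2 * s) / 2)

/-- The space `H = H^s_0(Ω)` of functions `v ∈ H^s(ℝⁿ)` that vanish a.e. outside `Ω`. An element is
the pair of `v ∈ L²(ℝⁿ)` and its fractional difference quotient, which has to be in `L²(ℝⁿ × ℝⁿ)`;
thus `v` alone determines the element, and the norm inherited from the ambient space is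
`‖v‖_H = (‖v‖²_{L²(ℝⁿ)} + ∬ (v(x) - v(y))² / |x - y|^{n+2s} dy dx)^{1/2}`. -/
noncomputable def fracSobolevZero (n : ℕ) (s : ℝ) (Ω : Set (EuclideanSpace ℝ (Fin n))) :
    Submodule ℝ (FracAmbient n) where
  carrier := {q | (∀ᵐ x, x ∉ Ω → q.fst x = 0) ∧
    ∀ᵐ p : EuclideanSpace ℝ (Fin n) × EuclideanSpace ℝ (Fin n),
      q.snd p = fracQuotient n s q.fst p}
  zero_mem' := by
    have h0 := Lp.coeFn_zero ℝ 2 (volume : Measure (EuclideanSpace ℝ (Fin n)))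
    have h1 := Lp.coeFn_zero ℝ 2
      (volume : Measure (EuclideanSpace ℝ (Fin n) × EuclideanSpace ℝ (Fin n)))
    refine ⟨?_, ?_⟩
    · filter_upwards [h0] with x _ _
      simp
    · filter_upwards [h1, Measure.quasiMeasurePreserving_fst.ae h0,
        Measure.quasiMeasurePreserving_snd.ae h0] with p hp ha hb
      simp only [WithLp.zero_fst, WithLp.zero_snd, fracQuotient]
      rw [hp, ha, hb]
      simp
  add_mem' := by
    rintro q r ⟨hq, hq'⟩ ⟨hr, hr'⟩
    have h0 := Lp.coeFn_add q.fst r.fst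
    have h1 := Lp.coeFn_add q.snd r.snd
    refine ⟨?_, ?_⟩
    · filter_upwards [h0, hq, hr] with x hx hqx hrx hxΩ
      simp only [WithLp.add_fst]
      rw [hx, Pi.add_apply, hqx hxΩ, hrx hxΩ, add_zero]
    · filter_upwards [h1, Measure.quasiMeasurePreserving_fst.ae h0,
        Measure.quasiMeasurePreserving_snd.ae h0, hq', hr'] with p hp ha hb hqp hrp
      simp only [WithLp.add_fst, WithLp.add_snd, fracQuotient] at *
      rw [hp, Pi.add_apply, ha, hb, hqp, hrp, Pi.add_apply, Pi.add_apply]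
      ring
  smul_mem' := by
    rintro c q ⟨hq, hq'⟩
    have h0 := Lp.coeFn_smul c q.fst
    have h1 := Lp.coeFn_smul c q.snd
    refine ⟨?_, ?_⟩
    · filter_upwards [h0, hq] with x hx hqx hxΩ
      simp only [WithLp.smul_fst]
      rw [hx, Pi.smul_apply, hqx hxΩ, smul_zero]
    · filter_upwards [h1, Measure.quasiMeasurePreserving_fst.ae h0,
        Measure.quasiMeasurePreserving_snd.ae h0, hq'] with p hp ha hb hqp
      simp only [WithLp.smul_fst, WithLp.smul_snd, fracQuotient] at *
      rw [hp, Pi.smul_apply, ha, hb, hqp, Pi.smul_apply, Pi.smul_apply]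
      simp only [smul_eq_mul]
      ring

/-- The function `ℝⁿ → ℝ` (defined up to null sets) underlying an element of `H^s_0(Ω)`. -/
noncomputable def fracSobolevFun {n : ℕ} {s : ℝ} {Ω : Set (EuclideanSpace ℝ (Fin n))}
    (v : fracSobolevZero n s Ω) : EuclideanSpace ℝ (Fin n) → ℝ :=
  (v : FracAmbient n).fst

/-- The normalization constant `c_{n,s}` of the fractional Laplacian. -/
noncomputable def fracConst (n : ℕ) (s : ℝ) : ℝ :=
  (2 : ℝ) ^ (2 * s) * s * Real.Gamma (((n : ℝ) + 2 * s) / 2) /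
    (Real.pi ^ ((n : ℝ) / 2) * Real.Gamma (1 - s))

/-- The bilinear form `a(u,v)` of the fractional Laplacian, with the double integral over
`(Ω × ℝⁿ) ∪ (ℝⁿ × Ω)`. -/
noncomputable def fracForm {n : ℕ} {s : ℝ} {Ω : Set (EuclideanSpace ℝ (Fin n))}
    (u v : fracSobolevZero n s Ω) : ℝ :=
  fracConst n s / 2 *
    ∫ p in {p : EuclideanSpace ℝ (Fin n) × EuclideanSpace ℝ (Fin n) | p.1 ∈ Ω ∨ p.2 ∈ Ω},
      (fracSobolevFun u p.1 - fracSobolevFun u p.2) * (fracSobolevFun v p.1 - fracSobolevFun v p.2) /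
        ‖p.1 - p.2‖ ^ ((n : ℝ) + 2 * s)

/-- `𝒯` is a (conforming, simplicial, finite) triangulation of `Ω`. -/
structure IsTriangulation {n : ℕ} (𝒯 : Geometry.SimplicialComplex ℝ (EuclideanSpace ℝ (Fin n)))
    (Ω : Set (EuclideanSpace ℝ (Fin n))) : Prop where
  finite : 𝒯.faces.Finite
  space_eq : 𝒯.space = closure Ω

/-- The elements of a triangulation: its `n`-dimensional simplices, given by their vertices. -/
def meshElements {n : ℕ} (𝒯 : Geometry.SimplicialComplex ℝ (EuclideanSpace ℝ (Fin n))) :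
    Set (Finset (EuclideanSpace ℝ (Fin n))) :=
  {T | T ∈ 𝒯.faces ∧ T.card = n + 1}

/-- The diameter `h_T` of the simplex with vertex set `T`. -/
noncomputable def simplexDiam {n : ℕ} (T : Finset (EuclideanSpace ℝ (Fin n))) : ℝ :=
  Metric.diam (convexHull ℝ (T : Set (EuclideanSpace ℝ (Fin n))))

/-- Shape regularity with parameter `κ`: every element contains a ball whose radius is at least the
`κ`-th part of its diameter, and elements that touch have comparable diameters. For triangulations
of Lipschitz domains in dimension `n ≥ 2` the second condition follows from the first one, up to a
change of `κ`; in dimension one it is the usual meaning of shape regularity. -/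
structure IsShapeRegular {n : ℕ} (κ : ℝ)
    (𝒯 : Geometry.SimplicialComplex ℝ (EuclideanSpace ℝ (Fin n))) : Prop where
  inball : ∀ T ∈ meshElements 𝒯, ∃ x : EuclideanSpace ℝ (Fin n),
    Metric.closedBall x (simplexDiam T / κ) ⊆ convexHull ℝ (T : Set (EuclideanSpace ℝ (Fin n)))
  neighbours : ∀ T ∈ meshElements 𝒯, ∀ T' ∈ meshElements 𝒯,
    (∃ x, x ∈ T ∧ x ∈ T') → simplexDiam T ≤ κ * simplexDiam T'

/-- The mesh condition `H ≥ C h` between local mesh sizes: wherever an element `K` of `𝒯H` and an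
element `T` of `𝒯h` overlap, `h_K ≥ C h_T`. -/
def MeshSizeGE {n : ℕ} (C : ℝ)
    (𝒯H 𝒯h : Geometry.SimplicialComplex ℝ (EuclideanSpace ℝ (Fin n))) : Prop :=
  ∀ K ∈ meshElements 𝒯H, ∀ T ∈ meshElements 𝒯h,
    (interior (convexHull ℝ (K : Set (EuclideanSpace ℝ (Fin n)))) ∩
      interior (convexHull ℝ (T : Set (EuclideanSpace ℝ (Fin n))))).Nonempty →
    C * simplexDiam T ≤ simplexDiam K

/-- The space `𝕍_h` of continuous functions that are affine on each element of the triangulation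
and vanish on the boundary (extended by zero outside `Ω`). -/
def piecewiseLinear {n : ℕ} (s : ℝ) (Ω : Set (EuclideanSpace ℝ (Fin n)))
    (𝒯 : Geometry.SimplicialComplex ℝ (EuclideanSpace ℝ (Fin n))) :
    Set (fracSobolevZero n s Ω) :=
  {v | ∃ g : EuclideanSpace ℝ (Fin n) → ℝ, Continuous g ∧ (∀ x, x ∉ Ω → g x = 0) ∧
    (∀ T ∈ meshElements 𝒯, ∃ A : EuclideanSpace ℝ (Fin n) →ᵃ[ℝ] ℝ,
      ∀ x ∈ convexHull ℝ (T : Set (EuclideanSpace ℝ (Fin n))), g x = A x) ∧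
    ∀ᵐ x, fracSobolevFun v x = g x}

/-- The space `𝕄_H` of piecewise constant functions `g` on the triangulation, regarded as a
subspace of `H*` by `⟨g, v⟩ = ∫_Ω g v`. -/
def piecewiseConstant {n : ℕ} (s : ℝ) (Ω : Set (EuclideanSpace ℝ (Fin n)))
    (𝒯 : Geometry.SimplicialComplex ℝ (EuclideanSpace ℝ (Fin n))) :
    Set (StrongDual ℝ (fracSobolevZero n s Ω)) :=
  {μ | ∃ g : EuclideanSpace ℝ (Fin n) → ℝ,
    (∀ K ∈ meshElements 𝒯, ∃ c : ℝ,
      ∀ x ∈ interior (convexHull ℝ (K : Set (EuclideanSpace ℝ (Fin n)))), g x = c) ∧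
    ∀ v : fracSobolevZero n s Ω, μ v = ∫ x in Ω, g x * fracSobolevFun v x}

/-- `(u, lam) ∈ V × Λ` solves the mixed formulation on `V × Λ` with data `f ∈ H*` and `w ∈ H`; the
bilinear form `b(μ, v)` is the duality pairing `⟨μ, v⟩`. The continuous problem is the case
`V = H`, the discrete problem the case `V = 𝕍_h` and `Λ = Λ_H ⊆ 𝕄_H`. -/
structure IsMixedSolution {n : ℕ} {s : ℝ} {Ω : Set (EuclideanSpace ℝ (Fin n))}
    (V : Set (fracSobolevZero n s Ω)) (Λ : Set (StrongDual ℝ (fracSobolevZero n s Ω)))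
    (f : StrongDual ℝ (fracSobolevZero n s Ω)) (w : fracSobolevZero n s Ω)
    (u : fracSobolevZero n s Ω) (lam : StrongDual ℝ (fracSobolevZero n s Ω)) : Prop where
  mem_space : u ∈ V
  mem_multipliers : lam ∈ Λ
  equation : ∀ v ∈ V, fracForm u v + lam v = f v
  inequality : ∀ μ ∈ Λ, (μ - lam) u ≤ (μ - lam) w

/-!
Both estimates are consequences of the Galerkin identity `a(u - u_h, z) = ⟨λ_H - λ, z⟩` for
`z ∈ 𝕍_h`. The first one follows from coercivity of `a`, which is a fractional Poincaré
inequality: every point of `Ω` sees, at a bounded distance, a ball on which all functions of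
`H^s_0(Ω)` vanish. The second one follows from the inf-sup condition, that is from a Fortin
operator `H^s_0(Ω) → 𝕍_h` which is bounded in `H^s` and preserves the mean over every element of
`𝒯_H`.

The Fortin operator starts from a quasi-interpolant on `𝒯_h` whose nodal values are means over
balls of the size of the mesh. At a boundary node the ball lies outside `Ω`, so that the nodal
value vanishes. The defect in the means is then repaired by adding, in each element of `𝒯_H`, a
multiple of a bubble: a continuous function which is affine on the elements of `𝒯_h` and has its
support inside that element. Such a bubble with mass comparable to the element exists as soon as
the elements of `𝒯_h` are sufficiently small compared to those of `𝒯_H`, hence the assumption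
`H ≥ C₀ h`. Boundedness in `H^s` uses no inverse estimate: a function that is Lipschitz at the
scale of the mesh has its Gagliardo energy controlled elementwise, and the local oscillations of
`v` on that scale are controlled by the Gagliardo energy of `v`.
-/

section AbstractErrorEstimates

variable {E : Type*} [NormedAddCommGroup E] [NormedSpace ℝ E]

theorem sq_le_of_mul_sq_le {α M e X D : ℝ} (hα : 0 < α)
    (h : α * e ^ 2 ≤ M * e * X + D * X + D * e) :
    e ^ 2 ≤ 2 / α * (M ^ 2 / α + 1 / α + 1) * (X ^ 2 + D ^ 2) := by
  have young (t : ℝ) : t * e ≤ α / 4 * e ^ 2 + t ^ 2 / α := by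
    have : α / 4 * e ^ 2 + t ^ 2 / α - t * e = (α / 2 * e - t) ^ 2 / α := by field_simp; ring
    have : 0 ≤ (α / 2 * e - t) ^ 2 / α := by positivity
    linarith
  have absorbed : α / 2 * e ^ 2 ≤ (M ^ 2 / α + 1 / α + 1) * (X ^ 2 + D ^ 2) := by
    have hMX : (M * X) ^ 2 / α = M ^ 2 / α * X ^ 2 := by ring
    have hD : D ^ 2 / α = 1 / α * D ^ 2 := by ring
    have hM : 0 ≤ M ^ 2 / α * D ^ 2 := by positivity
    have hX : 0 ≤ 1 / α * X ^ 2 := by positivity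
    linarith [young (M * X), young D, two_mul_le_add_sq D X, sq_nonneg D, sq_nonneg X]
  calc e ^ 2 = 2 / α * (α / 2 * e ^ 2) := by field_simp
    _ ≤ 2 / α * ((M ^ 2 / α + 1 / α + 1) * (X ^ 2 + D ^ 2)) := by gcongr
    _ = _ := by ring

theorem exists_norm_sub_sq_le_of_galerkin (B : E →L[ℝ] E →L[ℝ] ℝ) {α : ℝ} (hα : 0 < α)
    (hB : ∀ v, α * ‖v‖ ^ 2 ≤ B v v) :
    ∃ C : ℝ, 0 < C ∧ ∀ (V : Set E) (u : E), ∀ uh ∈ V, ∀ lam lamH : StrongDual ℝ E,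
      (∀ z ∈ V, B u z + lam z = B uh z + lamH z) → ∀ vh ∈ V,
      ‖u - uh‖ ^ 2 ≤ C * (‖u - vh‖ ^ 2 + ‖lam - lamH‖ ^ 2) := by
  refine ⟨2 / α * (‖B‖ ^ 2 / α + 1 / α + 1), by positivity, fun V u uh huh lam lamH hgal vh hvh =>
    sq_le_of_mul_sq_le hα ?_⟩
  have hsplit : B (u - uh) (u - uh) =
      B (u - uh) (u - vh) + ((lam - lamH) (u - vh) - (lam - lamH) (u - uh)) := by
    simp only [sub_apply, map_sub]
    linarith [hgal uh huh, hgal vh hvh]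
  have hXe := (le_abs_self _).trans (B.le_opNorm₂ (u - uh) (u - vh))
  have hX := (le_abs_self _).trans ((lam - lamH).le_opNorm (u - vh))
  have he := (neg_le_abs _).trans ((lam - lamH).le_opNorm (u - uh))
  linarith [hB (u - uh)]

theorem exists_norm_sub_le_of_fortin (B : E →L[ℝ] E →L[ℝ] ℝ) {C : ℝ} (hC : 0 ≤ C) :
    ∃ C' : ℝ, 0 < C' ∧ ∀ (V : Set E) (M : Set (StrongDual ℝ E)),
      (∀ v, ∃ z ∈ V, ‖z‖ ≤ C * ‖v‖ ∧ ∀ μ ∈ M, μ z = μ v) →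
      ∀ (u uh : E) (lam : StrongDual ℝ E), ∀ lamH ∈ M,
      (∀ z ∈ V, B u z + lam z = B uh z + lamH z) → ∀ μH ∈ M,
      ‖lam - lamH‖ ≤ C' * (‖u - uh‖ + ‖lam - μH‖) := by
  refine ⟨1 + C * (1 + ‖B‖), by positivity,
    fun V M hfortin u uh lam lamH hlamH hgal μH hμH => ?_⟩
  have hinfsup : ‖lamH - μH‖ ≤ C * (‖B‖ * ‖u - uh‖ + ‖lam - μH‖) := by
    refine ContinuousLinearMap.opNorm_le_bound _ (by positivity) fun v => ?_
    obtain ⟨z, hz, hzv, hμ⟩ := hfortin v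
    have hsplit : (lamH - μH) v = B (u - uh) z + (lam - μH) z := by
      simp only [sub_apply, map_sub]
      linarith [hgal z hz, hμ lamH hlamH, hμ μH hμH]
    calc ‖(lamH - μH) v‖ ≤ ‖B (u - uh) z‖ + ‖(lam - μH) z‖ := hsplit ▸ norm_add_le _ _
      _ ≤ ‖B‖ * ‖u - uh‖ * ‖z‖ + ‖lam - μH‖ * ‖z‖ :=
          add_le_add (B.le_opNorm₂ _ _) ((lam - μH).le_opNorm z)
      _ = (‖B‖ * ‖u - uh‖ + ‖lam - μH‖) * ‖z‖ := by ring
      _ ≤ (‖B‖ * ‖u - uh‖ + ‖lam - μH‖) * (C * ‖v‖) := by gcongr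
      _ = _ := by ring
  have htri := norm_sub_le_norm_sub_add_norm_sub lam μH lamH
  rw [norm_sub_rev μH lamH] at htri
  have h₁ : 0 ≤ C * ‖B‖ * ‖lam - μH‖ := by positivity
  have h₂ : 0 ≤ (1 + C) * ‖u - uh‖ := by positivity
  linarith

end AbstractErrorEstimates

section Kernel

variable {n : ℕ} {s : ℝ}

/-- The Euclidean space `ℝⁿ`. -/
abbrev Euc (n : ℕ) : Type := EuclideanSpace ℝ (Fin n)

/-- The order `n + 2s` of the singularity of the Gagliardo kernel. -/
noncomputable def kernelExp (n : ℕ) (s : ℝ) : ℝ := (n : ℝ) + 2 * s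

/-- The profile `min(r², t²) / t^{n+2s}`. It dominates the Gagliardo integrand of a function with
values of size `r` that is `1`-Lipschitz, at two points with distance `t`. -/
noncomputable def truncKernel (n : ℕ) (s r t : ℝ) : ℝ := min (r ^ 2) (t ^ 2) / t ^ kernelExp n s

theorem kernelExp_pos (hs0 : 0 < s) : 0 < kernelExp n s := by
  unfold kernelExp
  positivity

theorem rpow_kernelExp {d : ℝ} (hd : 0 < d) : d ^ kernelExp n s = d ^ n * d ^ (2 * s) := by
  rw [kernelExp, Real.rpow_add hd, Real.rpow_natCast]

theorem truncKernel_nonneg (n : ℕ) (s r : ℝ) {t : ℝ} (ht : 0 ≤ t) : 0 ≤ truncKernel n s r t := by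
  unfold truncKernel
  positivity

theorem pow_mul_rpow_div_rpow_kernelExp [NeZero n] {t : ℝ} (ht : 0 < t) (a : ℝ) :
    t ^ (n - 1) * (t ^ a / t ^ kernelExp n s) = t ^ (a - 1 - 2 * s) := by
  rw [← Real.rpow_natCast t (n - 1), ← Real.rpow_sub ht, ← Real.rpow_add ht,
    Nat.cast_pred (NeZero.pos n), kernelExp]
  congr 1
  ring

theorem integrable_truncKernel_one [NeZero n] (hs0 : 0 < s) (hs1 : s < 1) :
    Integrable fun x : Euc n => truncKernel n s 1 ‖x‖ := by
  rw [integrable_fun_norm_addHaar volume (f := truncKernel n s 1), finrank_euclideanSpace_fin,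
    ← Set.Ioc_union_Ioi_eq_Ioi (zero_le_one' ℝ)]
  refine IntegrableOn.union ?_ ?_
  · have hrpow : IntegrableOn (fun t : ℝ => t ^ (2 - 1 - 2 * s)) (Set.Ioc 0 1) := by
      rw [← intervalIntegrable_iff_integrableOn_Ioc_of_le zero_le_one]
      exact intervalIntegral.intervalIntegrable_rpow' (by linarith)
    refine hrpow.congr_fun (fun t ht => ?_) measurableSet_Ioc
    have hmin : min ((1 : ℝ) ^ 2) (t ^ 2) = t ^ (2 : ℝ) := by
      rw [min_eq_right (pow_le_pow_left₀ ht.1.le ht.2 2), Real.rpow_two]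
    simp only [truncKernel, smul_eq_mul, hmin, pow_mul_rpow_div_rpow_kernelExp ht.1]
  · have hrpow : IntegrableOn (fun t : ℝ => t ^ (0 - 1 - 2 * s)) (Set.Ioi 1) :=
      integrableOn_Ioi_rpow_of_lt (by linarith) zero_lt_one
    refine hrpow.congr_fun (fun t (ht : 1 < t) => ?_) measurableSet_Ioi
    have hmin : min ((1 : ℝ) ^ 2) (t ^ 2) = t ^ (0 : ℝ) := by
      rw [min_eq_left (pow_le_pow_left₀ zero_le_one ht.le 2), Real.rpow_zero, one_pow]
    simp only [truncKernel, smul_eq_mul, hmin,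
      pow_mul_rpow_div_rpow_kernelExp (zero_lt_one.trans ht)]

theorem truncKernel_eq_rpow_mul {r t : ℝ} (hr : 0 < r) (ht : 0 ≤ t) :
    truncKernel n s r t = r ^ (2 - kernelExp n s) * truncKernel n s 1 (r⁻¹ * t) := by
  have hmin : min ((1 : ℝ) ^ 2) ((r⁻¹ * t) ^ 2) = (r ^ 2)⁻¹ * min (r ^ 2) (t ^ 2) := by
    rw [mul_min_of_nonneg _ _ (by positivity)]
    congr 1 <;> field_simp
  rw [truncKernel, truncKernel, hmin, Real.mul_rpow (by positivity) ht, Real.inv_rpow hr.le,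
    Real.rpow_sub hr, Real.rpow_two]
  have : 0 < r ^ kernelExp n s := by positivity
  field_simp

theorem exists_lintegral_truncKernel_le [NeZero n] (hs0 : 0 < s) (hs1 : s < 1) :
    ∃ C : ℝ, 0 < C ∧ ∀ r : ℝ, 0 < r → ∀ x : Euc n,
      ∫⁻ y, ENNReal.ofReal (truncKernel n s r ‖x - y‖) ≤ ENNReal.ofReal (C * r ^ (2 - 2 * s)) := by
  have hone := integrable_truncKernel_one (n := n) hs0 hs1
  set J := ∫ x : Euc n, truncKernel n s 1 ‖x‖
  have hJ : 0 ≤ J := integral_nonneg fun x => truncKernel_nonneg _ _ _ (norm_nonneg _)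
  refine ⟨J + 1, by linarith, fun r hr x => ?_⟩
  have hscale (z : Euc n) : truncKernel n s r ‖z‖ =
      r ^ (2 - kernelExp n s) * truncKernel n s 1 ‖r⁻¹ • z‖ := by
    rw [truncKernel_eq_rpow_mul hr (norm_nonneg z), norm_smul, norm_inv,
      Real.norm_of_nonneg hr.le]
  have hintr : Integrable fun z : Euc n => truncKernel n s r ‖z‖ := by
    simp_rw [hscale]
    exact (hone.comp_smul (inv_ne_zero hr.ne')).const_mul _
  have hvalue : ∫ z : Euc n, truncKernel n s r ‖z‖ = J * r ^ (2 - 2 * s) := by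
    simp_rw [hscale]
    rw [integral_const_mul, Measure.integral_comp_inv_smul_of_nonneg volume
      (fun z : Euc n => truncKernel n s 1 ‖z‖) hr.le, finrank_euclideanSpace_fin, smul_eq_mul,
      ← mul_assoc, ← Real.rpow_natCast r n, ← Real.rpow_add hr, mul_comm, kernelExp]
    congr 2
    ring
  rw [lintegral_sub_left_eq_self (fun z : Euc n => ENNReal.ofReal (truncKernel n s r ‖z‖)) x,
    ← ofReal_integral_eq_lintegral_ofReal hintr
      (.of_forall fun z => truncKernel_nonneg _ _ _ (norm_nonneg _)), hvalue]
  gcongr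
  linarith

end Kernel

section Gagliardo

variable {n : ℕ} {s : ℝ} {u v : Euc n → ℝ}

/-- The inner integral `∫ (v(x) - v(y))² / |x - y|^{n+2s} dy` of the Gagliardo seminorm at `x`. -/
noncomputable def gagliardoAt (s : ℝ) (v : Euc n → ℝ) (x : Euc n) : ENNReal :=
  ∫⁻ y, ENNReal.ofReal ((v x - v y) ^ 2 / ‖x - y‖ ^ kernelExp n s)

/-- The square of the Gagliardo seminorm of order `s`. -/
noncomputable def gagliardo (s : ℝ) (v : Euc n → ℝ) : ENNReal :=
  ∫⁻ x, gagliardoAt s v x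

theorem measurable_gagliardo_integrand (s : ℝ) (hv : Measurable v) :
    Measurable fun p : Euc n × Euc n =>
      ENNReal.ofReal ((v p.1 - v p.2) ^ 2 / ‖p.1 - p.2‖ ^ kernelExp n s) := by
  fun_prop

theorem measurable_gagliardoAt (s : ℝ) (hv : Measurable v) : Measurable (gagliardoAt s v) :=
  (measurable_gagliardo_integrand s hv).lintegral_prod_right'

theorem gagliardo_congr_ae (s : ℝ) (h : u =ᵐ[volume] v) : gagliardo s u = gagliardo s v := by
  refine lintegral_congr_ae ?_
  filter_upwards [h] with x hx
  refine lintegral_congr_ae ?_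
  filter_upwards [h] with y hy
  rw [hx, hy]

theorem fracQuotient_mul_fracQuotient (s : ℝ) (u v : Euc n → ℝ) (p : Euc n × Euc n) :
    fracQuotient n s u p * fracQuotient n s v p =
      (u p.1 - u p.2) * (v p.1 - v p.2) / ‖p.1 - p.2‖ ^ kernelExp n s := by
  unfold fracQuotient kernelExp
  rw [div_mul_div_comm, ← sq (_ ^ _), ← Real.rpow_mul_natCast (norm_nonneg _)]
  congr 2
  push_cast
  ring

theorem gagliardo_eq_lintegral_fracQuotient (s : ℝ) (hv : Measurable v) :
    gagliardo s v = ∫⁻ p, ENNReal.ofReal (fracQuotient n s v p ^ 2) := by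
  simp_rw [sq (fracQuotient _ _ _ _), fracQuotient_mul_fracQuotient, ← sq]
  rw [Measure.volume_eq_prod, lintegral_prod _ (measurable_gagliardo_integrand s hv).aemeasurable]
  rfl

theorem gagliardo_const_smul (c : ℝ) (s : ℝ) (v : Euc n → ℝ) :
    gagliardo s (c • v) = ENNReal.ofReal (c ^ 2) * gagliardo s v := by
  have hintegrand (x y : Euc n) :
      ENNReal.ofReal (((c • v) x - (c • v) y) ^ 2 / ‖x - y‖ ^ kernelExp n s) =
        ENNReal.ofReal (c ^ 2) *
          ENNReal.ofReal ((v x - v y) ^ 2 / ‖x - y‖ ^ kernelExp n s) := by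
    rw [← ENNReal.ofReal_mul (sq_nonneg c), Pi.smul_apply, Pi.smul_apply, ← smul_sub, smul_eq_mul,
      mul_pow, mul_div_assoc]
  simp only [gagliardo, gagliardoAt, hintegrand, lintegral_const_mul' _ _ ENNReal.ofReal_ne_top]

theorem setLIntegral_sq_sub_le_gagliardoAt (hs0 : 0 < s) (v : Euc n → ℝ) (x : Euc n)
    {B : Set (Euc n)} (hB : MeasurableSet B) {D : ℝ} (hD : B ⊆ Metric.closedBall x D) :
    ∫⁻ y in B, ENNReal.ofReal ((v x - v y) ^ 2) ≤
      ENNReal.ofReal (D ^ kernelExp n s) * gagliardoAt s v x := by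
  rw [gagliardoAt, ← lintegral_const_mul' _ _ ENNReal.ofReal_ne_top]
  refine (setLIntegral_mono' hB fun y hy => ?_).trans (setLIntegral_le_lintegral B _)
  have hxy : ‖x - y‖ ≤ D := by
    rw [← dist_eq_norm, dist_comm]
    exact hD hy
  have : 0 ≤ D := (norm_nonneg _).trans hxy
  rw [← ENNReal.ofReal_mul (by positivity)]
  gcongr
  rcases eq_or_ne x y with rfl | hne
  · simp
  have hpos : 0 < ‖x - y‖ := norm_pos_iff.2 (sub_ne_zero.2 hne)
  have hle : ‖x - y‖ ^ kernelExp n s ≤ D ^ kernelExp n s :=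
    Real.rpow_le_rpow hpos.le hxy (kernelExp_pos hs0).le
  rw [mul_div_assoc', le_div_iff₀ (by positivity), mul_comm]
  gcongr

theorem sq_sub_average_le_average_sq_sub {α : Type*} [MeasurableSpace α] {μ : Measure α}
    [IsFiniteMeasure μ] [NeZero μ] {f : α → ℝ} (hf : MemLp f 2 μ) (c : ℝ) :
    (c - ⨍ y, f y ∂μ) ^ 2 ≤ ⨍ y, (c - f y) ^ 2 ∂μ := by
  have hconv : ConvexOn ℝ Set.univ fun t : ℝ => (c - t) ^ 2 :=
    (even_two.convexOn_pow (𝕜 := ℝ)).comp_affineMap (AffineMap.const ℝ ℝ c - AffineMap.id ℝ ℝ)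
  exact hconv.map_average_le (by fun_prop) isClosed_univ (by simp) (hf.integrable (by norm_num))
    ((memLp_const c).sub hf).integrable_sq

/-- The volume of the unit ball of `ℝⁿ`, as a real number. -/
noncomputable def unitBallVol (n : ℕ) : ℝ := volume.real (Metric.ball (0 : Euc n) 1)

theorem unitBallVol_pos (n : ℕ) : 0 < unitBallVol n :=
  ENNReal.toReal_pos (Metric.measure_ball_pos _ _ one_pos).ne' measure_ball_lt_top.ne

theorem volume_ball_eq (b : Euc n) {ρ : ℝ} (hρ : 0 < ρ) :
    volume (Metric.ball b ρ) = ENNReal.ofReal (unitBallVol n * ρ ^ n) := by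
  rw [Measure.addHaar_ball_of_pos _ _ hρ, finrank_euclideanSpace_fin, mul_comm, unitBallVol,
    ENNReal.ofReal_mul measureReal_nonneg, ofReal_measureReal measure_ball_lt_top.ne]

theorem sq_sub_average_ball_le_gagliardoAt (hs0 : 0 < s) (hv : MemLp v 2 volume) (x b : Euc n)
    {ρ D : ℝ} (hρ : 0 < ρ) (hD : Metric.ball b ρ ⊆ Metric.closedBall x D) :
    ENNReal.ofReal ((v x - ⨍ y in Metric.ball b ρ, v y) ^ 2) ≤
      ENNReal.ofReal (D ^ kernelExp n s / (unitBallVol n * ρ ^ n)) * gagliardoAt s v x := by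
  have hpos : 0 < unitBallVol n * ρ ^ n := mul_pos (unitBallVol_pos n) (pow_pos hρ n)
  have : IsFiniteMeasure (volume.restrict (Metric.ball b ρ)) :=
    isFiniteMeasure_restrict.2 measure_ball_lt_top.ne
  have : NeZero (volume.restrict (Metric.ball b ρ)) :=
    ⟨by rw [Ne, Measure.restrict_eq_zero]; exact (Metric.measure_ball_pos _ _ hρ).ne'⟩
  have hvB : MemLp v 2 (volume.restrict (Metric.ball b ρ)) := hv.restrict _
  refine (ENNReal.ofReal_le_ofReal (sq_sub_average_le_average_sq_sub hvB (v x))).trans ?_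
  have hreal : volume.real (Metric.ball b ρ) = unitBallVol n * ρ ^ n := by
    rw [Measure.real, volume_ball_eq b hρ, ENNReal.toReal_ofReal hpos.le]
  have : 0 ≤ D := dist_nonneg.trans (hD (Metric.mem_ball_self hρ))
  have hsq : IntegrableOn (fun y => (v x - v y) ^ 2) (Metric.ball b ρ) :=
    ((memLp_const (v x)).sub hvB).integrable_sq
  rw [setAverage_eq, hreal, smul_eq_mul, ENNReal.ofReal_mul (by positivity),
    div_eq_inv_mul, ENNReal.ofReal_mul (by positivity), mul_assoc,
    ofReal_integral_eq_lintegral_ofReal hsq (.of_forall fun y => sq_nonneg _)]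
  gcongr
  exact setLIntegral_sq_sub_le_gagliardoAt hs0 v x measurableSet_ball hD

end Gagliardo

section SobolevSpace

variable {n : ℕ} {s : ℝ} {Ω : Set (Euc n)}

theorem measurable_fracSobolevFun (v : fracSobolevZero n s Ω) : Measurable (fracSobolevFun v) :=
  (Lp.stronglyMeasurable _).measurable

theorem memLp_fracSobolevFun (v : fracSobolevZero n s Ω) : MemLp (fracSobolevFun v) 2 volume :=
  Lp.memLp _

theorem fracSobolevFun_ae_eq_zero (v : fracSobolevZero n s Ω) :
    ∀ᵐ x, x ∉ Ω → fracSobolevFun v x = 0 :=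
  v.2.1

theorem snd_ae_eq_fracQuotient (v : fracSobolevZero n s Ω) :
    (v : FracAmbient n).snd =ᵐ[volume] fracQuotient n s (fracSobolevFun v) :=
  v.2.2

theorem exists_representative (hΩ : MeasurableSet Ω) (v : fracSobolevZero n s Ω) :
    ∃ v' : Euc n → ℝ, Measurable v' ∧ MemLp v' 2 volume ∧ (∀ x, x ∉ Ω → v' x = 0) ∧
      fracSobolevFun v =ᵐ[volume] v' := by
  have hae : fracSobolevFun v =ᵐ[volume] Ω.indicator (fracSobolevFun v) := by
    filter_upwards [fracSobolevFun_ae_eq_zero v] with x hx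
    by_cases hxΩ : x ∈ Ω
    · rw [Set.indicator_of_mem hxΩ]
    · rw [Set.indicator_of_notMem hxΩ, hx hxΩ]
  exact ⟨Ω.indicator (fracSobolevFun v), (measurable_fracSobolevFun v).indicator hΩ,
    (memLp_fracSobolevFun v).ae_eq hae, fun x hx => Set.indicator_of_notMem hx _, hae⟩

theorem ofReal_norm_sq_Lp_two {α : Type*} [MeasurableSpace α] {μ : Measure α} (f : Lp ℝ 2 μ) :
    ENNReal.ofReal (‖f‖ ^ 2) = ∫⁻ x, ENNReal.ofReal (f x ^ 2) ∂μ := by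
  rw [← real_inner_self_eq_norm_sq, L2.inner_def,
    ofReal_integral_eq_lintegral_ofReal (L2.integrable_inner f f)
      (.of_forall fun x => real_inner_self_nonneg)]
  simp only [real_inner_self_eq_norm_sq, Real.norm_eq_abs, sq_abs]

theorem memLp_two_of_lintegral_sq_lt_top {α : Type*} [MeasurableSpace α] {μ : Measure α}
    {f : α → ℝ} (hf : AEStronglyMeasurable f μ) (h : ∫⁻ x, ENNReal.ofReal (f x ^ 2) ∂μ < ⊤) :
    MemLp f 2 μ := by
  rw [memLp_two_iff_integrable_sq hf]
  exact ⟨hf.pow 2, (hasFiniteIntegral_iff_ofReal (.of_forall fun x => sq_nonneg _)).2 h⟩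

theorem ofReal_norm_snd_sq (v : fracSobolevZero n s Ω) :
    ENNReal.ofReal (‖(v : FracAmbient n).snd‖ ^ 2) = gagliardo s (fracSobolevFun v) := by
  rw [ofReal_norm_sq_Lp_two, gagliardo_eq_lintegral_fracQuotient s (measurable_fracSobolevFun v)]
  refine lintegral_congr_ae ?_
  filter_upwards [snd_ae_eq_fracQuotient v] with p hp
  rw [hp]

theorem ofReal_norm_sq_of_ae_eq {v : fracSobolevZero n s Ω} {g : Euc n → ℝ}
    (h : fracSobolevFun v =ᵐ[volume] g) :
    ENNReal.ofReal (‖v‖ ^ 2) = (∫⁻ x, ENNReal.ofReal (g x ^ 2)) + gagliardo s g := by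
  rw [← Submodule.norm_coe, WithLp.prod_norm_sq_eq_of_L2,
    ENNReal.ofReal_add (sq_nonneg _) (sq_nonneg _), ofReal_norm_snd_sq, gagliardo_congr_ae s h]
  congr 1
  refine (ofReal_norm_sq_Lp_two _).trans (lintegral_congr_ae ?_)
  filter_upwards [h] with x hx
  rw [← hx, fracSobolevFun]

theorem exists_fracSobolevFun_ae_eq {g : Euc n → ℝ} (hg : MemLp g 2 volume)
    (hq : MemLp (fracQuotient n s g) 2 volume) (h0 : ∀ x, x ∉ Ω → g x = 0) :
    ∃ v : fracSobolevZero n s Ω, fracSobolevFun v =ᵐ[volume] g := by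
  have hg' := hg.coeFn_toLp
  refine ⟨⟨WithLp.toLp 2 (hg.toLp g, hq.toLp _), ?_, ?_⟩, hg'⟩
  · filter_upwards [hg'] with x hx hxΩ
    exact hx.trans (h0 x hxΩ)
  · filter_upwards [hq.coeFn_toLp, Measure.quasiMeasurePreserving_fst.ae hg',
      Measure.quasiMeasurePreserving_snd.ae hg'] with p hp h₁ h₂
    refine hp.trans ?_
    change _ = (hg.toLp g p.1 - hg.toLp g p.2) / _
    rw [h₁, h₂]
    rfl

theorem exists_fracSobolevZero_of_energy_le {g : Euc n → ℝ} (hg : Measurable g)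
    (h0 : ∀ x, x ∉ Ω → g x = 0) {C : ℝ} (hC : 0 ≤ C)
    (h : (∫⁻ x, ENNReal.ofReal (g x ^ 2)) + gagliardo s g ≤ ENNReal.ofReal C) :
    ∃ v : fracSobolevZero n s Ω, fracSobolevFun v =ᵐ[volume] g ∧ ‖v‖ ^ 2 ≤ C := by
  have hfin := h.trans_lt ENNReal.ofReal_lt_top
  have hqm : Measurable (fracQuotient n s g) := by unfold fracQuotient; fun_prop
  have hq : ∫⁻ p, ENNReal.ofReal (fracQuotient n s g p ^ 2) < ⊤ := by
    rw [← gagliardo_eq_lintegral_fracQuotient s hg]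
    exact le_add_self.trans_lt hfin
  obtain ⟨v, hv⟩ := exists_fracSobolevFun_ae_eq
    (memLp_two_of_lintegral_sq_lt_top hg.aestronglyMeasurable (le_self_add.trans_lt hfin))
    (memLp_two_of_lintegral_sq_lt_top hqm.aestronglyMeasurable hq) h0
  rw [← ofReal_norm_sq_of_ae_eq hv, ENNReal.ofReal_le_ofReal_iff hC] at h
  exact ⟨v, hv, h⟩

theorem fracConst_pos (hs0 : 0 < s) (hs1 : s < 1) : 0 < fracConst n s := by
  have : 0 < Real.Gamma (((n : ℝ) + 2 * s) / 2) := Real.Gamma_pos_of_pos (by positivity)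
  have : 0 < Real.Gamma (1 - s) := Real.Gamma_pos_of_pos (by linarith)
  unfold fracConst
  positivity

/-- The map sending `v ∈ H^s_0(Ω)` to its fractional difference quotient in `L²(ℝⁿ × ℝⁿ)`. -/
noncomputable def fracGradient (n : ℕ) (s : ℝ) (Ω : Set (Euc n)) :
    fracSobolevZero n s Ω →L[ℝ] Lp ℝ 2 (volume : Measure (Euc n × Euc n)) :=
  WithLp.sndL 2 ℝ _ _ ∘L (fracSobolevZero n s Ω).subtypeL

/-- The bilinear form `fracForm` as a bounded bilinear form on `H^s_0(Ω)`. The domain of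
integration in `fracForm` may be replaced by `ℝⁿ × ℝⁿ`, so that it is an inner product in
`L²(ℝⁿ × ℝⁿ)`. -/
noncomputable def fracFormL (n : ℕ) (s : ℝ) (Ω : Set (Euc n)) :
    fracSobolevZero n s Ω →L[ℝ] fracSobolevZero n s Ω →L[ℝ] ℝ :=
  (fracConst n s / 2) • (innerSL ℝ).bilinearComp (fracGradient n s Ω) (fracGradient n s Ω)

theorem fracFormL_apply (u v : fracSobolevZero n s Ω) : fracFormL n s Ω u v = fracForm u v := by
  change fracConst n s / 2 * inner ℝ (u : FracAmbient n).snd (v : FracAmbient n).snd = _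
  rw [fracForm, L2.inner_def, setIntegral_eq_integral_of_ae_compl_eq_zero]
  · congr 1
    refine integral_congr_ae ?_
    filter_upwards [snd_ae_eq_fracQuotient u, snd_ae_eq_fracQuotient v] with p hu hv
    rw [hu, hv, RCLike.inner_apply', conj_trivial, fracQuotient_mul_fracQuotient]
    rfl
  · filter_upwards [Measure.quasiMeasurePreserving_fst.ae (fracSobolevFun_ae_eq_zero u),
      Measure.quasiMeasurePreserving_snd.ae (fracSobolevFun_ae_eq_zero u)] with p h₁ h₂ hp
    rw [h₁ fun h => hp (.inl h), h₂ fun h => hp (.inr h), sub_zero, zero_mul, zero_div]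

theorem fracFormL_self (v : fracSobolevZero n s Ω) :
    fracFormL n s Ω v v = fracConst n s / 2 * ‖(v : FracAmbient n).snd‖ ^ 2 := by
  rw [← real_inner_self_eq_norm_sq]
  rfl

end SobolevSpace

section ExteriorBalls

/-- `Ω` has exterior balls at the points of `A`, with ratio `θ` and up to the scale `t₀`: for
`p ∈ A` and `t ≤ t₀`, the ball of radius `t` about `p` contains a ball of radius `θ t` disjoint from
`Ω`. -/
def HasExteriorBalls {X : Type*} [PseudoMetricSpace X] (Ω A : Set X) (θ t₀ : ℝ) : Prop :=
  ∀ p ∈ A, ∀ t, 0 < t → t ≤ t₀ → ∃ b, Metric.ball b (θ * t) ⊆ Metric.closedBall p t \ Ω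

/-- A bounded open set with exterior balls at its frontier, of size comparable to the scale (the
exterior corkscrew condition). Among the properties of a Lipschitz domain, these are the ones that
the error analysis needs. -/
structure IsCorkscrewDomain {X : Type*} [PseudoMetricSpace X] (Ω : Set X) : Prop where
  isOpen : IsOpen Ω
  isBounded : Bornology.IsBounded Ω
  exterior : ∃ θ > 0, ∃ t₀ > 0, HasExteriorBalls Ω (frontier Ω) θ t₀

section Metric

variable {X : Type*} [PseudoMetricSpace X] {Ω A B : Set X} {θ θ' t₀ t₀' R : ℝ}

theorem HasExteriorBalls.mono (h : HasExteriorBalls Ω A θ t₀) (hBA : B ⊆ A) (hθ : θ' ≤ θ)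
    (ht₀ : t₀' ≤ t₀) : HasExteriorBalls Ω B θ' t₀' := by
  intro p hp t ht htt
  obtain ⟨b, hb⟩ := h p (hBA hp) t ht (htt.trans ht₀)
  exact ⟨b, (Metric.ball_subset_ball (by gcongr)).trans hb⟩

theorem HasExteriorBalls.union (hA : HasExteriorBalls Ω A θ t₀)
    (hB : HasExteriorBalls Ω B θ t₀) : HasExteriorBalls Ω (A ∪ B) θ t₀ := by
  rintro p (hp | hp)
  exacts [hA p hp, hB p hp]

theorem HasExteriorBalls.rescale (h : HasExteriorBalls Ω A θ t₀) (ht₀ : 0 < t₀) (hR : 0 < R) :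
    HasExteriorBalls Ω A (θ * min 1 (t₀ / R)) R := by
  intro p hp t ht htR
  set m := min 1 (t₀ / R)
  have : 0 < m := by positivity
  have hmt : m * t ≤ t₀ := by
    calc m * t ≤ t₀ / R * R := by gcongr; exact min_le_right _ _
      _ = t₀ := by field_simp
  obtain ⟨b, hb⟩ := h p hp (m * t) (by positivity) hmt
  rw [← mul_assoc] at hb
  have hmt' : m * t ≤ t := mul_le_of_le_one_left ht.le (min_le_left _ _)
  exact ⟨b, hb.trans (Set.sdiff_subset_sdiff_left (Metric.closedBall_subset_closedBall hmt'))⟩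

theorem exists_hasExteriorBalls_of_isCompact (hA : IsCompact A)
    (h : ∀ z ∈ A, ∃ r > 0, ∃ θ > 0, ∃ t₀ > 0, HasExteriorBalls Ω (A ∩ Metric.ball z r) θ t₀) :
    ∃ θ > 0, ∃ t₀ > 0, HasExteriorBalls Ω A θ t₀ := by
  refine hA.induction_on (p := fun A => ∃ θ > 0, ∃ t₀ > 0, HasExteriorBalls Ω A θ t₀) ?_ ?_ ?_ ?_
  · exact ⟨1, one_pos, 1, one_pos, fun p hp => absurd hp (Set.notMem_empty p)⟩
  · rintro A B hAB ⟨θ, hθ, t₀, ht₀, hB⟩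
    exact ⟨θ, hθ, t₀, ht₀, hB.mono hAB le_rfl le_rfl⟩
  · rintro A B ⟨θ, hθ, t₀, ht₀, hA⟩ ⟨θ', hθ', t₀', ht₀', hB⟩
    exact ⟨min θ θ', lt_min hθ hθ', min t₀ t₀', lt_min ht₀ ht₀',
      (hA.mono subset_rfl (min_le_left _ _) (min_le_left _ _)).union
        (hB.mono subset_rfl (min_le_right _ _) (min_le_right _ _))⟩
  · intro z hz
    obtain ⟨r, hr, hball⟩ := h z hz
    exact ⟨A ∩ Metric.ball z r, inter_mem_nhdsWithin A (Metric.ball_mem_nhds z hr), hball⟩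

namespace IsCorkscrewDomain

theorem exists_hasExteriorBalls (hΩ : IsCorkscrewDomain Ω) (hR : 0 < R) :
    ∃ θ > 0, HasExteriorBalls Ω (frontier Ω) θ R := by
  obtain ⟨θ, hθ, t₀, ht₀, h⟩ := hΩ.exterior
  exact ⟨θ * min 1 (t₀ / R), by positivity, h.rescale ht₀ hR⟩

theorem interior_closure_subset (hΩ : IsCorkscrewDomain Ω) : interior (closure Ω) ⊆ Ω := by
  intro z hz
  by_contra hzΩ
  have hzf : z ∈ frontier Ω := ⟨interior_subset hz, fun h => hzΩ (interior_subset h)⟩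
  obtain ⟨ε, hε, hclosure⟩ :=
    Metric.nhds_basis_closedBall.mem_iff.1 (mem_interior_iff_mem_nhds.1 hz)
  obtain ⟨θ, hθ, h⟩ := hΩ.exists_hasExteriorBalls hε
  obtain ⟨b, hb⟩ := h z hzf ε hε le_rfl
  have hbb : b ∈ Metric.ball b (θ * ε) := Metric.mem_ball_self (by positivity)
  obtain ⟨y, hy, hyΩ⟩ := mem_closure_iff.1 (hclosure (hb hbb).1) _ Metric.isOpen_ball hbb
  exact (hb hy).2 hyΩ

theorem exists_dist_le (hΩ : IsCorkscrewDomain Ω) :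
    ∃ R : ℝ, 0 < R ∧ ∀ x ∈ closure Ω, ∀ y ∈ closure Ω, dist x y ≤ R := by
  obtain ⟨C, hC⟩ := Metric.isBounded_iff.1 hΩ.isBounded.closure
  exact ⟨max C 1, by positivity, fun x hx y hy => (hC hx hy).trans (le_max_left _ _)⟩

end IsCorkscrewDomain

end Metric

section Normed

variable {E : Type*} [NormedAddCommGroup E] [NormedSpace ℝ E] [Nontrivial E] {Ω : Set E} {x : E}

namespace IsCorkscrewDomain

theorem compl_nonempty (hΩ : IsCorkscrewDomain Ω) : Ωᶜ.Nonempty := by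
  rw [Set.nonempty_compl]
  rintro rfl
  exact NormedSpace.unbounded_univ ℝ E hΩ.isBounded

theorem infDist_compl_pos (hΩ : IsCorkscrewDomain Ω) (hx : x ∈ Ω) : 0 < Metric.infDist x Ωᶜ := by
  rwa [← hΩ.isOpen.isClosed_compl.notMem_iff_infDist_pos hΩ.compl_nonempty, Set.notMem_compl_iff]

theorem exists_mem_frontier_dist_eq [ProperSpace E] (hΩ : IsCorkscrewDomain Ω) (hx : x ∈ Ω) :
    ∃ p ∈ frontier Ω, dist x p = Metric.infDist x Ωᶜ := by
  obtain ⟨p, hp, hpd⟩ := hΩ.isOpen.isClosed_compl.exists_infDist_eq_dist hΩ.compl_nonempty x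
  have hball : p ∈ closure (Metric.ball x (Metric.infDist x Ωᶜ)) := by
    rw [closure_ball _ (hΩ.infDist_compl_pos hx).ne', Metric.mem_closedBall, dist_comm]
    exact hpd.symm.le
  exact ⟨p, ⟨closure_mono Metric.ball_infDist_compl_subset hball, fun h => hp (interior_subset h)⟩,
    hpd.symm⟩

end IsCorkscrewDomain

end Normed

section Lipschitz

variable {E : Type*} [NormedAddCommGroup E] [InnerProductSpace ℝ E] {Ω : Set E} {ν : E} {L : NNReal}
  {φ : E → ℝ}

theorem norm_sub_inner_smul_le (hν : ‖ν‖ = 1) (w : E) : ‖w - inner ℝ w ν • ν‖ ≤ ‖w‖ := by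
  refine le_of_sq_le_sq ?_ (norm_nonneg _)
  rw [norm_sub_sq_real, real_inner_smul_right, norm_smul, hν, mul_one, Real.norm_eq_abs, sq_abs]
  nlinarith [sq_nonneg (inner ℝ w ν)]

theorem height_sub_graph_le (hν : ‖ν‖ = 1) (hφ : LipschitzWith L φ) (p w : E) (t : ℝ) :
    inner ℝ (p - t • ν + w) ν - φ (p - t • ν + w - inner ℝ (p - t • ν + w) ν • ν) ≤
      inner ℝ p ν - φ (p - inner ℝ p ν • ν) + (1 + L) * ‖w‖ - t := by
  have hinner : inner ℝ (p - t • ν + w) ν = inner ℝ p ν - t + inner ℝ w ν := by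
    rw [inner_add_left, inner_sub_left, real_inner_smul_left, real_inner_self_eq_norm_sq, hν,
      one_pow, mul_one]
  have hw : inner ℝ w ν ≤ ‖w‖ := by simpa [hν] using real_inner_le_norm w ν
  have hfoot : p - t • ν + w - inner ℝ (p - t • ν + w) ν • ν =
      p - inner ℝ p ν • ν + (w - inner ℝ w ν • ν) := by
    rw [hinner]
    module
  have hgraph := hφ.dist_le_mul (p - inner ℝ p ν • ν + (w - inner ℝ w ν • ν)) (p - inner ℝ p ν • ν)
  rw [dist_self_add_left, Real.dist_eq] at hgraph
  have hproj : L * ‖w - inner ℝ w ν • ν‖ ≤ L * ‖w‖ := by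
    gcongr
    exact norm_sub_inner_smul_le hν w
  rw [hfoot, hinner]
  linarith [(abs_le.1 hgraph).1]

theorem hasExteriorBalls_of_graph {z : E} {r : ℝ} (hν : ‖ν‖ = 1) (hφ : LipschitzWith L φ)
    (hgraph : ∀ x ∈ Metric.ball z r, x ∈ Ω ↔ φ (x - inner ℝ x ν • ν) < inner ℝ x ν) :
    HasExteriorBalls Ω (Ωᶜ ∩ Metric.ball z (r / 2)) (1 / (2 * (1 + L))) (r / 2) := by
  rintro p ⟨hp, hpz⟩ t ht htr
  refine ⟨p - (t / 2) • ν, fun y hy => ?_⟩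
  obtain ⟨w, rfl⟩ : ∃ w, y = p - (t / 2) • ν + w := ⟨y - (p - (t / 2) • ν), by abel⟩
  have hw : (1 + L) * ‖w‖ < t / 2 := by
    rw [mem_ball_iff_norm, add_sub_cancel_left, one_div, inv_mul_eq_div,
      lt_div_iff₀ (by positivity)] at hy
    linarith
  have hdist : dist (p - (t / 2) • ν + w) p ≤ t := by
    have hw' : ‖w‖ ≤ (1 + L) * ‖w‖ := le_mul_of_one_le_left (norm_nonneg w) (by simp)
    calc dist (p - (t / 2) • ν + w) p = ‖w - (t / 2) • ν‖ := by rw [dist_eq_norm]; congr 1; abel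
      _ ≤ ‖w‖ + ‖(t / 2) • ν‖ := norm_sub_le _ _
      _ = ‖w‖ + t / 2 := by rw [norm_smul, hν, mul_one, Real.norm_of_nonneg (by positivity)]
      _ ≤ t := by linarith
  refine ⟨hdist, fun hmem => ?_⟩
  rw [Metric.mem_ball] at hpz
  have hbelow : inner ℝ p ν ≤ φ (p - inner ℝ p ν • ν) :=
    le_of_not_gt fun h => hp ((hgraph p (by rw [Metric.mem_ball]; linarith)).2 h)
  have habove := (hgraph (p - (t / 2) • ν + w) (by
    rw [Metric.mem_ball]
    linarith [dist_triangle (p - (t / 2) • ν + w) p z])).1 hmem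
  linarith [height_sub_graph_le hν hφ p w (t / 2)]

theorem IsBoundedLipschitzDomain.isCorkscrewDomain {n : ℕ} {Ω : Set (Euc n)}
    (hΩ : IsBoundedLipschitzDomain Ω) : IsCorkscrewDomain Ω := by
  have hcompact : IsCompact (frontier Ω) := Metric.isCompact_of_isClosed_isBounded
    isClosed_frontier (hΩ.isBounded.closure.subset frontier_subset_closure)
  refine ⟨hΩ.isOpen, hΩ.isBounded, exists_hasExteriorBalls_of_isCompact hcompact fun z hz => ?_⟩
  obtain ⟨r, hr, ν, hν, L, φ, hφ, hgraph⟩ := hΩ.graph z hz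
  have hfrontier : frontier Ω ⊆ Ωᶜ := fun p hp hpΩ =>
    hp.2 (by rwa [hΩ.isOpen.interior_eq])
  exact ⟨r / 2, by positivity, 1 / (2 * (1 + L)), by positivity, r / 2, by positivity,
    (hasExteriorBalls_of_graph hν hφ hgraph).mono (Set.inter_subset_inter_left _ hfrontier) le_rfl
      le_rfl⟩

end Lipschitz

end ExteriorBalls

section HardyPoincare

variable {n : ℕ} [NeZero n] {s : ℝ} {Ω : Set (Euc n)}

theorem exists_hardy (hΩ : IsCorkscrewDomain Ω) (hs0 : 0 < s) :
    ∃ C : ℝ, 0 < C ∧ ∀ v : Euc n → ℝ, MemLp v 2 volume → (∀ x, x ∉ Ω → v x = 0) → ∀ x ∈ Ω,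
      ENNReal.ofReal (v x ^ 2) ≤
        ENNReal.ofReal (C * Metric.infDist x Ωᶜ ^ (2 * s)) * gagliardoAt s v x := by
  obtain ⟨R, hR, hdiam⟩ := hΩ.exists_dist_le
  obtain ⟨θ, hθ, hext⟩ := hΩ.exists_hasExteriorBalls hR
  have hω := unitBallVol_pos n
  refine ⟨2 ^ kernelExp n s / (unitBallVol n * θ ^ n), by positivity, fun v hv hv0 x hx => ?_⟩
  obtain ⟨p, hp, hpd⟩ := hΩ.exists_mem_frontier_dist_eq hx
  have hd := hΩ.infDist_compl_pos hx
  set d := Metric.infDist x Ωᶜ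
  obtain ⟨b, hb⟩ := hext p hp d hd
    (hpd ▸ hdiam x (subset_closure hx) p (frontier_subset_closure hp))
  have hball : Metric.ball b (θ * d) ⊆ Metric.closedBall x (2 * d) := by
    refine (hb.trans Set.sdiff_subset).trans (Metric.closedBall_subset_closedBall' ?_)
    rw [dist_comm, hpd, two_mul]
  have haverage : ⨍ y in Metric.ball b (θ * d), v y = 0 := by
    rw [setAverage_eq, setIntegral_eq_zero_of_forall_eq_zero fun y hy => hv0 y (hb hy).2,
      smul_zero]
  have h := sq_sub_average_ball_le_gagliardoAt hs0 hv x b (by positivity) hball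
  rw [haverage, sub_zero] at h
  refine h.trans_eq ?_
  rw [Real.mul_rpow zero_le_two hd.le, mul_pow, rpow_kernelExp hd]
  congr 2
  field_simp

theorem exists_poincare (hΩ : IsCorkscrewDomain Ω) (hs0 : 0 < s) :
    ∃ C : ℝ, 0 < C ∧ ∀ v : Euc n → ℝ, MemLp v 2 volume → (∀ x, x ∉ Ω → v x = 0) →
      ∫⁻ x, ENNReal.ofReal (v x ^ 2) ≤ ENNReal.ofReal C * gagliardo s v := by
  obtain ⟨R, hR, hdiam⟩ := hΩ.exists_dist_le
  obtain ⟨C, hC, hhardy⟩ := exists_hardy hΩ hs0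
  refine ⟨C * R ^ (2 * s), by positivity, fun v hv hv0 => ?_⟩
  rw [gagliardo, ← lintegral_const_mul' _ _ ENNReal.ofReal_ne_top]
  refine lintegral_mono fun x => ?_
  by_cases hx : x ∈ Ω
  · obtain ⟨p, hp, hpd⟩ := hΩ.exists_mem_frontier_dist_eq hx
    have hxR := hdiam x (subset_closure hx) p (frontier_subset_closure hp)
    refine (hhardy v hv hv0 x hx).trans ?_
    gcongr
    · exact Metric.infDist_nonneg
    · exact hpd ▸ hxR
  · simp [hv0 x hx]

theorem exists_energy_le_gagliardo (hΩ : IsCorkscrewDomain Ω) (hs0 : 0 < s) :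
    ∃ C : ℝ, 0 < C ∧ ∀ v : Euc n → ℝ, MemLp v 2 volume → (∀ x, x ∉ Ω → v x = 0) →
      (∫⁻ x, ENNReal.ofReal (v x ^ 2)) + gagliardo s v ≤ ENNReal.ofReal C * gagliardo s v := by
  obtain ⟨C, hC, hpoincare⟩ := exists_poincare hΩ hs0
  refine ⟨C + 1, by positivity, fun v hv hv0 => ?_⟩
  rw [ENNReal.ofReal_add hC.le zero_le_one, ENNReal.ofReal_one, add_mul, one_mul]
  gcongr
  exact hpoincare v hv hv0

theorem exists_fracFormL_coercive (hΩ : IsCorkscrewDomain Ω) (hs0 : 0 < s) (hs1 : s < 1) :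
    ∃ α : ℝ, 0 < α ∧ ∀ v : fracSobolevZero n s Ω, α * ‖v‖ ^ 2 ≤ fracFormL n s Ω v v := by
  obtain ⟨C, hC, henergy⟩ := exists_energy_le_gagliardo hΩ hs0
  have hconst : 0 < fracConst n s := fracConst_pos hs0 hs1
  refine ⟨fracConst n s / 2 / C, by positivity, fun v => ?_⟩
  obtain ⟨v', -, hL, h0, hae⟩ := exists_representative hΩ.isOpen.measurableSet v
  have hnorm : ‖v‖ ^ 2 ≤ C * ‖(v : FracAmbient n).snd‖ ^ 2 := by
    rw [← ENNReal.ofReal_le_ofReal_iff (by positivity), ofReal_norm_sq_of_ae_eq hae,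
      ENNReal.ofReal_mul hC.le, ofReal_norm_snd_sq, gagliardo_congr_ae s hae]
    exact henergy v' hL h0
  rw [fracFormL_self, div_mul_eq_mul_div, div_le_iff₀ hC, mul_assoc, mul_comm _ C]
  gcongr

end HardyPoincare

/-! ### Segments and affine functions -/

section Segment

theorem exists_mem_frequently_of_finite_closed_cover {X ι : Type*} [TopologicalSpace X] {t : X}
    {l : Filter X} [l.NeBot] (hl : l ≤ nhds t) (I : Finset ι) {C : ι → Set X}
    (hC : ∀ i ∈ I, IsClosed (C i)) (hcov : ∀ᶠ z in l, ∃ i ∈ I, z ∈ C i) :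
    ∃ i ∈ I, t ∈ C i ∧ ∃ᶠ z in l, z ∈ C i := by
  obtain ⟨i, hi, hfreq⟩ : ∃ i ∈ I, ∃ᶠ z in l, z ∈ C i := by
    by_contra! hcon
    have hnone : ∀ᶠ z in l, ∀ i ∈ I, z ∉ C i := (Filter.eventually_all_finset I).2 hcon
    obtain ⟨z, hz, i, hi, hzi⟩ := (hnone.and hcov).exists
    exact hz i hi hzi
  exact ⟨i, hi, (hC i hi).mem_of_frequently_of_tendsto hfreq (Filter.tendsto_id.mono_left hl),
    hfreq⟩

theorem norm_sub_le_of_segment_subset_iUnion {E F ι : Type*} [NormedAddCommGroup E]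
    [NormedSpace ℝ E] [SeminormedAddCommGroup F] (I : Finset ι) {C : ι → Set E} {f : E → F}
    {x y : E} {L : ℝ} (hf : ContinuousOn f (segment ℝ x y)) (hC : ∀ i ∈ I, IsClosed (C i))
    (hcov : ∀ p ∈ segment ℝ x y, ∃ i ∈ I, p ∈ C i)
    (hL : ∀ i ∈ I, ∀ p ∈ C i, ∀ q ∈ C i, ‖f p - f q‖ ≤ L * ‖p - q‖) :
    ‖f x - f y‖ ≤ L * ‖x - y‖ := by
  set γ : ℝ → E := fun t => x + t • (y - x) with hγ
  have hγc : Continuous γ := by fun_prop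
  have hseg : ∀ t ∈ Set.Icc (0 : ℝ) 1, γ t ∈ segment ℝ x y := fun t ht => by
    rw [segment_eq_image']
    exact ⟨t, ht, rfl⟩
  have hslope : ∀ t ∈ Set.Ico (0 : ℝ) 1, ∀ r, L * ‖x - y‖ < r → ∃ᶠ z in nhdsWithin t (Set.Ioi t),
      slope (fun t => ‖f (γ t) - f x‖) t z < r := by
    intro t ht r hr
    have hev : ∀ᶠ z in nhdsWithin t (Set.Ioi t), z ∈ Set.Ioo t 1 := Ioo_mem_nhdsGT ht.2
    obtain ⟨i, hi, hti, hfreq⟩ := exists_mem_frequently_of_finite_closed_cover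
      (nhdsWithin_le_nhds (a := t) (s := Set.Ioi t)) I (C := fun i => γ ⁻¹' C i)
      (fun i hi => (hC i hi).preimage hγc)
      (hev.mono fun z hz => hcov (γ z) (hseg z ⟨ht.1.trans hz.1.le, hz.2.le⟩))
    refine (hfreq.and_eventually hev).mono fun z ⟨hzi, hz⟩ => ?_
    have hzt : 0 < z - t := sub_pos.2 hz.1
    have hγzt : ‖γ z - γ t‖ = (z - t) * ‖x - y‖ := by
      rw [show γ z - γ t = (z - t) • (y - x) by simp only [hγ]; module, norm_smul,
        Real.norm_of_nonneg hzt.le, norm_sub_rev]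
    rw [slope_def_field, div_lt_iff₀ hzt]
    calc ‖f (γ z) - f x‖ - ‖f (γ t) - f x‖ ≤ ‖f (γ z) - f (γ t)‖ := by
          simpa using norm_sub_norm_le (f (γ z) - f x) (f (γ t) - f x)
      _ ≤ L * ‖x - y‖ * (z - t) := by
          rw [mul_assoc, mul_comm ‖x - y‖, ← hγzt]; exact hL i hi _ hzi _ hti
      _ < r * (z - t) := mul_lt_mul_of_pos_right hr hzt
  have h := image_le_of_liminf_slope_right_le_deriv_boundary
    (B := fun t => t * (L * ‖x - y‖)) (B' := fun _ => L * ‖x - y‖)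
    ((hf.comp hγc.continuousOn hseg).sub continuousOn_const).norm (by simp [hγ]) (by fun_prop)
    (fun t _ => (hasDerivAt_mul_const _).hasDerivWithinAt) hslope (Set.right_mem_Icc.2 zero_le_one)
  simpa [hγ, norm_sub_rev (f x)] using h

end Segment

section AffineMap

variable {E : Type*} [NormedAddCommGroup E] [NormedSpace ℝ E] (A : E →ᵃ[ℝ] ℝ)

theorem exists_abs_sub_le_of_mem_convexHull (c : ℝ) {S : Set E} {x : E} (hx : x ∈ convexHull ℝ S) :
    ∃ z ∈ S, |A x - c| ≤ |A z - c| :=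
  ((convexOn_univ_dist c).comp_affineMap A).exists_ge_of_mem_convexHull (Set.subset_univ _) hx

theorem abs_sub_le_of_mem_convexHull {S : Set E} {D : ℝ}
    (hD : ∀ z ∈ S, ∀ z' ∈ S, |A z - A z'| ≤ D) {x y : E}
    (hx : x ∈ convexHull ℝ S) (hy : y ∈ convexHull ℝ S) : |A x - A y| ≤ D := by
  obtain ⟨z, hz, hxz⟩ := exists_abs_sub_le_of_mem_convexHull A (A y) hx
  obtain ⟨z', hz', hyz⟩ := exists_abs_sub_le_of_mem_convexHull A (A z) hy
  exact hxz.trans (by rw [abs_sub_comm]; exact hyz.trans (hD z' hz' z hz))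

theorem abs_sub_le_div_mul_norm_of_closedBall {c : E} {ρ D : ℝ} (hρ : 0 < ρ)
    (hD : ∀ p ∈ Metric.closedBall c ρ, |A p - A c| ≤ D) (x y : E) :
    |A x - A y| ≤ D / ρ * ‖x - y‖ := by
  have hlin : ∀ p q, A.linear (p - q) = A p - A q := fun p q => by
    simpa using A.linearMap_vsub p q
  rw [← hlin]
  refine LinearMap.bound_of_ball_bound' hρ D A.linear (fun v hv => ?_) (x - y)
  simpa [← hlin] using hD (c + v) (by simpa using hv)

variable {A}

theorem eqOn_convexHull_of_eqOn {B : E →ᵃ[ℝ] ℝ} {S : Set E} (h : Set.EqOn A B S) :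
    Set.EqOn A B (convexHull ℝ S) :=
  (AffineMap.eqOn_affineSpan h).mono (convexHull_subset_affineSpan S)

theorem affineMap_sum_smul_apply {ι : Type*} (I : Finset ι) (c : ι → ℝ) (A : ι → E →ᵃ[ℝ] ℝ)
    (x : E) : (∑ i ∈ I, c i • A i) x = ∑ i ∈ I, c i * A i x :=
  map_sum (⟨⟨fun A => A x, rfl⟩, fun _ _ => rfl⟩ : (E →ᵃ[ℝ] ℝ) →+ ℝ) (fun i => c i • A i) I

end AffineMap

/-! ### Simplices and triangulations -/

/-- The closed simplex with vertex set `T`. -/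
abbrev simplexHull {n : ℕ} (T : Finset (Euc n)) : Set (Euc n) :=
  convexHull ℝ (T : Set (Euc n))

section Simplex

variable {n : ℕ} {T : Finset (Euc n)}

theorem isCompact_simplexHull (T : Finset (Euc n)) : IsCompact (simplexHull T) :=
  T.finite_toSet.isCompact_convexHull ℝ

theorem isClosed_simplexHull (T : Finset (Euc n)) : IsClosed (simplexHull T) :=
  (isCompact_simplexHull T).isClosed

theorem mem_simplexHull_of_mem {z : Euc n} (hz : z ∈ T) : z ∈ simplexHull T :=
  subset_convexHull ℝ _ hz

theorem dist_le_simplexDiam {x y : Euc n} (hx : x ∈ simplexHull T) (hy : y ∈ simplexHull T) :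
    dist x y ≤ simplexDiam T :=
  Metric.dist_le_diam_of_mem (isCompact_simplexHull T).isBounded hx hy

theorem volume_simplexHull_eq_zero (hT : T.card ≤ n) : volume (simplexHull T) = 0 := by
  rcases T.eq_empty_or_nonempty with rfl | hne
  · simp [simplexHull]
  refine measure_mono_null (convexHull_subset_affineSpan _)
    (Measure.addHaar_affineSubspace _ _ fun h => ?_)
  have hcard : T.card = (T.card - 1) + 1 := (Nat.sub_add_cancel hne.card_pos).symm
  have hrank := finrank_vectorSpan_image_finset_le ℝ (id : Euc n → Euc n) T hcard
  rw [Finset.image_id, ← direction_affineSpan, h, AffineSubspace.direction_top, finrank_top,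
    finrank_euclideanSpace, Fintype.card_fin] at hrank
  have := hne.card_pos
  omega

theorem interior_simplexHull_ae_eq (T : Finset (Euc n)) :
    interior (simplexHull T) =ᵐ[volume] simplexHull T :=
  interior_ae_eq_of_null_frontier
    ((convex_convexHull ℝ (T : Set (Euc n))).addHaar_frontier volume)

end Simplex

section Mesh

variable {n : ℕ} {Ω : Set (Euc n)} {𝒯 : Geometry.SimplicialComplex ℝ (Euc n)}
  {T T' : Finset (Euc n)}

theorem affineSpan_meshElement (hT : T ∈ meshElements 𝒯) :
    affineSpan ℝ (T : Set (Euc n)) = ⊤ := by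
  have h := (𝒯.indep hT.1).affineSpan_eq_top_iff_card_eq_finrank_add_one
  rw [Subtype.range_coe] at h
  exact h.2 (by simpa using hT.2)

theorem interior_simplexHull_nonempty (hT : T ∈ meshElements 𝒯) :
    (interior (simplexHull T)).Nonempty :=
  interior_convexHull_nonempty_iff_affineSpan_eq_top.2 (affineSpan_meshElement hT)

theorem exists_affineMap_eq_on_vertices (hT : T ∈ meshElements 𝒯) (a : Euc n → ℝ) :
    ∃ A : Euc n →ᵃ[ℝ] ℝ, ∀ z ∈ T, A z = a z := by
  classical
  let b : AffineBasis T ℝ (Euc n) := ⟨Subtype.val, 𝒯.indep hT.1, by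
    rw [Subtype.range_coe]; exact affineSpan_meshElement hT⟩
  refine ⟨∑ i : T, a i • b.coord i, fun z hz => ?_⟩
  have hcoord : ∀ i : T, b.coord i z = if i = ⟨z, hz⟩ then 1 else 0 := fun i =>
    b.coord_apply i ⟨z, hz⟩
  calc (∑ i : T, a i • b.coord i) z = ∑ i : T, a i * b.coord i z :=
        affineMap_sum_smul_apply _ _ _ _
    _ = a z := by simp [hcoord]

theorem simplexDiam_pos [NeZero n] (hT : T ∈ meshElements 𝒯) : 0 < simplexDiam T := by
  have hcard : 1 < T.card := by rw [hT.2]; exact Nat.succ_lt_succ (NeZero.pos n)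
  obtain ⟨z, hz, z', hz', hne⟩ := Finset.one_lt_card.1 hcard
  exact (dist_pos.2 hne).trans_le
    (dist_le_simplexDiam (mem_simplexHull_of_mem hz) (mem_simplexHull_of_mem hz'))

theorem volume_inter_simplexHull (hT : T ∈ meshElements 𝒯) (hT' : T' ∈ meshElements 𝒯)
    (hne : T ≠ T') : volume (simplexHull T ∩ simplexHull T') = 0 := by
  classical
  refine measure_mono_null (𝒯.inter_subset_convexHull hT.1 hT'.1) ?_
  rw [← Finset.coe_inter]
  refine volume_simplexHull_eq_zero ?_
  by_contra! h
  have hl : T ∩ T' = T := Finset.eq_of_subset_of_card_le Finset.inter_subset_left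
    (by rw [hT.2]; exact h)
  have hr : T ∩ T' = T' := Finset.eq_of_subset_of_card_le Finset.inter_subset_right
    (by rw [hT'.2]; exact h)
  exact hne (hl.symm.trans hr)

theorem disjoint_interior_simplexHull (hT : T ∈ meshElements 𝒯) (hT' : T' ∈ meshElements 𝒯)
    (hne : T ≠ T') : Disjoint (interior (simplexHull T)) (interior (simplexHull T')) := by
  rw [Set.disjoint_iff_inter_eq_empty]
  refine (isOpen_interior.inter isOpen_interior).eq_empty_of_measure_zero (μ := volume) ?_
  exact measure_mono_null (Set.inter_subset_inter interior_subset interior_subset)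
    (volume_inter_simplexHull hT hT' hne)

theorem card_face_le (hT : T ∈ 𝒯.faces) : T.card ≤ n + 1 := by
  simpa using (𝒯.indep hT).card_le_finrank_succ.trans
    (Nat.succ_le_succ (Submodule.finrank_le _))

namespace IsTriangulation

/-- The elements of a triangulation as a `Finset`. -/
noncomputable def elements (h : IsTriangulation 𝒯 Ω) : Finset (Finset (Euc n)) :=
  (h.finite.subset (fun _ hT => hT.1 : meshElements 𝒯 ⊆ 𝒯.faces)).toFinset

theorem mem_elements (h : IsTriangulation 𝒯 Ω) : T ∈ h.elements ↔ T ∈ meshElements 𝒯 := by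
  simp [elements]

theorem simplexHull_subset (h : IsTriangulation 𝒯 Ω) (hT : T ∈ meshElements 𝒯) :
    simplexHull T ⊆ closure Ω := by
  rw [← h.space_eq]
  exact 𝒯.convexHull_subset_space hT.1

theorem isClosed_biUnion_elements (h : IsTriangulation 𝒯 Ω) :
    IsClosed (⋃ T ∈ h.elements, simplexHull T) :=
  isClosed_biUnion_finset fun T _ => isClosed_simplexHull T

theorem volume_closure_diff_biUnion_elements (h : IsTriangulation 𝒯 Ω) :
    volume (closure Ω \ ⋃ T ∈ h.elements, simplexHull T) = 0 := by
  have hsub : closure Ω \ (⋃ T ∈ h.elements, simplexHull T) ⊆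
      ⋃ T ∈ {T ∈ 𝒯.faces | T.card ≤ n}, simplexHull T := by
    rintro y ⟨hy, hyU⟩
    rw [← h.space_eq] at hy
    obtain ⟨T, hT, hyT⟩ := 𝒯.mem_space_iff.1 hy
    have hlt : T.card ≤ n := by
      by_contra! hlt
      exact hyU (Set.mem_biUnion
        (h.mem_elements.2 ⟨hT, (card_face_le hT).antisymm hlt⟩) hyT)
    exact Set.mem_biUnion (show T ∈ {T ∈ 𝒯.faces | T.card ≤ n} from ⟨hT, hlt⟩) hyT
  refine measure_mono_null hsub ((measure_biUnion_null_iff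
    (h.finite.subset (Set.sep_subset _ _)).countable).2 ?_)
  exact fun T hT => volume_simplexHull_eq_zero hT.2

theorem exists_mem_element (h : IsTriangulation 𝒯 Ω) (hΩ : IsOpen Ω) {x : Euc n}
    (hx : x ∈ closure Ω) : ∃ T ∈ meshElements 𝒯, x ∈ simplexHull T := by
  have hempty : Ω \ ⋃ T ∈ h.elements, simplexHull T = ∅ :=
    (hΩ.sdiff h.isClosed_biUnion_elements).eq_empty_of_measure_zero (μ := volume)
      (measure_mono_null (Set.sdiff_subset_sdiff_left subset_closure)
        h.volume_closure_diff_biUnion_elements)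
  have hxU := closure_minimal (Set.sdiff_eq_empty.1 hempty) h.isClosed_biUnion_elements hx
  simpa only [Set.mem_iUnion, h.mem_elements, exists_prop] using hxU

theorem sum_setLIntegral_le (h : IsTriangulation 𝒯 Ω) (f : Euc n → ENNReal) :
    ∑ T ∈ h.elements, ∫⁻ x in simplexHull T, f x ≤ ∫⁻ x, f x := by
  calc ∑ T ∈ h.elements, ∫⁻ x in simplexHull T, f x
      = ∑ T ∈ h.elements, ∫⁻ x in interior (simplexHull T), f x :=
        Finset.sum_congr rfl fun T _ => (setLIntegral_congr (interior_simplexHull_ae_eq T)).symm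
    _ = ∫⁻ x in ⋃ T ∈ h.elements, interior (simplexHull T), f x :=
        (lintegral_biUnion_finset (fun T hT T' hT' hne => disjoint_interior_simplexHull
          (h.mem_elements.1 hT) (h.mem_elements.1 hT') hne)
          (fun T _ => isOpen_interior.measurableSet) f).symm
    _ ≤ ∫⁻ x, f x := setLIntegral_le_lintegral _ _

end IsTriangulation

end Mesh

section Interpolation

variable {n : ℕ} {Ω : Set (Euc n)} {κ : ℝ} {𝒯 : Geometry.SimplicialComplex ℝ (Euc n)}
  {T T' : Finset (Euc n)} {a : Euc n → ℝ} {x y : Euc n}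

theorem IsShapeRegular.abs_affine_sub_le [NeZero n] (hκ : IsShapeRegular κ 𝒯) (hκ0 : 0 < κ)
    (hT : T ∈ meshElements 𝒯) (A : Euc n →ᵃ[ℝ] ℝ) {D : ℝ}
    (hD : ∀ z ∈ T, ∀ z' ∈ T, |A z - A z'| ≤ D) (x y : Euc n) :
    |A x - A y| ≤ κ * D / simplexDiam T * ‖x - y‖ := by
  obtain ⟨c, hc⟩ := hκ.inball T hT
  have hρ : 0 < simplexDiam T / κ := div_pos (simplexDiam_pos hT) hκ0
  have h := abs_sub_le_div_mul_norm_of_closedBall A hρ (fun p hp =>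
    abs_sub_le_of_mem_convexHull A hD (hc hp) (hc (Metric.mem_closedBall_self hρ.le))) x y
  rwa [div_div_eq_mul_div, mul_comm D] at h

theorem affineMap_eq_of_mem_inter (hT : T ∈ meshElements 𝒯) (hT' : T' ∈ meshElements 𝒯)
    {A A' : Euc n →ᵃ[ℝ] ℝ} (hA : ∀ z ∈ T, A z = a z) (hA' : ∀ z ∈ T', A' z = a z)
    (hx : x ∈ simplexHull T) (hx' : x ∈ simplexHull T') : A x = A' x :=
  eqOn_convexHull_of_eqOn (fun z hz => (hA z hz.1).trans (hA' z hz.2).symm)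
    (𝒯.inter_subset_convexHull hT.1 hT'.1 ⟨hx, hx'⟩)

theorem continuous_of_continuousOn_closure {X Y : Type*} [TopologicalSpace X] [TopologicalSpace Y]
    {U : Set X} (hU : IsOpen U) {g : X → Y} {c : Y} (hg : ContinuousOn g (closure U))
    (hc : ∀ x ∉ U, g x = c) : Continuous g := by
  have hout : ContinuousOn g Uᶜ := continuousOn_const.congr hc
  rw [← continuousOn_univ, ← Set.union_compl_self U]
  exact (hg.union_of_isClosed hout isClosed_closure hU.isClosed_compl).mono
    (Set.union_subset_union_left _ subset_closure)

namespace IsTriangulation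

theorem continuousOn_closure (h : IsTriangulation 𝒯 Ω) (hΩ : IsOpen Ω) {g : Euc n → ℝ}
    (hg : ∀ T ∈ meshElements 𝒯, ContinuousOn g (simplexHull T)) : ContinuousOn g (closure Ω) := by
  have hcov : closure Ω ⊆ ⋃ T : h.elements, simplexHull (T : Finset (Euc n)) := fun x hx => by
    obtain ⟨T, hT, hxT⟩ := h.exists_mem_element hΩ hx
    exact Set.mem_iUnion.2 ⟨⟨T, h.mem_elements.2 hT⟩, hxT⟩
  exact ((locallyFinite_of_finite _).continuousOn_iUnion (fun T => isClosed_simplexHull _)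
    fun T : h.elements => hg T (h.mem_elements.1 T.2)).mono hcov

theorem exists_interp (h : IsTriangulation 𝒯 Ω) (hΩ : IsOpen Ω) (a : Euc n → ℝ) :
    ∃ g : Euc n → ℝ, (∀ x ∉ closure Ω, g x = 0) ∧
      ∀ T ∈ meshElements 𝒯, ∃ A : Euc n →ᵃ[ℝ] ℝ, (∀ z ∈ T, A z = a z) ∧
        Set.EqOn g A (simplexHull T) := by
  classical
  choose! A hA using fun T (hT : T ∈ meshElements 𝒯) => exists_affineMap_eq_on_vertices hT a
  choose! τ hτ hxτ using fun x (hx : x ∈ closure Ω) => h.exists_mem_element hΩ hx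
  refine ⟨(closure Ω).indicator fun x => A (τ x) x, fun x hx => Set.indicator_of_notMem hx _,
    fun T hT => ⟨A T, hA T hT, fun x hx => ?_⟩⟩
  have hxΩ := h.simplexHull_subset hT hx
  rw [Set.indicator_of_mem hxΩ]
  exact affineMap_eq_of_mem_inter (hτ x hxΩ) hT (hA _ (hτ x hxΩ)) (hA T hT) (hxτ x hxΩ) hx

/-- The continuous piecewise affine interpolant of the vertex values `a`, extended by zero outside
`closure Ω`. Only the values of `a` at vertices matter. -/
noncomputable def interp (h : IsTriangulation 𝒯 Ω) (hΩ : IsOpen Ω) (a : Euc n → ℝ) : Euc n → ℝ :=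
  (h.exists_interp hΩ a).choose

variable (h : IsTriangulation 𝒯 Ω) (hΩ : IsOpen Ω)

theorem interp_eq_zero_of_notMem (a : Euc n → ℝ) (hx : x ∉ closure Ω) : h.interp hΩ a x = 0 :=
  (h.exists_interp hΩ a).choose_spec.1 x hx

theorem exists_eqOn_interp (a : Euc n → ℝ) (hT : T ∈ meshElements 𝒯) :
    ∃ A : Euc n →ᵃ[ℝ] ℝ, (∀ z ∈ T, A z = a z) ∧ Set.EqOn (h.interp hΩ a) A (simplexHull T) :=
  (h.exists_interp hΩ a).choose_spec.2 T hT

theorem continuousOn_interp (a : Euc n → ℝ) : ContinuousOn (h.interp hΩ a) (closure Ω) :=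
  h.continuousOn_closure hΩ fun _ hT =>
    let ⟨A, _, hA⟩ := h.exists_eqOn_interp hΩ a hT
    (AffineMap.continuous_of_finiteDimensional A).continuousOn.congr hA

theorem exists_abs_interp_sub_le (a : Euc n → ℝ) (hT : T ∈ meshElements 𝒯) (c : ℝ)
    (hx : x ∈ simplexHull T) : ∃ z ∈ T, |h.interp hΩ a x - c| ≤ |a z - c| := by
  obtain ⟨A, hA, hA'⟩ := h.exists_eqOn_interp hΩ a hT
  obtain ⟨z, hz, hxz⟩ := exists_abs_sub_le_of_mem_convexHull A c hx
  exact ⟨z, hz, by rwa [hA' hx, ← hA z hz]⟩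

theorem interp_eq_of_forall_eq (hT : T ∈ meshElements 𝒯) {c : ℝ} (hc : ∀ z ∈ T, a z = c)
    (hx : x ∈ simplexHull T) : h.interp hΩ a x = c := by
  obtain ⟨z, hz, hxz⟩ := h.exists_abs_interp_sub_le hΩ a hT c hx
  rw [hc z hz, sub_self, abs_zero] at hxz
  exact sub_eq_zero.1 (abs_nonpos_iff.1 hxz)

theorem abs_interp_sub_le [NeZero n] (hκ : IsShapeRegular κ 𝒯) (hκ0 : 0 < κ)
    (hT : T ∈ meshElements 𝒯) {D : ℝ} (hD : ∀ z ∈ T, ∀ z' ∈ T, |a z - a z'| ≤ D)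
    (hx : x ∈ simplexHull T) (hy : y ∈ simplexHull T) :
    |h.interp hΩ a x - h.interp hΩ a y| ≤ κ * D / simplexDiam T * ‖x - y‖ := by
  obtain ⟨A, hA, hA'⟩ := h.exists_eqOn_interp hΩ a hT
  rw [hA' hx, hA' hy]
  exact hκ.abs_affine_sub_le hκ0 hT A (fun z hz z' hz' => by
    rw [hA z hz, hA z' hz']; exact hD z hz z' hz') x y

/-- The nodal basis function of the vertex `z`. -/
noncomputable def hat (z : Euc n) : Euc n → ℝ :=
  h.interp hΩ (Set.indicator {z} 1)

theorem interp_eq_sum_hat (a : Euc n → ℝ) (hT : T ∈ meshElements 𝒯) (hx : x ∈ simplexHull T) :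
    h.interp hΩ a x = ∑ z ∈ T, a z * h.hat hΩ z x := by
  obtain ⟨A, hA, hA'⟩ := h.exists_eqOn_interp hΩ a hT
  choose B hB hB' using fun z => h.exists_eqOn_interp hΩ (Set.indicator {z} 1) hT
  have hsum : Set.EqOn A (∑ z ∈ T, a z • B z : Euc n →ᵃ[ℝ] ℝ) (T : Set (Euc n)) := by
    intro y hy
    rw [affineMap_sum_smul_apply, hA y hy, Finset.sum_eq_single_of_mem y hy]
    · simp [hB y y hy]
    · intro z _ hzy
      rw [hB z y hy, Set.indicator_of_notMem (by simpa using hzy.symm), mul_zero]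
  rw [hA' hx, eqOn_convexHull_of_eqOn hsum hx, affineMap_sum_smul_apply]
  exact Finset.sum_congr rfl fun z _ => congrArg _ (hB' z hx).symm

/-- A vertex is free if its hat function vanishes on the boundary of the domain. -/
def IsFree (z : Euc n) : Prop :=
  ∀ x ∈ frontier Ω, h.hat hΩ z x = 0

theorem exists_frontier_of_not_isFree {z : Euc n} (hz : ¬ h.IsFree hΩ z) :
    ∃ p ∈ frontier Ω, ∃ T ∈ meshElements 𝒯, z ∈ T ∧ p ∈ simplexHull T := by
  simp only [IsFree, not_forall] at hz
  obtain ⟨p, hp, hpz⟩ := hz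
  obtain ⟨T, hT, hpT⟩ := h.exists_mem_element hΩ (frontier_subset_closure hp)
  refine ⟨p, hp, T, hT, ?_, hpT⟩
  by_contra hzT
  exact hpz (h.interp_eq_of_forall_eq hΩ hT
    (fun y hy => Set.indicator_of_notMem (by rintro rfl; exact hzT hy) _) hpT)

theorem interp_eq_zero_of_isFree (ha : ∀ z, ¬ h.IsFree hΩ z → a z = 0) (hx : x ∉ Ω) :
    h.interp hΩ a x = 0 := by
  by_cases hxc : x ∈ closure Ω
  · obtain ⟨T, hT, hxT⟩ := h.exists_mem_element hΩ hxc
    rw [h.interp_eq_sum_hat hΩ a hT hxT]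
    refine Finset.sum_eq_zero fun z _ => ?_
    by_cases hz : h.IsFree hΩ z
    · rw [hz x ⟨hxc, by rwa [hΩ.interior_eq]⟩, mul_zero]
    · rw [ha z hz, zero_mul]
  · exact h.interp_eq_zero_of_notMem hΩ a hxc

theorem abs_interp_indicator_sub_le [NeZero n] (hκ : IsShapeRegular κ 𝒯) (hκ0 : 0 < κ)
    (hT : T ∈ meshElements 𝒯) (hT' : T' ∈ meshElements 𝒯)
    (hx : x ∈ simplexHull T') (hy : y ∈ simplexHull T') :
    |h.interp hΩ (Set.indicator T 1) x - h.interp hΩ (Set.indicator T 1) y| ≤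
      κ ^ 2 / simplexDiam T * ‖x - y‖ := by
  classical
  have hd := simplexDiam_pos hT
  have hd' := simplexDiam_pos hT'
  by_cases htouch : ∃ z, z ∈ T ∧ z ∈ T'
  · have hosc : ∀ z z' : Euc n, |Set.indicator (T : Set (Euc n)) (1 : Euc n → ℝ) z -
        Set.indicator (T : Set (Euc n)) 1 z'| ≤ 1 := fun z z' => by
      simp only [Set.indicator_apply, Pi.one_apply]
      split_ifs <;> simp
    refine (h.abs_interp_sub_le hΩ hκ hκ0 hT' (fun z _ z' _ => hosc z z') hx hy).trans ?_
    have hTT' := hκ.neighbours T hT T' hT' htouch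
    gcongr ?_ * _
    rw [div_le_div_iff₀ hd' hd]
    nlinarith
  · push Not at htouch
    have hzero : ∀ z ∈ T', Set.indicator (T : Set (Euc n)) (1 : Euc n → ℝ) z = 0 := fun z hz =>
      Set.indicator_of_notMem (fun hzT => htouch z hzT hz) _
    rw [h.interp_eq_of_forall_eq hΩ hT' hzero hx, h.interp_eq_of_forall_eq hΩ hT' hzero hy,
      sub_self, abs_zero]
    positivity

-- The interpolant of the indicator of the vertices of `T` is one on `T` and vanishes on the
-- elements that do not touch `T`, and its slope is at most `κ ^ 2 / h_T`.
theorem exists_touching_element [NeZero n] (h : IsTriangulation 𝒯 Ω) (hΩ : IsOpen Ω)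
    (hκ : IsShapeRegular κ 𝒯) (hκ0 : 0 < κ) (hT : T ∈ meshElements 𝒯) (hx : x ∈ simplexHull T)
    (hseg : segment ℝ x y ⊆ closure Ω) (hxy : ‖x - y‖ ≤ simplexDiam T / (2 * κ ^ 2)) :
    ∃ T' ∈ meshElements 𝒯, y ∈ simplexHull T' ∧ ∃ z, z ∈ T ∧ z ∈ T' := by
  have hd := simplexDiam_pos hT
  set g := h.interp hΩ (Set.indicator T 1)
  have hlip : |g x - g y| ≤ κ ^ 2 / simplexDiam T * ‖x - y‖ :=
    norm_sub_le_of_segment_subset_iUnion h.elements ((h.continuousOn_interp hΩ _).mono hseg)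
      (fun _ _ => isClosed_simplexHull _)
      (fun q hq => by simpa only [h.mem_elements] using h.exists_mem_element hΩ (hseg hq))
      (fun T' hT' q hq r hr =>
        h.abs_interp_indicator_sub_le hΩ hκ hκ0 hT (h.mem_elements.1 hT') hq hr)
  have hhalf : κ ^ 2 / simplexDiam T * ‖x - y‖ ≤ 1 / 2 := by
    calc _ ≤ κ ^ 2 / simplexDiam T * (simplexDiam T / (2 * κ ^ 2)) := by gcongr
      _ = 1 / 2 := by field_simp
  have hgx : g x = 1 :=
    h.interp_eq_of_forall_eq hΩ hT (fun z hz => Set.indicator_of_mem (Finset.mem_coe.2 hz) _) hx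
  obtain ⟨T', hT', hyT'⟩ := h.exists_mem_element hΩ (hseg (right_mem_segment ℝ x y))
  refine ⟨T', hT', hyT', ?_⟩
  by_contra! hcon
  have hgy : g y = 0 := h.interp_eq_of_forall_eq hΩ hT'
    (fun z hz => Set.indicator_of_notMem (fun hzT => hcon z hzT hz) _) hyT'
  rw [hgx, hgy, sub_zero, abs_one] at hlip
  linarith

theorem abs_sub_le_of_touching [NeZero n] (h : IsTriangulation 𝒯 Ω) (hΩ : IsOpen Ω)
    (hκ : IsShapeRegular κ 𝒯) (hκ0 : 0 < κ) (hT : T ∈ meshElements 𝒯) {g : Euc n → ℝ}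
    (hg : ContinuousOn g (closure Ω)) {M : ℝ}
    (hM : ∀ T' ∈ meshElements 𝒯, (∃ z, z ∈ T ∧ z ∈ T') → ∀ q ∈ simplexHull T',
      ∀ r ∈ simplexHull T', |g q - g r| ≤ M * ‖q - r‖)
    (hx : x ∈ simplexHull T) (hseg : segment ℝ x y ⊆ closure Ω)
    (hxy : ‖x - y‖ ≤ simplexDiam T / (2 * κ ^ 2)) :
    |g x - g y| ≤ M * ‖x - y‖ := by
  classical
  refine norm_sub_le_of_segment_subset_iUnion
    (h.elements.filter fun T' => ∃ z, z ∈ T ∧ z ∈ T') (C := simplexHull) (hg.mono hseg)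
    (fun _ _ => isClosed_simplexHull _) (fun p hp => ?_) (fun T' hT' => ?_)
  · have hsub : segment ℝ x p ⊆ segment ℝ x y :=
      (convex_segment x y).segment_subset (left_mem_segment ℝ x y) hp
    have hxp : ‖x - p‖ ≤ ‖x - y‖ := by
      simpa only [norm_sub_rev x] using norm_sub_le_of_mem_segment hp
    obtain ⟨T', hT', hpT', hz⟩ :=
      h.exists_touching_element hΩ hκ hκ0 hT hx (hsub.trans hseg) (hxp.trans hxy)
    exact ⟨T', Finset.mem_filter.2 ⟨h.mem_elements.2 hT', hz⟩, hpT'⟩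
  · obtain ⟨hT'e, htouch⟩ := Finset.mem_filter.1 hT'
    exact hM T' (h.mem_elements.1 hT'e) htouch

end IsTriangulation

/-- The functions whose classes form `piecewiseLinear`: continuous, affine on each element and
vanishing outside the domain. -/
structure IsMeshFunction (𝒯 : Geometry.SimplicialComplex ℝ (Euc n)) (Ω : Set (Euc n))
    (g : Euc n → ℝ) : Prop where
  continuous : Continuous g
  eq_zero : ∀ x, x ∉ Ω → g x = 0
  affine : ∀ T ∈ meshElements 𝒯, ∃ A : Euc n →ᵃ[ℝ] ℝ, ∀ x ∈ simplexHull T, g x = A x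

namespace IsMeshFunction

theorem zero : IsMeshFunction 𝒯 Ω 0 :=
  ⟨continuous_zero, fun _ _ => rfl, fun _ _ => ⟨0, fun _ _ => rfl⟩⟩

theorem add {f g : Euc n → ℝ} (hf : IsMeshFunction 𝒯 Ω f) (hg : IsMeshFunction 𝒯 Ω g) :
    IsMeshFunction 𝒯 Ω (f + g) := by
  refine ⟨hf.continuous.add hg.continuous, fun x hx => ?_, fun T hT => ?_⟩
  · rw [Pi.add_apply, hf.eq_zero x hx, hg.eq_zero x hx, add_zero]
  · obtain ⟨A, hA⟩ := hf.affine T hT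
    obtain ⟨B, hB⟩ := hg.affine T hT
    exact ⟨A + B, fun x hx => congrArg₂ (· + ·) (hA x hx) (hB x hx)⟩

theorem const_smul {f : Euc n → ℝ} (hf : IsMeshFunction 𝒯 Ω f) (c : ℝ) :
    IsMeshFunction 𝒯 Ω (c • f) := by
  refine ⟨hf.continuous.const_smul c, fun x hx => ?_, fun T hT => ?_⟩
  · rw [Pi.smul_apply, hf.eq_zero x hx, smul_zero]
  · obtain ⟨A, hA⟩ := hf.affine T hT
    exact ⟨c • A, fun x hx => congrArg (c • ·) (hA x hx)⟩

theorem finset_sum {ι : Type*} (I : Finset ι) {f : ι → Euc n → ℝ}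
    (hf : ∀ i ∈ I, IsMeshFunction 𝒯 Ω (f i)) : IsMeshFunction 𝒯 Ω (∑ i ∈ I, f i) :=
  Finset.sum_induction f (IsMeshFunction 𝒯 Ω) (fun _ _ => add) zero hf

theorem abs_sub_le {g : Euc n → ℝ} (hg : IsMeshFunction 𝒯 Ω g) (h : IsTriangulation 𝒯 Ω)
    (hΩ : IsOpen Ω) {M : ℝ} (hM0 : 0 ≤ M)
    (hM : ∀ T ∈ meshElements 𝒯, ∀ q ∈ simplexHull T, ∀ r ∈ simplexHull T,
      |g q - g r| ≤ M * ‖q - r‖) (x y : Euc n) : |g x - g y| ≤ M * ‖x - y‖ := by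
  classical
  refine norm_sub_le_of_segment_subset_iUnion (insert Ωᶜ (h.elements.image simplexHull)) (C := id)
    hg.continuous.continuousOn (fun i hi => ?_) (fun p _ => ?_) (fun i hi => ?_)
  · rcases Finset.mem_insert.1 hi with rfl | hi
    · exact hΩ.isClosed_compl
    · obtain ⟨T, _, rfl⟩ := Finset.mem_image.1 hi
      exact isClosed_simplexHull T
  · by_cases hp : p ∈ Ω
    · obtain ⟨T, hT, hpT⟩ := h.exists_mem_element hΩ (subset_closure hp)
      exact ⟨_, Finset.mem_insert_of_mem
        (Finset.mem_image_of_mem _ (h.mem_elements.2 hT)), hpT⟩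
    · exact ⟨_, Finset.mem_insert_self _ _, hp⟩
  · rcases Finset.mem_insert.1 hi with rfl | hi
    · intro p hp q hq
      rw [hg.eq_zero p hp, hg.eq_zero q hq, sub_self, norm_zero]
      positivity
    · obtain ⟨T, hT, rfl⟩ := Finset.mem_image.1 hi
      exact hM T (h.mem_elements.1 hT)

end IsMeshFunction

theorem IsTriangulation.isMeshFunction_interp (h : IsTriangulation 𝒯 Ω) (hΩ : IsOpen Ω)
    (ha : ∀ z, ¬ h.IsFree hΩ z → a z = 0) : IsMeshFunction 𝒯 Ω (h.interp hΩ a) where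
  continuous := continuous_of_continuousOn_closure hΩ (h.continuousOn_interp hΩ a)
    fun _ => h.interp_eq_zero_of_isFree hΩ ha
  eq_zero _ := h.interp_eq_zero_of_isFree hΩ ha
  affine _ hT := let ⟨A, _, hA⟩ := h.exists_eqOn_interp hΩ a hT; ⟨A, hA⟩

end Interpolation

/-! ### Energy of functions that are Lipschitz at a variable scale -/

section LocalApprox

variable {n : ℕ} {s : ℝ} {ρ m v g : Euc n → ℝ} {F : Euc n → ENNReal} {x y : Euc n}

theorem ofReal_div_le_truncKernel {a r t : ℝ} (ha : 0 ≤ a) (hr : 0 < r) (hrt : r ≤ t) :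
    ENNReal.ofReal (a / t ^ kernelExp n s) ≤
      ENNReal.ofReal (a / r ^ 2) * ENNReal.ofReal (truncKernel n s r t) := by
  rw [← ENNReal.ofReal_mul (by positivity)]
  apply ENNReal.ofReal_le_ofReal
  rw [truncKernel, min_eq_left (by gcongr : r ^ 2 ≤ t ^ 2)]
  apply le_of_eq
  field_simp

theorem ofReal_sq_div_le_truncKernel {b m r t : ℝ} (hb : |b| ≤ m * t) (ht : 0 ≤ t) (htr : t ≤ r) :
    ENNReal.ofReal (b ^ 2 / t ^ kernelExp n s) ≤
      ENNReal.ofReal (m ^ 2) * ENNReal.ofReal (truncKernel n s r t) := by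
  rw [← ENNReal.ofReal_mul (by positivity)]
  apply ENNReal.ofReal_le_ofReal
  rw [truncKernel, min_eq_right (by gcongr : t ^ 2 ≤ r ^ 2), ← mul_div_assoc, ← mul_pow]
  have hsq : b ^ 2 ≤ (m * t) ^ 2 := sq_le_sq' (by linarith [(abs_le.1 hb).1]) (le_of_abs_le hb)
  gcongr

/-- At the point `x`, the function `g` approximates `v` at the scale `ρ x` with slope `m x` and
error density `F x`. The scale may vanish, in which case `g x = v x`. -/
structure IsLocalApproxAt (s : ℝ) (ρ m : Euc n → ℝ) (F : Euc n → ENNReal) (v g : Euc n → ℝ)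
    (x : Euc n) : Prop where
  scale_nonneg : 0 ≤ ρ x
  abs_sub_le : ∀ y, ‖x - y‖ ≤ ρ x → |g x - g y| ≤ m x * ‖x - y‖
  sq_sub_le : ENNReal.ofReal ((g x - v x) ^ 2) ≤ ENNReal.ofReal (ρ x ^ (2 * s)) * F x

/-- The part of the Gagliardo integrand of `g` that is charged to its first variable: the slope
inside the ball of radius `ρ x`, the distance to `v` outside of it. -/
noncomputable def gagliardoCharge (s : ℝ) (ρ m v g : Euc n → ℝ) (x y : Euc n) : ENNReal :=
  ENNReal.ofReal (m x ^ 2 + 3 * (g x - v x) ^ 2 / ρ x ^ 2) *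
    ENNReal.ofReal (truncKernel n s (ρ x) ‖x - y‖)

theorem measurable_gagliardoCharge (s : ℝ) (hρ : Measurable ρ) (hm : Measurable m)
    (hv : Measurable v) (hg : Measurable g) :
    Measurable fun p : Euc n × Euc n => gagliardoCharge s ρ m v g p.1 p.2 := by
  unfold gagliardoCharge truncKernel
  fun_prop

namespace IsLocalApproxAt

theorem sub_eq_zero_of_scale_eq_zero (hs0 : 0 < s) (h : IsLocalApproxAt s ρ m F v g x)
    (hρ : ρ x = 0) : g x - v x = 0 := by
  have hsq := h.sq_sub_le
  rw [hρ, Real.zero_rpow (by positivity), ENNReal.ofReal_zero, zero_mul, nonpos_iff_eq_zero,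
    ENNReal.ofReal_eq_zero] at hsq
  exact pow_eq_zero_iff two_ne_zero |>.1 (hsq.antisymm (sq_nonneg _))

theorem near_le_gagliardoCharge (h : IsLocalApproxAt s ρ m F v g x) (hxy : ‖x - y‖ ≤ ρ x) :
    ENNReal.ofReal ((g x - g y) ^ 2 / ‖x - y‖ ^ kernelExp n s) ≤ gagliardoCharge s ρ m v g x y :=
  (ofReal_sq_div_le_truncKernel (h.abs_sub_le y hxy) (norm_nonneg _) hxy).trans
    (mul_le_mul_left (ENNReal.ofReal_le_ofReal (le_add_of_nonneg_right (by positivity))) _)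

theorem far_le_gagliardoCharge (hs0 : 0 < s) (h : IsLocalApproxAt s ρ m F v g x)
    (hxy : ρ x ≤ ‖x - y‖) :
    ENNReal.ofReal (3 * (g x - v x) ^ 2 / ‖x - y‖ ^ kernelExp n s) ≤
      gagliardoCharge s ρ m v g x y := by
  rcases h.scale_nonneg.eq_or_lt with hρ | hρ
  · simp [h.sub_eq_zero_of_scale_eq_zero hs0 hρ.symm]
  · exact (ofReal_div_le_truncKernel (by positivity) hρ hxy).trans
      (mul_le_mul_left (ENNReal.ofReal_le_ofReal (le_add_of_nonneg_left (sq_nonneg _))) _)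

theorem gagliardo_integrand_le (hs0 : 0 < s) (hx : IsLocalApproxAt s ρ m F v g x)
    (hy : IsLocalApproxAt s ρ m F v g y) :
    ENNReal.ofReal ((g x - g y) ^ 2 / ‖x - y‖ ^ kernelExp n s) ≤
      gagliardoCharge s ρ m v g x y + gagliardoCharge s ρ m v g y x +
        3 * ENNReal.ofReal ((v x - v y) ^ 2 / ‖x - y‖ ^ kernelExp n s) := by
  rcases le_total ‖x - y‖ (ρ x) with hnear | hfar
  · exact (hx.near_le_gagliardoCharge hnear).trans (le_self_add.trans le_self_add)
  rw [norm_sub_rev] at *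
  rcases le_total ‖y - x‖ (ρ y) with hnear' | hfar'
  · rw [← neg_sub (g y), neg_sq]
    exact (hy.near_le_gagliardoCharge hnear').trans (le_add_self.trans le_self_add)
  have hx' := hx.far_le_gagliardoCharge hs0 (norm_sub_rev y x ▸ hfar)
  have hy' := hy.far_le_gagliardoCharge hs0 hfar'
  rw [norm_sub_rev] at hx'
  have hthree : (3 : ENNReal) * ENNReal.ofReal ((v x - v y) ^ 2 / ‖y - x‖ ^ kernelExp n s) =
      ENNReal.ofReal (3 * (v x - v y) ^ 2 / ‖y - x‖ ^ kernelExp n s) := by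
    rw [mul_div_assoc, ENNReal.ofReal_mul (by norm_num), ENNReal.ofReal_ofNat]
  refine le_trans ?_ (add_le_add (add_le_add hx' hy') hthree.ge)
  rw [← ENNReal.ofReal_add (by positivity) (by positivity), ← add_div,
    ← ENNReal.ofReal_add (by positivity) (by positivity), ← add_div]
  gcongr
  nlinarith [sq_nonneg (g x - v x - (v x - v y)), sq_nonneg (g x - v x + (g y - v y)),
    sq_nonneg ((v x - v y) + (g y - v y))]

theorem lintegral_gagliardoCharge_le {C : ℝ} (hC : 0 ≤ C)
    (hker : ∀ r : ℝ, 0 < r → ∀ x : Euc n,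
      ∫⁻ y, ENNReal.ofReal (truncKernel n s r ‖x - y‖) ≤ ENNReal.ofReal (C * r ^ (2 - 2 * s)))
    (h : IsLocalApproxAt s ρ m F v g x) :
    ∫⁻ y, gagliardoCharge s ρ m v g x y ≤
      ENNReal.ofReal C * (ENNReal.ofReal (m x ^ 2 * ρ x ^ (2 - 2 * s)) + 3 * F x) := by
  rcases h.scale_nonneg.eq_or_lt with hρ | hρ
  · simp [gagliardoCharge, truncKernel, ← hρ]
  have hsplit : ρ x ^ (2 - 2 * s) = ρ x ^ 2 / ρ x ^ (2 * s) := by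
    rw [Real.rpow_sub hρ, Real.rpow_two]
  have hpos : 0 < ρ x ^ (2 * s) := by positivity
  have herr : ENNReal.ofReal (3 * (g x - v x) ^ 2 / ρ x ^ (2 * s)) ≤ 3 * F x := by
    rw [mul_div_assoc, ENNReal.ofReal_mul (by norm_num), ENNReal.ofReal_ofNat,
      ENNReal.ofReal_div_of_pos hpos]
    gcongr
    exact ENNReal.div_le_of_le_mul' h.sq_sub_le
  calc ∫⁻ y, gagliardoCharge s ρ m v g x y
      = ENNReal.ofReal (m x ^ 2 + 3 * (g x - v x) ^ 2 / ρ x ^ 2) *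
          ∫⁻ y, ENNReal.ofReal (truncKernel n s (ρ x) ‖x - y‖) :=
        lintegral_const_mul' _ _ ENNReal.ofReal_ne_top
    _ ≤ ENNReal.ofReal (m x ^ 2 + 3 * (g x - v x) ^ 2 / ρ x ^ 2) *
          ENNReal.ofReal (C * ρ x ^ (2 - 2 * s)) := by gcongr; exact hker _ hρ x
    _ = ENNReal.ofReal C * (ENNReal.ofReal (m x ^ 2 * ρ x ^ (2 - 2 * s)) +
          ENNReal.ofReal (3 * (g x - v x) ^ 2 / ρ x ^ (2 * s))) := by
        rw [← ENNReal.ofReal_add (by positivity) (by positivity),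
          ← ENNReal.ofReal_mul (by positivity), ← ENNReal.ofReal_mul hC, hsplit]
        congr 1
        field_simp
    _ ≤ _ := by gcongr

theorem of_scale_eq_zero (hρ : ρ x = 0) (hg : g x = 0) (hv : v x = 0) :
    IsLocalApproxAt s ρ m F v g x where
  scale_nonneg := hρ.ge
  abs_sub_le y hxy := by
    obtain rfl : x = y := sub_eq_zero.1 (norm_le_zero_iff.1 (hρ ▸ hxy))
    simp
  sq_sub_le := by simp [hg, hv]

end IsLocalApproxAt

theorem gagliardo_le_lintegral_gagliardoCharge (hs0 : 0 < s) (hρm : Measurable ρ)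
    (hmm : Measurable m) (hvm : Measurable v) (hgm : Measurable g)
    (h : ∀ᵐ x, IsLocalApproxAt s ρ m F v g x) :
    gagliardo s g ≤ 2 * (∫⁻ x, ∫⁻ y, gagliardoCharge s ρ m v g x y) + 3 * gagliardo s v := by
  have hmeas := measurable_gagliardoCharge s hρm hmm hvm hgm
  generalize hA : gagliardoCharge s ρ m v g = A at hmeas
  have hswap : ∫⁻ x, ∫⁻ y, A y x = ∫⁻ x, ∫⁻ y, A x y :=
    lintegral_lintegral_swap (hmeas.comp measurable_swap).aemeasurable
  have hleft : ∀ x, Measurable fun y => A x y := fun x => hmeas.comp measurable_prodMk_left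
  have hright : ∀ x, Measurable fun y => A y x := fun x => hmeas.comp measurable_prodMk_right
  have hintl : Measurable fun x => ∫⁻ y, A x y := hmeas.lintegral_prod_right'
  have hintr : Measurable fun x => ∫⁻ y, A y x :=
    (hmeas.comp measurable_swap).lintegral_prod_right'
  calc gagliardo s g ≤ ∫⁻ x, ∫⁻ y, (A x y + A y x +
        3 * ENNReal.ofReal ((v x - v y) ^ 2 / ‖x - y‖ ^ kernelExp n s)) :=
      lintegral_mono_ae (h.mono fun x hx => lintegral_mono_ae (h.mono fun y hy =>
        hA ▸ hx.gagliardo_integrand_le hs0 hy))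
    _ = ∫⁻ x, ((∫⁻ y, A x y) + (∫⁻ y, A y x) + 3 * gagliardoAt s v x) := by
      refine lintegral_congr fun x => ?_
      rw [lintegral_add_left (f := fun y => A x y + A y x) ((hleft x).add (hright x)),
        lintegral_add_left (hleft x),
        lintegral_const_mul' _ _ (by norm_num), gagliardoAt]
    _ = (∫⁻ x, ∫⁻ y, A x y) + (∫⁻ x, ∫⁻ y, A y x) + 3 * gagliardo s v := by
      rw [lintegral_add_left (f := fun x => (∫⁻ y, A x y) + ∫⁻ y, A y x) (hintl.add hintr),
        lintegral_add_left hintl, lintegral_const_mul' _ _ (by norm_num), gagliardo]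
    _ = _ := by rw [hswap, two_mul]

theorem exists_gagliardo_le_of_isLocalApproxAt [NeZero n] (hs0 : 0 < s) (hs1 : s < 1) :
    ∃ C : ℝ, 0 < C ∧ ∀ (ρ m v g : Euc n → ℝ) (F : Euc n → ENNReal), Measurable ρ → Measurable m →
      Measurable v → Measurable g → (∀ᵐ x, IsLocalApproxAt s ρ m F v g x) →
      gagliardo s g ≤ ENNReal.ofReal C *
        ((∫⁻ x, ENNReal.ofReal (m x ^ 2 * ρ x ^ (2 - 2 * s))) + ∫⁻ x, F x) +
          3 * gagliardo s v := by
  obtain ⟨C, hC, hker⟩ := exists_lintegral_truncKernel_le (n := n) hs0 hs1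
  refine ⟨6 * C, by positivity, fun ρ m v g F hρm hmm hvm hgm h => ?_⟩
  refine (gagliardo_le_lintegral_gagliardoCharge hs0 hρm hmm hvm hgm h).trans ?_
  refine add_le_add_left ?_ _
  calc 2 * ∫⁻ x, ∫⁻ y, gagliardoCharge s ρ m v g x y
      ≤ 2 * ∫⁻ x, ENNReal.ofReal C *
          (ENNReal.ofReal (m x ^ 2 * ρ x ^ (2 - 2 * s)) + 3 * F x) := by
        gcongr 2 * ?_
        exact lintegral_mono_ae (h.mono fun x hx =>
          hx.lintegral_gagliardoCharge_le hC.le hker)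
    _ = 2 * (ENNReal.ofReal C *
          ((∫⁻ x, ENNReal.ofReal (m x ^ 2 * ρ x ^ (2 - 2 * s))) + 3 * ∫⁻ x, F x)) := by
        rw [lintegral_const_mul' _ _ ENNReal.ofReal_ne_top,
          lintegral_add_left (by fun_prop), lintegral_const_mul' _ _ (by norm_num)]
    _ ≤ 2 * (ENNReal.ofReal C *
          (3 * (∫⁻ x, ENNReal.ofReal (m x ^ 2 * ρ x ^ (2 - 2 * s))) + 3 * ∫⁻ x, F x)) := by
        gcongr
        exact le_mul_of_one_le_left' (by norm_num)
    _ = _ := by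
        rw [ENNReal.ofReal_mul (by norm_num), ENNReal.ofReal_ofNat]
        ring

end LocalApprox

section CorkscrewDomain

variable {n : ℕ} {s : ℝ} {Ω : Set (Euc n)} {r m v g : Euc n → ℝ} {x : Euc n}

/-- The scale `r` cut off at the distance to the complement of `Ω`. -/
noncomputable def clippedScale (Ω : Set (Euc n)) (r : Euc n → ℝ) : Euc n → ℝ :=
  Ω.indicator fun x => min (r x) (Metric.infDist x Ωᶜ)

theorem lintegral_clippedScale_le (hΩ : MeasurableSet Ω) (hs1 : s < 1)
    (hr : ∀ᵐ x, x ∈ Ω → 0 < r x) :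
    ∫⁻ x, ENNReal.ofReal (m x ^ 2 * clippedScale Ω r x ^ (2 - 2 * s)) ≤
      ∫⁻ x in Ω, ENNReal.ofReal (m x ^ 2 * r x ^ (2 - 2 * s)) := by
  rw [← lintegral_indicator hΩ]
  refine lintegral_mono_ae (hr.mono fun x hx => ?_)
  by_cases hxΩ : x ∈ Ω
  · have hmin : 0 ≤ min (r x) (Metric.infDist x Ωᶜ) := le_min (hx hxΩ).le Metric.infDist_nonneg
    simp only [clippedScale, Set.indicator_of_mem hxΩ]
    gcongr
    · linarith
    · exact min_le_left _ _
  · simp [clippedScale, Set.indicator_of_notMem hxΩ,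
      Real.zero_rpow (by linarith : 2 - 2 * s ≠ 0)]

/-- At the point `x` of `Ω`, the function `g` approximates `v` at the positive scale `r x` with
slope `m x`, where the slope is tested only along segments that stay in `closure Ω`. -/
structure IsInteriorApproxAt (s c : ℝ) (Ω : Set (Euc n)) (r m v g : Euc n → ℝ) (x : Euc n) :
    Prop where
  scale_pos : 0 < r x
  abs_sub_le : ∀ y, segment ℝ x y ⊆ closure Ω → ‖x - y‖ ≤ r x → |g x - g y| ≤ m x * ‖x - y‖
  sq_sub_le : ENNReal.ofReal ((g x - v x) ^ 2) ≤
    ENNReal.ofReal (r x ^ (2 * s)) * (ENNReal.ofReal c * gagliardoAt s v x)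

variable [NeZero n]

theorem IsCorkscrewDomain.segment_subset_closure {y : Euc n} (hΩ : IsCorkscrewDomain Ω)
    (hx : x ∈ Ω) (hxy : ‖x - y‖ ≤ Metric.infDist x Ωᶜ) : segment ℝ x y ⊆ closure Ω :=
  ((convex_closedBall x _).segment_subset (Metric.mem_closedBall_self Metric.infDist_nonneg)
    (by rwa [Metric.mem_closedBall', dist_eq_norm])).trans
      (closure_ball x (hΩ.infDist_compl_pos hx).ne' ▸
        closure_mono Metric.ball_infDist_compl_subset)

theorem IsInteriorApproxAt.sq_sub_le_infDist {c c' : ℝ} (hΩ : IsCorkscrewDomain Ω) (hs1 : s < 1)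
    (hc' : 0 ≤ c') (hg0 : ∀ x, x ∉ Ω → g x = 0)
    (hv : ENNReal.ofReal (v x ^ 2) ≤
      ENNReal.ofReal (c' * Metric.infDist x Ωᶜ ^ (2 * s)) * gagliardoAt s v x) (hx : x ∈ Ω)
    (h : IsInteriorApproxAt s c Ω r m v g x) (hd : Metric.infDist x Ωᶜ ≤ r x) :
    ENNReal.ofReal ((g x - v x) ^ 2) ≤ ENNReal.ofReal (Metric.infDist x Ωᶜ ^ (2 * s)) *
      (ENNReal.ofReal (2 * c') * gagliardoAt s v x +
        ENNReal.ofReal (2 * (m x ^ 2 * r x ^ (2 - 2 * s)))) := by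
  have hpos := hΩ.infDist_compl_pos hx
  obtain ⟨p, hp, hpd⟩ := hΩ.exists_mem_frontier_dist_eq hx
  set d := Metric.infDist x Ωᶜ
  have hgx : |g x| ≤ m x * d := by
    have hxp : ‖x - p‖ = d := by rwa [← dist_eq_norm]
    have := h.abs_sub_le p (hΩ.segment_subset_closure hx hxp.le) (hxp.trans_le hd)
    rwa [hg0 p fun hpΩ => hp.2 (hΩ.isOpen.interior_eq.symm ▸ hpΩ), sub_zero, hxp] at this
  have hgsq : g x ^ 2 ≤ d ^ (2 * s) * (m x ^ 2 * r x ^ (2 - 2 * s)) := by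
    calc g x ^ 2 ≤ (m x * d) ^ 2 := sq_le_sq' (by linarith [(abs_le.1 hgx).1]) (le_of_abs_le hgx)
      _ = d ^ (2 * s) * (m x ^ 2 * d ^ (2 - 2 * s)) := by
        rw [Real.rpow_sub hpos, Real.rpow_two]
        field_simp
      _ ≤ _ := by gcongr; linarith
  have hds : 0 ≤ d ^ (2 * s) := by positivity
  calc ENNReal.ofReal ((g x - v x) ^ 2)
      ≤ ENNReal.ofReal (2 * v x ^ 2 + d ^ (2 * s) * (2 * (m x ^ 2 * r x ^ (2 - 2 * s)))) := by
        gcongr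
        nlinarith [sq_nonneg (g x + v x)]
    _ = 2 * ENNReal.ofReal (v x ^ 2) +
          ENNReal.ofReal (d ^ (2 * s)) * ENNReal.ofReal (2 * (m x ^ 2 * r x ^ (2 - 2 * s))) := by
        have := h.scale_pos
        rw [ENNReal.ofReal_add (by positivity) (by positivity), ENNReal.ofReal_mul zero_le_two,
          ENNReal.ofReal_ofNat, ENNReal.ofReal_mul hds]
    _ ≤ 2 * (ENNReal.ofReal (c' * d ^ (2 * s)) * gagliardoAt s v x) + _ := by gcongr
    _ = _ := by
        rw [ENNReal.ofReal_mul hc', ENNReal.ofReal_mul (q := c') zero_le_two, ENNReal.ofReal_ofNat]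
        ring

theorem IsInteriorApproxAt.isLocalApproxAt {c c' : ℝ} (hΩ : IsCorkscrewDomain Ω)
    (hs1 : s < 1) (hc : 0 ≤ c) (hc' : 0 ≤ c') (hg0 : ∀ x, x ∉ Ω → g x = 0)
    (hv : ENNReal.ofReal (v x ^ 2) ≤
      ENNReal.ofReal (c' * Metric.infDist x Ωᶜ ^ (2 * s)) * gagliardoAt s v x) (hx : x ∈ Ω)
    (h : IsInteriorApproxAt s c Ω r m v g x) :
    IsLocalApproxAt s (clippedScale Ω r) m
      (fun x => ENNReal.ofReal (c + 2 * c') * gagliardoAt s v x +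
        Ω.indicator (fun x => ENNReal.ofReal (2 * (m x ^ 2 * r x ^ (2 - 2 * s)))) x) v g x where
  scale_nonneg := by
    rw [clippedScale, Set.indicator_of_mem hx]
    exact le_min h.scale_pos.le Metric.infDist_nonneg
  abs_sub_le y hxy := by
    rw [clippedScale, Set.indicator_of_mem hx, le_min_iff] at hxy
    exact h.abs_sub_le y (hΩ.segment_subset_closure hx hxy.2) hxy.1
  sq_sub_le := by
    rw [clippedScale, Set.indicator_of_mem hx, Set.indicator_of_mem hx]
    rcases le_total (r x) (Metric.infDist x Ωᶜ) with hrd | hdr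
    · rw [min_eq_left hrd]
      refine h.sq_sub_le.trans ?_
      gcongr
      exact le_add_right (by gcongr; linarith)
    · rw [min_eq_right hdr]
      refine (h.sq_sub_le_infDist hΩ hs1 hc' hg0 hv hx hdr).trans ?_
      gcongr
      linarith

theorem exists_gagliardo_le_of_isInteriorApproxAt (hΩ : IsCorkscrewDomain Ω)
    (hs0 : 0 < s) (hs1 : s < 1) {c : ℝ} (hc : 0 ≤ c) :
    ∃ C : ℝ, 0 < C ∧ ∀ r m v g : Euc n → ℝ, Measurable r → Measurable m → Measurable v →
      Measurable g → MemLp v 2 volume → (∀ x, x ∉ Ω → v x = 0) → (∀ x, x ∉ Ω → g x = 0) →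
      (∀ᵐ x, x ∈ Ω → IsInteriorApproxAt s c Ω r m v g x) →
      gagliardo s g ≤ ENNReal.ofReal C *
        (gagliardo s v + ∫⁻ x in Ω, ENNReal.ofReal (m x ^ 2 * r x ^ (2 - 2 * s))) := by
  obtain ⟨c', hc', hardy⟩ := exists_hardy hΩ hs0
  obtain ⟨C, hC, hlocal⟩ := exists_gagliardo_le_of_isLocalApproxAt (n := n) hs0 hs1
  refine ⟨C * (c + 2 * c' + 3) + 3, by positivity,
    fun r m v g hr hm hv hg hvL hv0 hg0 h => ?_⟩
  have hΩm := hΩ.isOpen.measurableSet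
  have hρ : Measurable (clippedScale Ω r) :=
    (hr.min (Metric.continuous_infDist_pt _).measurable).indicator hΩm
  set F : Euc n → ENNReal := fun x => ENNReal.ofReal (c + 2 * c') * gagliardoAt s v x +
    Ω.indicator (fun x => ENNReal.ofReal (2 * (m x ^ 2 * r x ^ (2 - 2 * s)))) x with hF
  have happrox : ∀ᵐ x, IsLocalApproxAt s (clippedScale Ω r) m F v g x := by
    filter_upwards [h] with x hx
    by_cases hxΩ : x ∈ Ω
    · exact (hx hxΩ).isLocalApproxAt hΩ hs1 hc hc'.le hg0 (hardy v hvL hv0 x hxΩ) hxΩ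
    · exact IsLocalApproxAt.of_scale_eq_zero (Set.indicator_of_notMem hxΩ _) (hg0 x hxΩ)
        (hv0 x hxΩ)
  set I := ∫⁻ x in Ω, ENNReal.ofReal (m x ^ 2 * r x ^ (2 - 2 * s))
  have hslope : ∫⁻ x, ENNReal.ofReal (m x ^ 2 * clippedScale Ω r x ^ (2 - 2 * s)) ≤ I :=
    lintegral_clippedScale_le hΩm hs1 (h.mono fun x hx hxΩ => (hx hxΩ).scale_pos)
  have herror : ∫⁻ x, F x = ENNReal.ofReal (c + 2 * c') * gagliardo s v + 2 * I := by
    simp only [hF, ENNReal.ofReal_mul zero_le_two, ENNReal.ofReal_ofNat]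
    rw [lintegral_add_left ((measurable_gagliardoAt s hv).const_mul _), gagliardo,
      lintegral_const_mul' _ _ ENNReal.ofReal_ne_top, lintegral_indicator hΩm,
      lintegral_const_mul' _ _ (by norm_num)]
  calc gagliardo s g ≤ ENNReal.ofReal C *
        (I + (ENNReal.ofReal (c + 2 * c') * gagliardo s v + 2 * I)) + 3 * gagliardo s v := by
        grw [hlocal _ m v g F hρ hm hv hg happrox, hslope, herror]
    _ ≤ ENNReal.ofReal C * (ENNReal.ofReal (c + 2 * c') * (gagliardo s v + I) +
          3 * (gagliardo s v + I)) + 3 * (gagliardo s v + I) := by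
        grw [show I + (ENNReal.ofReal (c + 2 * c') * gagliardo s v + 2 * I) =
          ENNReal.ofReal (c + 2 * c') * gagliardo s v + 3 * I by ring]
        gcongr <;> simp
    _ = _ := by
        rw [ENNReal.ofReal_add (by positivity) zero_le_three, ENNReal.ofReal_mul hC.le,
          ENNReal.ofReal_add (by positivity) zero_le_three, ENNReal.ofReal_ofNat]
        ring

end CorkscrewDomain

section MeshEnergy

variable {n : ℕ} {s : ℝ} {Ω : Set (Euc n)} {κ : ℝ}
  {𝒯 : Geometry.SimplicialComplex ℝ (Euc n)} {T : Finset (Euc n)} {x : Euc n}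

namespace IsTriangulation

/-- The function that takes the value `φ T` inside each element `T`; it vanishes on the element
boundaries, a null set. -/
noncomputable def elementwise (h : IsTriangulation 𝒯 Ω) (φ : Finset (Euc n) → ℝ) (x : Euc n) : ℝ :=
  ∑ T ∈ h.elements, (interior (simplexHull T)).indicator (fun _ => φ T) x

theorem measurable_elementwise (h : IsTriangulation 𝒯 Ω) (φ : Finset (Euc n) → ℝ) :
    Measurable (h.elementwise φ) :=
  Finset.measurable_fun_sum _ fun _ _ => measurable_const.indicator isOpen_interior.measurableSet

theorem elementwise_apply (h : IsTriangulation 𝒯 Ω) (φ : Finset (Euc n) → ℝ)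
    (hT : T ∈ meshElements 𝒯) (hx : x ∈ interior (simplexHull T)) : h.elementwise φ x = φ T := by
  rw [elementwise, Finset.sum_eq_single_of_mem T (h.mem_elements.2 hT), Set.indicator_of_mem hx]
  intro T' hT' hne
  exact Set.indicator_of_notMem (Set.disjoint_right.1
    (disjoint_interior_simplexHull (h.mem_elements.1 hT') hT hne) hx) _

theorem ae_exists_mem_interior (h : IsTriangulation 𝒯 Ω) (hΩ : IsOpen Ω) :
    ∀ᵐ x, x ∈ Ω → ∃ T ∈ meshElements 𝒯, x ∈ interior (simplexHull T) := by
  have hinterior : ∀ᵐ x, ∀ T ∈ h.elements, x ∈ interior (simplexHull T) ↔ x ∈ simplexHull T :=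
    (ae_ball_iff (Finset.countable_toSet _)).2 fun T _ => (interior_simplexHull_ae_eq T).mem_iff
  filter_upwards [hinterior] with x hx hxΩ
  obtain ⟨T, hT, hxT⟩ := h.exists_mem_element hΩ (subset_closure hxΩ)
  exact ⟨T, hT, (hx T (h.mem_elements.2 hT)).2 hxT⟩

theorem setLIntegral_le_sum (h : IsTriangulation 𝒯 Ω) (hΩ : IsOpen Ω) (f : Euc n → ENNReal) :
    ∫⁻ x in Ω, f x ≤ ∑ T ∈ h.elements, ∫⁻ x in interior (simplexHull T), f x := by
  have hsub : Ω ≤ᵐ[volume] ⋃ T ∈ h.elements, interior (simplexHull T) := by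
    filter_upwards [h.ae_exists_mem_interior hΩ] with x hx hxΩ
    obtain ⟨T, hT, hxT⟩ := hx hxΩ
    exact Set.mem_biUnion (h.mem_elements.2 hT) hxT
  rw [← lintegral_biUnion_finset (fun T hT T' hT' hne => disjoint_interior_simplexHull
    (h.mem_elements.1 hT) (h.mem_elements.1 hT') hne) fun _ _ => isOpen_interior.measurableSet]
  exact lintegral_mono' (Measure.restrict_mono_ae hsub) le_rfl

theorem setLIntegral_elementwise_le (h : IsTriangulation 𝒯 Ω) (hΩ : IsOpen Ω)
    (f : ℝ → ℝ → ENNReal) (φ ψ : Finset (Euc n) → ℝ) :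
    ∫⁻ x in Ω, f (h.elementwise φ x) (h.elementwise ψ x) ≤
      ∑ T ∈ h.elements, f (φ T) (ψ T) * volume (simplexHull T) := by
  refine (h.setLIntegral_le_sum hΩ _).trans (Finset.sum_le_sum fun T hT => le_of_eq ?_)
  have hT' := h.mem_elements.1 hT
  calc ∫⁻ x in interior (simplexHull T), f (h.elementwise φ x) (h.elementwise ψ x)
      = ∫⁻ _ in interior (simplexHull T), f (φ T) (ψ T) :=
        setLIntegral_congr_fun isOpen_interior.measurableSet fun x hx => by
          simp only [h.elementwise_apply _ hT' hx]
    _ = f (φ T) (ψ T) * volume (simplexHull T) := by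
        rw [setLIntegral_const, measure_congr (interior_simplexHull_ae_eq T)]

open Classical in
/-- The elements that share a vertex with `T`. -/
noncomputable def patch (h : IsTriangulation 𝒯 Ω) (T : Finset (Euc n)) : Finset (Finset (Euc n)) :=
  h.elements.filter fun T' => ∃ z, z ∈ T ∧ z ∈ T'

theorem mem_patch (h : IsTriangulation 𝒯 Ω) {T' : Finset (Euc n)} :
    T' ∈ h.patch T ↔ T' ∈ meshElements 𝒯 ∧ ∃ z, z ∈ T ∧ z ∈ T' := by
  rw [patch, Finset.mem_filter, h.mem_elements]

theorem mem_patch_comm (h : IsTriangulation 𝒯 Ω) {T' : Finset (Euc n)} (hT : T ∈ meshElements 𝒯)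
    (hT' : T' ∈ h.patch T) : T ∈ h.patch T' := by
  obtain ⟨-, z, hz, hz'⟩ := h.mem_patch.1 hT'
  exact h.mem_patch.2 ⟨hT, z, hz', hz⟩

/-- A bound for all slopes `G` in the patch of `T`. -/
noncomputable def patchSlope (h : IsTriangulation 𝒯 Ω) (G : Finset (Euc n) → ℝ)
    (T : Finset (Euc n)) : ℝ :=
  √(∑ T' ∈ h.patch T, G T' ^ 2)

theorem le_patchSlope (h : IsTriangulation 𝒯 Ω) (G : Finset (Euc n) → ℝ) {T' : Finset (Euc n)}
    (hT' : T' ∈ h.patch T) : G T' ≤ h.patchSlope G T :=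
  Real.le_sqrt_of_sq_le
    (Finset.single_le_sum (f := fun T' => G T' ^ 2) (fun _ _ => sq_nonneg _) hT')

end IsTriangulation

variable [NeZero n]

theorem IsShapeRegular.le_volume (hκ : IsShapeRegular κ 𝒯) (hκ0 : 0 < κ)
    (hT : T ∈ meshElements 𝒯) :
    ENNReal.ofReal (unitBallVol n * (simplexDiam T / κ) ^ n) ≤ volume (simplexHull T) := by
  obtain ⟨c, hc⟩ := hκ.inball T hT
  have hd := simplexDiam_pos hT
  rw [← volume_ball_eq c (by positivity)]
  exact measure_mono (Metric.ball_subset_closedBall.trans hc)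

namespace IsTriangulation

theorem simplexHull_subset_ball_of_mem_patch (h : IsTriangulation 𝒯 Ω) (hκ : IsShapeRegular κ 𝒯)
    (hT : T ∈ meshElements 𝒯) (hx : x ∈ simplexHull T) {T' : Finset (Euc n)}
    (hT' : T' ∈ h.patch T) :
    simplexHull T' ⊆ Metric.ball x ((κ + 2) * simplexDiam T) := by
  intro y hy
  obtain ⟨hT'e, z, hz, hz'⟩ := h.mem_patch.1 hT'
  have hd := simplexDiam_pos hT
  calc dist y x ≤ dist y z + dist z x := dist_triangle _ _ _
    _ ≤ simplexDiam T' + simplexDiam T :=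
      add_le_add (dist_le_simplexDiam hy (mem_simplexHull_of_mem hz'))
        (dist_le_simplexDiam (mem_simplexHull_of_mem hz) hx)
    _ < (κ + 2) * simplexDiam T := by linarith [hκ.neighbours T' hT'e T hT ⟨z, hz', hz⟩]

theorem sum_volume_patch_le (h : IsTriangulation 𝒯 Ω) (hκ : IsShapeRegular κ 𝒯) (hκ0 : 0 < κ)
    (hT : T ∈ meshElements 𝒯) :
    ∑ T' ∈ h.patch T, volume (simplexHull T') ≤
      ENNReal.ofReal (((κ + 2) * κ) ^ n) * volume (simplexHull T) := by
  obtain ⟨x₀, hx₀⟩ := interior_simplexHull_nonempty hT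
  have hd := simplexDiam_pos hT
  set B := Metric.ball x₀ ((κ + 2) * simplexDiam T)
  calc ∑ T' ∈ h.patch T, volume (simplexHull T')
      ≤ ∑ T' ∈ h.patch T, volume (B ∩ simplexHull T') :=
        Finset.sum_le_sum fun T' hT' => measure_mono (Set.subset_inter
          (h.simplexHull_subset_ball_of_mem_patch hκ hT (interior_subset hx₀) hT') subset_rfl)
    _ ≤ ∑ T' ∈ h.elements, volume (B ∩ simplexHull T') :=
        Finset.sum_le_sum_of_subset (Finset.filter_subset _ _)
    _ = ∑ T' ∈ h.elements, ∫⁻ x in simplexHull T', B.indicator 1 x := by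
        simp only [lintegral_indicator_one Metric.isOpen_ball.measurableSet,
          Measure.restrict_apply Metric.isOpen_ball.measurableSet, B]
    _ ≤ ∫⁻ x, B.indicator 1 x := h.sum_setLIntegral_le _
    _ = ENNReal.ofReal (((κ + 2) * κ) ^ n) *
        ENNReal.ofReal (unitBallVol n * (simplexDiam T / κ) ^ n) := by
        rw [lintegral_indicator_one Metric.isOpen_ball.measurableSet,
          volume_ball_eq _ (by positivity), ← ENNReal.ofReal_mul (by positivity)]
        congr 1
        rw [div_pow, mul_pow, mul_pow]
        field_simp
    _ ≤ _ := by
        gcongr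
        exact hκ.le_volume hκ0 hT

theorem patchSlope_energy_le (h : IsTriangulation 𝒯 Ω) (hκ : IsShapeRegular κ 𝒯) (hκ0 : 0 < κ)
    (hs1 : s < 1) (G : Finset (Euc n) → ℝ) (hT : T ∈ meshElements 𝒯) :
    ENNReal.ofReal (h.patchSlope G T ^ 2 * simplexDiam T ^ (2 - 2 * s)) ≤
      ∑ T' ∈ h.patch T, ENNReal.ofReal (κ ^ (2 - 2 * s)) *
        ENNReal.ofReal (G T' ^ 2 * simplexDiam T' ^ (2 - 2 * s)) := by
  have hd := simplexDiam_pos hT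
  rw [patchSlope, Real.sq_sqrt (Finset.sum_nonneg fun _ _ => sq_nonneg _), Finset.sum_mul,
    ENNReal.ofReal_sum_of_nonneg fun _ _ => by positivity]
  refine Finset.sum_le_sum fun T' hT' => ?_
  obtain ⟨hT'e, hz⟩ := h.mem_patch.1 hT'
  have hd' := simplexDiam_pos hT'e
  rw [← ENNReal.ofReal_mul (by positivity)]
  apply ENNReal.ofReal_le_ofReal
  calc G T' ^ 2 * simplexDiam T ^ (2 - 2 * s)
      ≤ G T' ^ 2 * (κ * simplexDiam T') ^ (2 - 2 * s) := by
        gcongr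
        · linarith
        · exact hκ.neighbours T hT T' hT'e hz
    _ = _ := by rw [Real.mul_rpow hκ0.le hd'.le]; ring

theorem sum_patchSlope_energy_le (h : IsTriangulation 𝒯 Ω) (hκ : IsShapeRegular κ 𝒯) (hκ0 : 0 < κ)
    (hs1 : s < 1) (G : Finset (Euc n) → ℝ) :
    ∑ T ∈ h.elements, ENNReal.ofReal (h.patchSlope G T ^ 2 * simplexDiam T ^ (2 - 2 * s)) *
        volume (simplexHull T) ≤
      ENNReal.ofReal (κ ^ (2 - 2 * s) * ((κ + 2) * κ) ^ n) * ∑ T ∈ h.elements,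
        ENNReal.ofReal (G T ^ 2 * simplexDiam T ^ (2 - 2 * s)) * volume (simplexHull T) := by
  set e := fun T => ENNReal.ofReal (G T ^ 2 * simplexDiam T ^ (2 - 2 * s))
  calc _ ≤ ∑ T ∈ h.elements, ∑ T' ∈ h.patch T,
        ENNReal.ofReal (κ ^ (2 - 2 * s)) * e T' * volume (simplexHull T) := by
        refine Finset.sum_le_sum fun T hT => ?_
        grw [h.patchSlope_energy_le hκ hκ0 hs1 G (h.mem_elements.1 hT), Finset.sum_mul]
    _ = ∑ T' ∈ h.elements, ∑ T ∈ h.patch T',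
        ENNReal.ofReal (κ ^ (2 - 2 * s)) * e T' * volume (simplexHull T) :=
        Finset.sum_comm' fun T T' => ⟨fun ⟨hT, hT'⟩ =>
            ⟨h.mem_patch_comm (h.mem_elements.1 hT) hT', h.mem_elements.2 (h.mem_patch.1 hT').1⟩,
          fun ⟨hT, hT'⟩ =>
            ⟨h.mem_elements.2 (h.mem_patch.1 hT).1, h.mem_patch_comm (h.mem_elements.1 hT') hT⟩⟩
    _ ≤ ∑ T' ∈ h.elements, ENNReal.ofReal (κ ^ (2 - 2 * s)) * e T' *
        (ENNReal.ofReal (((κ + 2) * κ) ^ n) * volume (simplexHull T')) := by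
        refine Finset.sum_le_sum fun T' hT' => ?_
        rw [← Finset.mul_sum]
        gcongr
        exact h.sum_volume_patch_le hκ hκ0 (h.mem_elements.1 hT')
    _ = _ := by
        rw [Finset.mul_sum, ENNReal.ofReal_mul (by positivity)]
        exact Finset.sum_congr rfl fun T _ => by ring

theorem abs_sub_le_patchSlope (h : IsTriangulation 𝒯 Ω) (hΩ : IsOpen Ω) (hκ : IsShapeRegular κ 𝒯)
    (hκ0 : 0 < κ) {g : Euc n → ℝ} (hg : Continuous g) {G : Finset (Euc n) → ℝ}
    (hG : ∀ T ∈ meshElements 𝒯, ∀ x ∈ simplexHull T, ∀ y ∈ simplexHull T,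
      |g x - g y| ≤ G T * ‖x - y‖) (hT : T ∈ meshElements 𝒯) (hx : x ∈ simplexHull T) {y : Euc n}
    (hseg : segment ℝ x y ⊆ closure Ω) (hxy : ‖x - y‖ ≤ simplexDiam T / (2 * κ ^ 2)) :
    |g x - g y| ≤ h.patchSlope G T * ‖x - y‖ := by
  refine h.abs_sub_le_of_touching hΩ hκ hκ0 hT hg.continuousOn (fun T' hT' hz q hq r hr => ?_) hx
    hseg hxy
  grw [hG T' hT' q hq r hr, h.le_patchSlope G (h.mem_patch.2 ⟨hT', hz⟩)]

theorem ae_isInteriorApproxAt_elementwise (h : IsTriangulation 𝒯 Ω) (hΩ : IsOpen Ω)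
    (hκ : IsShapeRegular κ 𝒯) (hκ0 : 0 < κ) {v g : Euc n → ℝ} (hg : Continuous g)
    {G : Finset (Euc n) → ℝ} (hG : ∀ T ∈ meshElements 𝒯, ∀ x ∈ simplexHull T, ∀ y ∈ simplexHull T,
      |g x - g y| ≤ G T * ‖x - y‖) {c : ℝ}
    (herr : ∀ T ∈ meshElements 𝒯, ∀ x ∈ simplexHull T, ENNReal.ofReal ((g x - v x) ^ 2) ≤
      ENNReal.ofReal (c * simplexDiam T ^ (2 * s)) * gagliardoAt s v x) :
    ∀ᵐ x, x ∈ Ω → IsInteriorApproxAt s (c * (2 * κ ^ 2) ^ (2 * s)) Ω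
      (h.elementwise fun T => simplexDiam T / (2 * κ ^ 2))
      (h.elementwise (h.patchSlope G)) v g x := by
  filter_upwards [h.ae_exists_mem_interior hΩ] with x hx hxΩ
  obtain ⟨T, hT, hxT⟩ := hx hxΩ
  have hd := simplexDiam_pos hT
  constructor <;> simp only [h.elementwise_apply _ hT hxT]
  · positivity
  · exact fun y hseg hxy =>
      h.abs_sub_le_patchSlope hΩ hκ hκ0 hg hG hT (interior_subset hxT) hseg hxy
  · refine (herr T hT x (interior_subset hxT)).trans_eq ?_
    rw [← mul_assoc, ← ENNReal.ofReal_mul (by positivity), Real.div_rpow hd.le (by positivity)]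
    congr 2
    field_simp

end IsTriangulation

theorem exists_gagliardo_le_sum (hΩ : IsCorkscrewDomain Ω) (hs0 : 0 < s) (hs1 : s < 1)
    (hκ0 : 0 < κ) {c : ℝ} (hc : 0 ≤ c) :
    ∃ C : ℝ, 0 < C ∧ ∀ 𝒯 : Geometry.SimplicialComplex ℝ (Euc n),
      ∀ h : IsTriangulation 𝒯 Ω, IsShapeRegular κ 𝒯 →
      ∀ v : Euc n → ℝ, Measurable v → MemLp v 2 volume → (∀ x, x ∉ Ω → v x = 0) →
      ∀ g : Euc n → ℝ, Continuous g → (∀ x, x ∉ Ω → g x = 0) → ∀ G : Finset (Euc n) → ℝ,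
      (∀ T ∈ meshElements 𝒯, ∀ x ∈ simplexHull T, ∀ y ∈ simplexHull T,
        |g x - g y| ≤ G T * ‖x - y‖) →
      (∀ T ∈ meshElements 𝒯, ∀ x ∈ simplexHull T, ENNReal.ofReal ((g x - v x) ^ 2) ≤
        ENNReal.ofReal (c * simplexDiam T ^ (2 * s)) * gagliardoAt s v x) →
      gagliardo s g ≤ ENNReal.ofReal C * (gagliardo s v + ∑ T ∈ h.elements,
        ENNReal.ofReal (G T ^ 2 * simplexDiam T ^ (2 - 2 * s)) * volume (simplexHull T)) := by
  obtain ⟨C, hC, hlocal⟩ := exists_gagliardo_le_of_isInteriorApproxAt (s := s) (n := n) hΩ hs0 hs1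
    (c := c * (2 * κ ^ 2) ^ (2 * s)) (by positivity)
  set D := ((2 * κ ^ 2) ^ (2 - 2 * s))⁻¹ * (κ ^ (2 - 2 * s) * ((κ + 2) * κ) ^ n) with hD
  refine ⟨C * (1 + D), by positivity, fun 𝒯 h hκ v hvm hv hv0 g hg hg0 G hG herr => ?_⟩
  set S := ∑ T ∈ h.elements,
    ENNReal.ofReal (G T ^ 2 * simplexDiam T ^ (2 - 2 * s)) * volume (simplexHull T)
  have hsum : ∑ T ∈ h.elements, ENNReal.ofReal (h.patchSlope G T ^ 2 *
      (simplexDiam T / (2 * κ ^ 2)) ^ (2 - 2 * s)) * volume (simplexHull T) ≤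
        ENNReal.ofReal D * S := by
    rw [hD, ENNReal.ofReal_mul (by positivity), mul_assoc]
    grw [← h.sum_patchSlope_energy_le hκ hκ0 hs1 G]
    rw [Finset.mul_sum]
    refine Finset.sum_le_sum fun T hT => le_of_eq ?_
    have hd := simplexDiam_pos (h.mem_elements.1 hT)
    rw [← mul_assoc, ← ENNReal.ofReal_mul (by positivity), Real.div_rpow hd.le (by positivity)]
    congr 2
    ring
  calc gagliardo s g ≤ ENNReal.ofReal C * (gagliardo s v + ENNReal.ofReal D * S) := by
        grw [hlocal _ _ v g (h.measurable_elementwise _) (h.measurable_elementwise _) hvm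
          hg.measurable hv hv0 hg0
          (h.ae_isInteriorApproxAt_elementwise hΩ.isOpen hκ hκ0 hg hG herr),
          h.setLIntegral_elementwise_le hΩ.isOpen
            (fun m r => ENNReal.ofReal (m ^ 2 * r ^ (2 - 2 * s))), hsum]
    _ ≤ ENNReal.ofReal C * (gagliardo s v + S + ENNReal.ofReal D * (gagliardo s v + S)) := by
        gcongr <;> simp
    _ = _ := by
        rw [ENNReal.ofReal_mul hC.le, ENNReal.ofReal_add zero_le_one (by positivity),
          ENNReal.ofReal_one]
        ring

end MeshEnergy

/-! ### Quasi-interpolation -/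

section QuasiInterpolation

variable {n : ℕ} {s : ℝ} {Ω : Set (Euc n)} {κ : ℝ}
  {𝒯 : Geometry.SimplicialComplex ℝ (Euc n)} {T : Finset (Euc n)}

theorem ofReal_sq_sub_le_of_sq_sub_le {p q t : ℝ} {M : ENNReal}
    (hp : ENNReal.ofReal ((t - p) ^ 2) ≤ M) (hq : ENNReal.ofReal ((t - q) ^ 2) ≤ M) :
    ENNReal.ofReal ((p - q) ^ 2) ≤ 4 * M := by
  have hsq : (p - q) ^ 2 ≤ 2 * ((t - p) ^ 2 + (t - q) ^ 2) := by
    linarith [sq_nonneg ((t - p) + (t - q))]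
  calc ENNReal.ofReal ((p - q) ^ 2) ≤ ENNReal.ofReal (2 * ((t - p) ^ 2 + (t - q) ^ 2)) :=
        ENNReal.ofReal_le_ofReal hsq
    _ = 2 * (ENNReal.ofReal ((t - p) ^ 2) + ENNReal.ofReal ((t - q) ^ 2)) := by
        rw [ENNReal.ofReal_mul zero_le_two, ENNReal.ofReal_ofNat,
          ENNReal.ofReal_add (sq_nonneg _) (sq_nonneg _)]
    _ ≤ 2 * (M + M) := by gcongr
    _ = 4 * M := by ring

theorem IsTriangulation.simplexDiam_le (h : IsTriangulation 𝒯 Ω) {R : ℝ} (hR : 0 ≤ R)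
    (hdist : ∀ x ∈ closure Ω, ∀ y ∈ closure Ω, dist x y ≤ R) (hT : T ∈ meshElements 𝒯) :
    simplexDiam T ≤ R :=
  Metric.diam_le_of_forall_dist_le hR fun x hx y hy =>
    hdist x (h.simplexHull_subset hT hx) y (h.simplexHull_subset hT hy)

theorem IsTriangulation.sq_interp_sub_le (h : IsTriangulation 𝒯 Ω) (hΩ : IsOpen Ω)
    (hT : T ∈ meshElements 𝒯) {a : Euc n → ℝ} {t : ℝ} {M : ENNReal}
    (ha : ∀ z ∈ T, ENNReal.ofReal ((t - a z) ^ 2) ≤ M) {x : Euc n} (hx : x ∈ simplexHull T) :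
    ENNReal.ofReal ((h.interp hΩ a x - t) ^ 2) ≤ M := by
  obtain ⟨z, hz, hle⟩ := h.exists_abs_interp_sub_le hΩ a hT t hx
  refine (ENNReal.ofReal_le_ofReal ?_).trans (ha z hz)
  rw [← sq_abs, ← sq_abs (t - a z), abs_sub_comm t]
  gcongr

variable [NeZero n]

/-- The ball with centre `b` and radius `r` has the size of the elements with vertex `z` and lies
close to them, so that a mean over it can serve as nodal value at `z`. -/
structure IsNodeBall (c C : ℝ) (𝒯 : Geometry.SimplicialComplex ℝ (Euc n)) (z b : Euc n) (r : ℝ) :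
    Prop where
  pos : 0 < r
  le_radius : ∀ T ∈ meshElements 𝒯, z ∈ T → c * simplexDiam T ≤ r
  ball_subset : ∀ T ∈ meshElements 𝒯, z ∈ T → ∀ x ∈ simplexHull T,
    Metric.ball b r ⊆ Metric.closedBall x (C * simplexDiam T)

theorem IsShapeRegular.isNodeBall (hκ : IsShapeRegular κ 𝒯) (hκ0 : 0 < κ)
    (hT : T ∈ meshElements 𝒯) {z p b : Euc n} (hz : z ∈ T) (hp : p ∈ simplexHull T) {τ : ℝ}
    (hτ : 0 < τ)
    (hb : Metric.ball b (τ * simplexDiam T) ⊆ Metric.closedBall p (simplexDiam T)) :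
    IsNodeBall (τ / κ) (1 + 2 * κ) 𝒯 z b (τ * simplexDiam T) where
  pos := mul_pos hτ (simplexDiam_pos hT)
  le_radius T' hT' hz' := by
    calc τ / κ * simplexDiam T' ≤ τ / κ * (κ * simplexDiam T) := by
          gcongr
          exact hκ.neighbours T' hT' T hT ⟨z, hz', hz⟩
      _ = τ * simplexDiam T := by field_simp
  ball_subset T' hT' hz' x hx y hy := by
    calc dist y x ≤ dist y p + dist p z + dist z x := dist_triangle4 _ _ _ _
      _ ≤ simplexDiam T + simplexDiam T + simplexDiam T' :=
        add_le_add (add_le_add (hb hy) (dist_le_simplexDiam hp (mem_simplexHull_of_mem hz)))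
          (dist_le_simplexDiam (mem_simplexHull_of_mem hz') hx)
      _ ≤ (1 + 2 * κ) * simplexDiam T' := by linarith [hκ.neighbours T hT T' hT' ⟨z, hz, hz'⟩]

theorem exists_isNodeBall (hΩ : IsCorkscrewDomain Ω) (hκ0 : 0 < κ) :
    ∃ c C : ℝ, 0 < c ∧ 0 < C ∧ ∀ 𝒯 : Geometry.SimplicialComplex ℝ (Euc n),
      ∀ h : IsTriangulation 𝒯 Ω, IsShapeRegular κ 𝒯 → ∀ z : Euc n, ∃ (b : Euc n) (r : ℝ),
        IsNodeBall c C 𝒯 z b r ∧ (¬ h.IsFree hΩ.isOpen z → Disjoint (Metric.ball b r) Ω) := by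
  obtain ⟨R, hR, hdist⟩ := hΩ.exists_dist_le
  obtain ⟨θ, hθ, hext⟩ := hΩ.exists_hasExteriorBalls hR
  refine ⟨min (1 / κ) θ / κ, 1 + 2 * κ, by positivity, by positivity, fun 𝒯 h hκ z => ?_⟩
  have hτ : 0 < min (1 / κ) θ := by positivity
  by_cases hz : h.IsFree hΩ.isOpen z
  · by_cases hvertex : ∃ T ∈ meshElements 𝒯, z ∈ T
    · obtain ⟨T, hT, hzT⟩ := hvertex
      have hd := simplexDiam_pos hT
      obtain ⟨b, hb⟩ := hκ.inball T hT
      refine ⟨b, _, hκ.isNodeBall hκ0 hT hzT (mem_simplexHull_of_mem hzT) hτ fun y hy => ?_,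
        fun h => absurd hz h⟩
      refine dist_le_simplexDiam
        (hb (Metric.ball_subset_closedBall (Metric.ball_subset_ball ?_ hy)))
        (mem_simplexHull_of_mem hzT)
      grw [min_le_left, one_div_mul_eq_div]
    · push Not at hvertex
      exact ⟨0, 1, ⟨one_pos, fun T hT hzT => absurd hzT (hvertex T hT),
        fun T hT hzT => absurd hzT (hvertex T hT)⟩, fun h => absurd hz h⟩
  · obtain ⟨p, hp, T, hT, hzT, hpT⟩ := h.exists_frontier_of_not_isFree hΩ.isOpen hz
    have hd := simplexDiam_pos hT
    obtain ⟨b, hb⟩ := hext p hp (simplexDiam T) hd (h.simplexDiam_le hR.le hdist hT)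
    have hball : Metric.ball b (min (1 / κ) θ * simplexDiam T) ⊆
        Metric.closedBall p (simplexDiam T) \ Ω :=
      (Metric.ball_subset_ball (by grw [min_le_right])).trans hb
    exact ⟨b, _, hκ.isNodeBall hκ0 hT hzT hpT hτ (hball.trans Set.sdiff_subset),
      fun _ => Set.disjoint_left.2 fun y hy => (hball hy).2⟩

theorem IsNodeBall.sq_sub_average_le {c C : ℝ} (hc : 0 < c) (hC : 0 ≤ C) (hs0 : 0 < s)
    {z b : Euc n} {r : ℝ} (hb : IsNodeBall c C 𝒯 z b r) {v : Euc n → ℝ} (hv : MemLp v 2 volume)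
    (hT : T ∈ meshElements 𝒯) (hz : z ∈ T) {x : Euc n} (hx : x ∈ simplexHull T) :
    ENNReal.ofReal ((v x - ⨍ y in Metric.ball b r, v y) ^ 2) ≤
      ENNReal.ofReal (C ^ kernelExp n s / (unitBallVol n * c ^ n) * simplexDiam T ^ (2 * s)) *
        gagliardoAt s v x := by
  have hd := simplexDiam_pos hT
  have hω := unitBallVol_pos n
  refine (sq_sub_average_ball_le_gagliardoAt hs0 hv x b hb.pos (hb.ball_subset T hT hz x hx)).trans
    (mul_le_mul_left (ENNReal.ofReal_le_ofReal ?_) _)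
  calc (C * simplexDiam T) ^ kernelExp n s / (unitBallVol n * r ^ n)
      ≤ (C * simplexDiam T) ^ kernelExp n s / (unitBallVol n * (c * simplexDiam T) ^ n) := by
        gcongr
        exact hb.le_radius T hT hz
    _ = _ := by
        rw [Real.mul_rpow hC hd.le, mul_pow, rpow_kernelExp hd]
        field_simp

theorem exists_nodal_values (hs0 : 0 < s) (hΩ : IsCorkscrewDomain Ω) (hκ0 : 0 < κ) :
    ∃ C : ℝ, 0 < C ∧ ∀ 𝒯 : Geometry.SimplicialComplex ℝ (Euc n),
      ∀ h : IsTriangulation 𝒯 Ω, IsShapeRegular κ 𝒯 → ∀ v : Euc n → ℝ, MemLp v 2 volume →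
      (∀ x, x ∉ Ω → v x = 0) → ∃ a : Euc n → ℝ, (∀ z, ¬ h.IsFree hΩ.isOpen z → a z = 0) ∧
        ∀ T ∈ meshElements 𝒯, ∀ z ∈ T, ∀ x ∈ simplexHull T, ENNReal.ofReal ((v x - a z) ^ 2) ≤
          ENNReal.ofReal (C * simplexDiam T ^ (2 * s)) * gagliardoAt s v x := by
  obtain ⟨c, C, hc, hC, hball⟩ := exists_isNodeBall hΩ hκ0
  have hω := unitBallVol_pos n
  refine ⟨C ^ kernelExp n s / (unitBallVol n * c ^ n), by positivity, fun 𝒯 h hκ v hv hv0 => ?_⟩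
  choose b r hb hdisj using hball 𝒯 h hκ
  refine ⟨fun z => ⨍ y in Metric.ball (b z) (r z), v y, fun z hz => ?_,
    fun T hT z hz x hx => (hb z).sq_sub_average_le hc hC.le hs0 hv hT hz hx⟩
  beta_reduce
  rw [setAverage_eq, setIntegral_eq_zero_of_forall_eq_zero fun y hy =>
    hv0 y (Set.disjoint_left.1 (hdisj z hz) hy), smul_zero]

theorem IsTriangulation.exists_slope_of_nodal_values (h : IsTriangulation 𝒯 Ω) (hΩ : IsOpen Ω)
    (hκ : IsShapeRegular κ 𝒯) (hκ0 : 0 < κ) {a v : Euc n → ℝ} {C : ℝ}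
    (hT : T ∈ meshElements 𝒯)
    (ha : ∀ z ∈ T, ∀ x ∈ simplexHull T, ENNReal.ofReal ((v x - a z) ^ 2) ≤
      ENNReal.ofReal (C * simplexDiam T ^ (2 * s)) * gagliardoAt s v x) :
    ∃ G : ℝ, (∀ x ∈ simplexHull T, ∀ y ∈ simplexHull T,
        |h.interp hΩ a x - h.interp hΩ a y| ≤ G * ‖x - y‖) ∧
      ENNReal.ofReal (G ^ 2 * simplexDiam T ^ (2 - 2 * s)) * volume (simplexHull T) ≤
        ENNReal.ofReal (4 * κ ^ 2 * C) * ∫⁻ x in simplexHull T, gagliardoAt s v x := by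
  have hd := simplexDiam_pos hT
  have hne : T.Nonempty := Finset.card_pos.1 (by rw [hT.2]; omega)
  obtain ⟨⟨z, z'⟩, hzz, hmax⟩ :=
    Finset.exists_max_image (T ×ˢ T) (fun q => |a q.1 - a q.2|) (hne.product hne)
  obtain ⟨hz, hz'⟩ := Finset.mem_product.1 hzz
  refine ⟨κ * |a z - a z'| / simplexDiam T, fun x hx y hy => h.abs_interp_sub_le hΩ hκ hκ0 hT
    (fun w hw w' hw' => hmax (w, w') (Finset.mk_mem_product hw hw')) hx hy, ?_⟩
  have hscale : (κ * |a z - a z'| / simplexDiam T) ^ 2 * simplexDiam T ^ (2 - 2 * s) =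
      κ ^ 2 * (simplexDiam T ^ (2 * s))⁻¹ * (a z - a z') ^ 2 := by
    rw [Real.rpow_sub hd, Real.rpow_two, div_pow, mul_pow, sq_abs]
    field_simp
  rw [hscale, ← setLIntegral_const, ← lintegral_const_mul' _ _ ENNReal.ofReal_ne_top]
  refine setLIntegral_mono' (isClosed_simplexHull T).measurableSet fun x hx => ?_
  rw [ENNReal.ofReal_mul (by positivity)]
  grw [ofReal_sq_sub_le_of_sq_sub_le (ha z hz x hx) (ha z' hz' x hx)]
  rw [← ENNReal.ofReal_ofNat 4, ← mul_assoc, ← mul_assoc, ← ENNReal.ofReal_mul (by positivity),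
    ← ENNReal.ofReal_mul (by positivity)]
  refine le_of_eq ?_
  congr 2
  field_simp

/-- `g` is a discrete function that approximates `v` to the order `h_T ^ s` on each element `T`,
with an error that is controlled pointwise by the energy density of `v`, and whose energy is
controlled by that of `v`. -/
structure IsQuasiInterpolant (s C : ℝ) (𝒯 : Geometry.SimplicialComplex ℝ (Euc n)) (Ω : Set (Euc n))
    (v g : Euc n → ℝ) : Prop extends IsMeshFunction 𝒯 Ω g where
  sq_sub_le : ∀ T ∈ meshElements 𝒯, ∀ x ∈ simplexHull T, ENNReal.ofReal ((g x - v x) ^ 2) ≤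
    ENNReal.ofReal (C * simplexDiam T ^ (2 * s)) * gagliardoAt s v x
  gagliardo_le : gagliardo s g ≤ ENNReal.ofReal C * gagliardo s v

theorem exists_isQuasiInterpolant (hs0 : 0 < s) (hs1 : s < 1) (hΩ : IsCorkscrewDomain Ω)
    (hκ0 : 0 < κ) :
    ∃ C : ℝ, 0 < C ∧ ∀ 𝒯 : Geometry.SimplicialComplex ℝ (Euc n),
      IsTriangulation 𝒯 Ω → IsShapeRegular κ 𝒯 → ∀ v : Euc n → ℝ, Measurable v →
      MemLp v 2 volume → (∀ x, x ∉ Ω → v x = 0) → ∃ g, IsQuasiInterpolant s C 𝒯 Ω v g := by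
  obtain ⟨C₁, hC₁, hnodal⟩ := exists_nodal_values (s := s) hs0 hΩ hκ0
  obtain ⟨C₂, hC₂, henergy⟩ := exists_gagliardo_le_sum hΩ hs0 hs1 hκ0 hC₁.le
  refine ⟨max C₁ (C₂ * (1 + 4 * κ ^ 2 * C₁)), by positivity, fun 𝒯 h hκ v hvm hv hv0 => ?_⟩
  obtain ⟨a, ha0, ha⟩ := hnodal 𝒯 h hκ v hv hv0
  have hslope := fun T hT => h.exists_slope_of_nodal_values hΩ.isOpen hκ hκ0 hT (ha T hT)
  choose! G hG hGenergy using hslope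
  have hmesh := h.isMeshFunction_interp hΩ.isOpen ha0
  have herr : ∀ T ∈ meshElements 𝒯, ∀ x ∈ simplexHull T,
      ENNReal.ofReal ((h.interp hΩ.isOpen a x - v x) ^ 2) ≤
        ENNReal.ofReal (C₁ * simplexDiam T ^ (2 * s)) * gagliardoAt s v x := fun T hT x hx =>
    h.sq_interp_sub_le hΩ.isOpen hT (fun z hz => ha T hT z hz x hx) hx
  have hsum : ∑ T ∈ h.elements, ENNReal.ofReal (G T ^ 2 * simplexDiam T ^ (2 - 2 * s)) *
      volume (simplexHull T) ≤ ENNReal.ofReal (4 * κ ^ 2 * C₁) * gagliardo s v := by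
    grw [Finset.sum_le_sum fun T hT => hGenergy T (h.mem_elements.1 hT), ← Finset.mul_sum,
      h.sum_setLIntegral_le]
    rfl
  refine ⟨h.interp hΩ.isOpen a, hmesh, fun T hT x hx => ?_, ?_⟩
  · have hd := simplexDiam_pos hT
    grw [herr T hT x hx, ← le_max_left]
  · grw [henergy 𝒯 h hκ v hvm hv hv0 _ hmesh.continuous hmesh.eq_zero G hG herr, hsum,
      ← le_max_right]
    rw [ENNReal.ofReal_mul hC₂.le, ENNReal.ofReal_add zero_le_one (by positivity),
      ENNReal.ofReal_one, mul_assoc (ENNReal.ofReal C₂), add_mul, one_mul]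

end QuasiInterpolation

/-! ### Bubbles and the Fortin operator -/

section GagliardoSum

variable {n : ℕ} {s : ℝ}

theorem gagliardo_le_two_mul_sum {ι : Type*} (I : Finset ι) {f : ι → Euc n → ℝ} {w : Euc n → ℝ}
    (s : ℝ) (hf : ∀ i ∈ I, Measurable (f i))
    (hw : ∀ x y, (w x - w y) ^ 2 ≤ 2 * ∑ i ∈ I, (f i x - f i y) ^ 2) :
    gagliardo s w ≤ 2 * ∑ i ∈ I, gagliardo s (f i) := by
  have hintegrand (x y : Euc n) :
      ENNReal.ofReal ((w x - w y) ^ 2 / ‖x - y‖ ^ kernelExp n s) ≤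
        2 * ∑ i ∈ I, ENNReal.ofReal ((f i x - f i y) ^ 2 / ‖x - y‖ ^ kernelExp n s) := by
    calc ENNReal.ofReal ((w x - w y) ^ 2 / ‖x - y‖ ^ kernelExp n s)
        ≤ ENNReal.ofReal (2 * ∑ i ∈ I, (f i x - f i y) ^ 2 / ‖x - y‖ ^ kernelExp n s) := by
          rw [← Finset.sum_div, ← mul_div_assoc]
          gcongr
          exact hw x y
      _ = _ := by
          rw [ENNReal.ofReal_mul zero_le_two, ENNReal.ofReal_ofNat,
            ENNReal.ofReal_sum_of_nonneg fun i _ => by positivity]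
  have hinner (x : Euc n) : gagliardoAt s w x ≤ 2 * ∑ i ∈ I, gagliardoAt s (f i) x := by
    have hmeas : ∀ i ∈ I, Measurable fun y =>
        ENNReal.ofReal ((f i x - f i y) ^ 2 / ‖x - y‖ ^ kernelExp n s) := fun i hi => by
      have := hf i hi
      fun_prop
    refine (lintegral_mono (hintegrand x)).trans_eq ?_
    rw [lintegral_const_mul' _ _ ENNReal.ofNat_ne_top, lintegral_finsetSum I hmeas]
    rfl
  refine (lintegral_mono hinner).trans_eq ?_
  rw [lintegral_const_mul' _ _ ENNReal.ofNat_ne_top, lintegral_finsetSum I fun i hi =>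
    measurable_gagliardoAt s (hf i hi)]
  rfl

theorem gagliardo_add_le {f g : Euc n → ℝ} (s : ℝ) (hf : Measurable f) (hg : Measurable g) :
    gagliardo s (f + g) ≤ 2 * (gagliardo s f + gagliardo s g) := by
  have hsum := gagliardo_le_two_mul_sum Finset.univ (f := ![f, g]) (w := f + g) s
    (fun i _ => by fin_cases i <;> assumption) (fun x y => by
      simp only [Fin.sum_univ_two, Matrix.cons_val_zero, Matrix.cons_val_one, Pi.add_apply]
      linarith [sq_nonneg ((f x - f y) - (g x - g y))])
  rwa [Fin.sum_univ_two] at hsum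

-- At most two summands contribute to the difference: one that lives at `x` and one that lives
-- at `y`.
theorem sq_sum_sub_le_of_pairwiseDisjoint_support {ι α : Type*} (I : Finset ι) {f : ι → α → ℝ}
    (hf : (I : Set ι).PairwiseDisjoint fun i => Function.support (f i)) (x y : α) :
    (∑ i ∈ I, f i x - ∑ i ∈ I, f i y) ^ 2 ≤ 2 * ∑ i ∈ I, (f i x - f i y) ^ 2 := by
  classical
  set J := I.filter fun i => f i x ≠ 0 ∨ f i y ≠ 0 with hJ
  have hzero : ∀ i ∈ I, i ∉ J → f i x - f i y = 0 := by
    intro i hi hiJ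
    simp only [hJ, Finset.mem_filter, not_and, not_or, not_not] at hiJ
    rw [(hiJ hi).1, (hiJ hi).2, sub_zero]
  have hone (z : α) : (I.filter fun i => f i z ≠ 0).card ≤ 1 := by
    refine Finset.card_le_one.2 fun i hi j hj => ?_
    rw [Finset.mem_filter] at hi hj
    exact hf.elim_set hi.1 hj.1 z hi.2 hj.2
  have hcard : (J.card : ℝ) ≤ 2 := by
    rw [hJ, Finset.filter_or]
    exact_mod_cast (Finset.card_union_le _ _).trans (add_le_add (hone x) (hone y))
  calc (∑ i ∈ I, f i x - ∑ i ∈ I, f i y) ^ 2 = (∑ i ∈ J, (f i x - f i y)) ^ 2 := by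
        rw [← Finset.sum_sub_distrib, Finset.sum_subset (Finset.filter_subset _ I) hzero]
    _ ≤ J.card * ∑ i ∈ J, (f i x - f i y) ^ 2 := sq_sum_le_card_mul_sum_sq
    _ ≤ 2 * ∑ i ∈ I, (f i x - f i y) ^ 2 := by
        gcongr
        exact Finset.filter_subset _ I

theorem exists_gagliardo_le_of_support_subset [NeZero n] (hs0 : 0 < s) (hs1 : s < 1) :
    ∃ C : ℝ, 0 < C ∧ ∀ (φ : Euc n → ℝ) (A : Set (Euc n)) (r L : ℝ), Measurable φ →
      MeasurableSet A → Function.support φ ⊆ A → 0 < r → (∀ x, |φ x| ≤ L * r) →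
      (∀ x y, |φ x - φ y| ≤ L * ‖x - y‖) →
      gagliardo s φ ≤ ENNReal.ofReal (C * (L ^ 2 * r ^ (2 - 2 * s))) * volume A := by
  obtain ⟨C, hC, hlocal⟩ := exists_gagliardo_le_of_isLocalApproxAt (n := n) hs0 hs1
  refine ⟨C * 2, by positivity, fun φ A r L hφ hA hsupp hr hbound hlip => ?_⟩
  set E := L ^ 2 * r ^ (2 - 2 * s)
  have : 0 ≤ E := by positivity
  have happrox (x : Euc n) : IsLocalApproxAt s (A.indicator fun _ => r) (fun _ => L)
      (A.indicator fun _ => ENNReal.ofReal E) 0 φ x := by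
    by_cases hx : x ∈ A
    · refine ⟨by simp [hx, hr.le], fun y _ => hlip x y, ?_⟩
      rw [Set.indicator_of_mem hx, Set.indicator_of_mem hx, Pi.zero_apply, sub_zero,
        ← ENNReal.ofReal_mul (by positivity)]
      have hpow : r ^ (2 * s) * E = (L * r) ^ 2 := by
        rw [mul_left_comm, ← Real.rpow_add hr, add_sub_cancel, Real.rpow_two, mul_pow]
      rw [hpow, ← sq_abs]
      gcongr
      exact hbound x
    · exact .of_scale_eq_zero (Set.indicator_of_notMem hx _)
        (by simpa using fun h => hx (hsupp h)) rfl
  have hslope (x : Euc n) : ENNReal.ofReal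
      (L ^ 2 * A.indicator (fun _ => r) x ^ (2 - 2 * s)) =
        A.indicator (fun _ => ENNReal.ofReal E) x := by
    by_cases hx : x ∈ A
    · simp [hx, E]
    · simp [hx, Real.zero_rpow (show (2 - 2 * s) ≠ 0 by linarith)]
  have henergy := hlocal _ _ 0 φ _ (measurable_const.indicator hA) measurable_const
    measurable_zero hφ (.of_forall happrox)
  have hzero : gagliardo s (0 : Euc n → ℝ) = 0 := by simp [gagliardo, gagliardoAt]
  simp only [hslope, lintegral_indicator_const hA, hzero, mul_zero, add_zero] at henergy
  refine henergy.trans_eq ?_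
  rw [mul_assoc, ENNReal.ofReal_mul hC.le, ENNReal.ofReal_mul zero_le_two, ENNReal.ofReal_ofNat]
  ring

end GagliardoSum

section Bubble

variable {n : ℕ} {s L M r κ : ℝ} {Ω A : Set (Euc n)} {b : Euc n} {φ : Euc n → ℝ}
  {𝒯 𝒯H : Geometry.SimplicialComplex ℝ (Euc n)} {K T : Finset (Euc n)}

/-- `φ` is a Lipschitz bump of size `r` in the ball `B(b, 2r) ⊆ A`. Multiples of it serve to
adjust the integral over `A`. -/
structure IsBubble (L : ℝ) (A : Set (Euc n)) (b : Euc n) (r : ℝ) (φ : Euc n → ℝ) : Prop where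
  pos : 0 < r
  ball_subset : Metric.ball b (2 * r) ⊆ A
  support_subset : Function.support φ ⊆ Metric.ball b (2 * r)
  nonneg : ∀ x, 0 ≤ φ x
  le : ∀ x, φ x ≤ r
  half_le : ∀ x ∈ Metric.ball b (r / 4), r / 2 ≤ φ x
  abs_sub_le : ∀ x y, |φ x - φ y| ≤ L * ‖x - y‖

namespace IsBubble

theorem support_subset' (hφ : IsBubble L A b r φ) : Function.support φ ⊆ A :=
  hφ.support_subset.trans hφ.ball_subset

theorem continuous (hφ : IsBubble L A b r φ) : Continuous φ :=
  (LipschitzWith.of_dist_le' fun x y => by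
    simpa only [dist_eq_norm, Real.norm_eq_abs] using hφ.abs_sub_le x y).continuous

theorem integrable (hφ : IsBubble L A b r φ) : Integrable φ :=
  hφ.continuous.integrable_of_hasCompactSupport <|
    HasCompactSupport.of_support_subset_isCompact (isCompact_closedBall b (2 * r))
      (hφ.support_subset.trans Metric.ball_subset_closedBall)

theorem le_setIntegral (hφ : IsBubble L A b r φ) :
    r / 2 * (unitBallVol n * (r / 4) ^ n) ≤ ∫ x in A, φ x := by
  have hr := hφ.pos
  have hball : Metric.ball b (r / 4) ⊆ A :=
    (Metric.ball_subset_ball (by linarith)).trans hφ.ball_subset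
  have hvol : volume.real (Metric.ball b (r / 4)) = unitBallVol n * (r / 4) ^ n := by
    have hω := unitBallVol_pos n
    rw [Measure.real, volume_ball_eq _ (by positivity), ENNReal.toReal_ofReal (by positivity)]
  calc r / 2 * (unitBallVol n * (r / 4) ^ n) = ∫ x in Metric.ball b (r / 4), r / 2 := by
        rw [setIntegral_const, hvol, smul_eq_mul, mul_comm]
    _ ≤ ∫ x in Metric.ball b (r / 4), φ x :=
        setIntegral_mono_on (integrableOn_const measure_ball_lt_top.ne) hφ.integrable.integrableOn
          measurableSet_ball hφ.half_le
    _ ≤ ∫ x in A, φ x :=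
        setIntegral_mono_set hφ.integrable.integrableOn (.of_forall hφ.nonneg) hball.eventuallyLE

theorem setIntegral_pos (hφ : IsBubble L A b r φ) : 0 < ∫ x in A, φ x := by
  have hr := hφ.pos
  have hω := unitBallVol_pos n
  exact lt_of_lt_of_le (by positivity) hφ.le_setIntegral

end IsBubble

theorem exists_gagliardo_isBubble_le [NeZero n] (hs0 : 0 < s) (hs1 : s < 1) (L : ℝ) :
    ∃ C : ℝ, 0 < C ∧ ∀ (A : Set (Euc n)) (b : Euc n) (r : ℝ) (φ : Euc n → ℝ), MeasurableSet A →
      IsBubble L A b r φ → gagliardo s φ ≤ ENNReal.ofReal (C * r ^ (2 - 2 * s)) * volume A := by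
  obtain ⟨C, hC, henergy⟩ := exists_gagliardo_le_of_support_subset (n := n) hs0 hs1
  refine ⟨C * max L 1 ^ 2, by positivity, fun A b r φ hA hφ => ?_⟩
  have hr := hφ.pos
  rw [mul_assoc]
  refine henergy φ A r (max L 1) hφ.continuous.measurable hA hφ.support_subset' hr
    (fun x => ?_) fun x y => ?_
  · rw [abs_of_nonneg (hφ.nonneg x)]
    exact (hφ.le x).trans (le_mul_of_one_le_left hr.le (le_max_right _ _))
  · grw [hφ.abs_sub_le, ← le_max_left]

theorem ofReal_sq_setIntegral_le {α : Type*} [MeasurableSpace α] {μ : Measure α} {f : α → ℝ}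
    {A : Set α} (hA : μ A ≠ ⊤) (hf : MemLp f 2 μ) :
    ENNReal.ofReal ((∫ x in A, f x ∂μ) ^ 2) ≤ μ A * ∫⁻ x in A, ENNReal.ofReal (f x ^ 2) ∂μ := by
  rcases eq_or_ne (μ A) 0 with h0 | h0
  · simp [Measure.restrict_eq_zero.2 h0]
  have : IsFiniteMeasure (μ.restrict A) := isFiniteMeasure_restrict.2 hA
  have : NeZero (μ.restrict A) := ⟨by rwa [Ne, Measure.restrict_eq_zero]⟩
  have hfA : MemLp f 2 (μ.restrict A) := hf.restrict A
  have hpos : 0 < μ.real A := ENNReal.toReal_pos h0 hA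
  have hjensen := sq_sub_average_le_average_sq_sub hfA 0
  simp only [zero_sub, neg_sq] at hjensen
  rw [setAverage_eq, setAverage_eq, smul_eq_mul, smul_eq_mul, mul_pow] at hjensen
  rw [← ofReal_integral_eq_lintegral_ofReal hfA.integrable_sq (.of_forall fun x => sq_nonneg _),
    ← ofReal_measureReal hA, ← ENNReal.ofReal_mul hpos.le]
  refine ENNReal.ofReal_le_ofReal ?_
  field_simp at hjensen
  exact hjensen

theorem exists_gagliardo_correction_le [NeZero n] (hs0 : 0 < s) (hs1 : s < 1) (L : ℝ)
    (hM : 0 < M) :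
    ∃ C : ℝ, 0 < C ∧ ∀ (A : Set (Euc n)) (b : Euc n) (r : ℝ) (φ e : Euc n → ℝ),
      IsBubble L A b r φ → MeasurableSet A → volume A ≤ ENNReal.ofReal (M * r ^ n) →
      MemLp e 2 volume → gagliardo s (((∫ x in A, e x) / ∫ x in A, φ x) • φ) ≤
        ENNReal.ofReal (C * (r ^ (2 * s))⁻¹) * ∫⁻ x in A, ENNReal.ofReal (e x ^ 2) := by
  obtain ⟨C, hC, hbubble⟩ := exists_gagliardo_isBubble_le (n := n) hs0 hs1 L
  have hω := unitBallVol_pos n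
  refine ⟨C * M ^ 2 * (2 * 4 ^ n / unitBallVol n) ^ 2, by positivity,
    fun A b r φ e hφ hA hvol he => ?_⟩
  have hr := hφ.pos
  set V := M * r ^ n with hV
  set J := r / 2 * (unitBallVol n * (r / 4) ^ n) with hJ
  have hcoeff : ENNReal.ofReal (((∫ x in A, e x) / ∫ x in A, φ x) ^ 2) ≤
      ENNReal.ofReal (V / J ^ 2) * ∫⁻ x in A, ENNReal.ofReal (e x ^ 2) := by
    calc ENNReal.ofReal (((∫ x in A, e x) / ∫ x in A, φ x) ^ 2)
        ≤ ENNReal.ofReal ((J ^ 2)⁻¹ * (∫ x in A, e x) ^ 2) := by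
          rw [div_pow, div_eq_inv_mul]
          gcongr
          exact hφ.le_setIntegral
      _ ≤ ENNReal.ofReal (J ^ 2)⁻¹ *
            (ENNReal.ofReal V * ∫⁻ x in A, ENNReal.ofReal (e x ^ 2)) := by
          rw [ENNReal.ofReal_mul (by positivity)]
          grw [ofReal_sq_setIntegral_le (hvol.trans_lt ENNReal.ofReal_lt_top).ne he, hvol]
      _ = _ := by
          rw [← mul_assoc, ← ENNReal.ofReal_mul (by positivity), ← div_eq_inv_mul]
  have hconst : V / J ^ 2 * (C * r ^ (2 - 2 * s) * V) =
      C * M ^ 2 * (2 * 4 ^ n / unitBallVol n) ^ 2 * (r ^ (2 * s))⁻¹ := by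
    have : 0 < r ^ (2 * s) := by positivity
    rw [Real.rpow_sub hr, Real.rpow_two, hJ, hV, div_pow]
    field_simp
  rw [gagliardo_const_smul]
  grw [hcoeff, hbubble A b r φ hA hφ, hvol]
  rw [← ENNReal.ofReal_mul (by positivity), mul_right_comm, ← ENNReal.ofReal_mul (by positivity),
    hconst]

/-- The tent of height `r` over the ball `B(b, r)`. -/
noncomputable def tent (b : Euc n) (r : ℝ) (z : Euc n) : ℝ := max (r - dist z b) 0

theorem tent_nonneg (b : Euc n) (r : ℝ) (z : Euc n) : 0 ≤ tent b r z := le_max_right _ _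

theorem tent_le (b : Euc n) (hr : 0 ≤ r) (z : Euc n) : tent b r z ≤ r :=
  max_le (sub_le_self r dist_nonneg) hr

theorem tent_eq_zero {z : Euc n} (hz : r ≤ dist z b) : tent b r z = 0 :=
  max_eq_right (sub_nonpos.2 hz)

theorem abs_tent_sub_le (b : Euc n) (r : ℝ) (z z' : Euc n) :
    |tent b r z - tent b r z'| ≤ dist z z' := by
  refine (abs_max_sub_max_le_abs _ _ _).trans ?_
  rw [sub_sub_sub_cancel_left, abs_sub_comm]
  exact abs_dist_sub_le z z' b

namespace IsTriangulation

theorem interp_tent_eq_zero (h : IsTriangulation 𝒯 Ω) (hΩ : IsOpen Ω)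
    (hsmall : ∀ T ∈ meshElements 𝒯, ∀ x ∈ simplexHull T, x ∈ Metric.ball b (2 * r) →
      simplexDiam T ≤ r / 4) {x : Euc n} (hx : x ∉ Metric.ball b (2 * r)) :
    h.interp hΩ (tent b r) x = 0 := by
  by_contra hne
  have hxc : x ∈ closure Ω := by
    by_contra hxc
    exact hne (h.interp_eq_zero_of_notMem hΩ _ hxc)
  obtain ⟨T, hT, hxT⟩ := h.exists_mem_element hΩ hxc
  refine hne (h.interp_eq_of_forall_eq hΩ hT (fun z hz => tent_eq_zero ?_) hxT)
  rw [Metric.mem_ball, not_lt] at hx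
  by_contra! hzb
  have hzT := mem_simplexHull_of_mem hz
  have hdiam := hsmall T hT z hzT (by
    rw [Metric.mem_ball]; linarith [dist_nonneg (x := z) (y := b)])
  linarith [dist_triangle x z b, dist_le_simplexDiam hxT hzT, dist_nonneg (x := z) (y := b)]

theorem isMeshFunction_interp_tent (h : IsTriangulation 𝒯 Ω) (hΩ : IsOpen Ω)
    (hball : Metric.ball b (2 * r) ⊆ Ω)
    (hsmall : ∀ T ∈ meshElements 𝒯, ∀ x ∈ simplexHull T, x ∈ Metric.ball b (2 * r) →
      simplexDiam T ≤ r / 4) : IsMeshFunction 𝒯 Ω (h.interp hΩ (tent b r)) := by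
  refine h.isMeshFunction_interp hΩ fun z hz => tent_eq_zero ?_
  obtain ⟨p, hp, T, hT, hzT, hpT⟩ := h.exists_frontier_of_not_isFree hΩ hz
  by_contra! hzb
  have hzT := mem_simplexHull_of_mem hzT
  have hr : 0 < r := dist_nonneg.trans_lt hzb
  have hdiam := hsmall T hT z hzT (by rw [Metric.mem_ball]; linarith)
  have hpb : p ∈ Metric.ball b (2 * r) := by
    rw [Metric.mem_ball]
    linarith [dist_triangle p z b, dist_le_simplexDiam hpT hzT]
  exact hp.2 (by rw [hΩ.interior_eq]; exact hball hpb)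

theorem isBubble_interp_tent [NeZero n] (h : IsTriangulation 𝒯 Ω) (hΩ : IsOpen Ω)
    (hκ : IsShapeRegular κ 𝒯) (hκ0 : 0 < κ) (hr : 0 < r) (hA : Metric.ball b (2 * r) ⊆ A)
    (hAΩ : A ⊆ Ω)
    (hsmall : ∀ T ∈ meshElements 𝒯, ∀ x ∈ simplexHull T, x ∈ Metric.ball b (2 * r) →
      simplexDiam T ≤ r / 4) : IsBubble κ A b r (h.interp hΩ (tent b r)) := by
  have hmesh := h.isMeshFunction_interp_tent hΩ (hA.trans hAΩ) hsmall
  have hmid (x : Euc n) : |h.interp hΩ (tent b r) x - r / 2| ≤ r / 2 := by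
    by_cases hx : x ∈ Ω
    · obtain ⟨T, hT, hxT⟩ := h.exists_mem_element hΩ (subset_closure hx)
      obtain ⟨z, -, hz⟩ := h.exists_abs_interp_sub_le hΩ (tent b r) hT (r / 2) hxT
      refine hz.trans (abs_le.2 ⟨?_, ?_⟩) <;> linarith [tent_nonneg b r z, tent_le b hr.le z]
    · rw [hmesh.eq_zero x hx, zero_sub, abs_neg, abs_of_pos (half_pos hr)]
  refine ⟨hr, hA, fun x hx => ?_, fun x => ?_, fun x => ?_, fun x hx => ?_, ?_⟩
  · by_contra hxb
    exact hx (h.interp_tent_eq_zero hΩ hsmall hxb)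
  · linarith [(abs_le.1 (hmid x)).1]
  · linarith [(abs_le.1 (hmid x)).2]
  · rw [Metric.mem_ball] at hx
    have hx2 : x ∈ Metric.ball b (2 * r) := by rw [Metric.mem_ball]; linarith
    obtain ⟨T, hT, hxT⟩ := h.exists_mem_element hΩ (subset_closure (hAΩ (hA hx2)))
    obtain ⟨z, hz, hxz⟩ := h.exists_abs_interp_sub_le hΩ (tent b r) hT r hxT
    have hdist := dist_le_simplexDiam (mem_simplexHull_of_mem hz) hxT
    have hhalf : r / 2 ≤ tent b r z := by
      refine le_max_of_le_left ?_
      linarith [dist_triangle z x b, hsmall T hT x hxT hx2]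
    rw [abs_sub_comm (tent b r z), abs_of_nonneg (sub_nonneg.2 (tent_le b hr.le z))] at hxz
    linarith [(abs_le.1 hxz).1]
  · refine hmesh.abs_sub_le h hΩ hκ0.le fun T hT q hq p hp => ?_
    have hslope := h.abs_interp_sub_le hΩ hκ hκ0 hT (fun z hz z' hz' =>
      (abs_tent_sub_le b r z z').trans
        (dist_le_simplexDiam (mem_simplexHull_of_mem hz) (mem_simplexHull_of_mem hz'))) hq hp
    rwa [mul_div_assoc, div_self (simplexDiam_pos hT).ne', mul_one] at hslope

end IsTriangulation

theorem MeshSizeGE.le_of_mem_interior {C : ℝ} (hsize : MeshSizeGE C 𝒯H 𝒯)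
    (hK : K ∈ meshElements 𝒯H) (hT : T ∈ meshElements 𝒯) {x : Euc n}
    (hxK : x ∈ interior (simplexHull K)) (hxT : x ∈ simplexHull T) :
    C * simplexDiam T ≤ simplexDiam K := by
  have hclosure : closure (interior (simplexHull T)) = simplexHull T := by
    rw [(convex_convexHull ℝ (T : Set (Euc n))).closure_interior_eq_closure_of_nonempty_interior
      (interior_simplexHull_nonempty hT), (isClosed_simplexHull T).closure_eq]
  rw [← hclosure] at hxT
  exact hsize K hK T hT (mem_closure_iff.1 hxT _ isOpen_interior hxK)

theorem exists_isBubble [NeZero n] (hΩ : IsCorkscrewDomain Ω) (hκ0 : 0 < κ)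
    (h : IsTriangulation 𝒯 Ω) (hκ : IsShapeRegular κ 𝒯) (hH : IsTriangulation 𝒯H Ω)
    (hκH : IsShapeRegular κ 𝒯H) (hsize : MeshSizeGE (8 * κ) 𝒯H 𝒯) (hK : K ∈ meshElements 𝒯H) :
    ∃ (b : Euc n) (φ : Euc n → ℝ), IsMeshFunction 𝒯 Ω φ ∧
      IsBubble κ (interior (simplexHull K)) b (simplexDiam K / (2 * κ)) φ := by
  have hdK := simplexDiam_pos hK
  set r := simplexDiam K / (2 * κ) with hr
  have hr0 : 0 < r := by positivity
  obtain ⟨b, hb⟩ := hκH.inball K hK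
  have hrK : 2 * r = simplexDiam K / κ := by rw [hr]; field_simp
  have hbK : Metric.ball b (2 * r) ⊆ interior (simplexHull K) :=
    interior_maximal (Metric.ball_subset_closedBall.trans (hrK ▸ hb)) Metric.isOpen_ball
  have hKΩ : interior (simplexHull K) ⊆ Ω :=
    (interior_mono (hH.simplexHull_subset hK)).trans hΩ.interior_closure_subset
  have hsmall : ∀ T ∈ meshElements 𝒯, ∀ x ∈ simplexHull T, x ∈ Metric.ball b (2 * r) →
      simplexDiam T ≤ r / 4 := fun T hT x hxT hx => by
    have hTK := hsize.le_of_mem_interior hK hT (hbK hx) hxT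
    rw [hr, div_div, le_div_iff₀ (by positivity)]
    linarith
  exact ⟨b, _, h.isMeshFunction_interp_tent hΩ.isOpen (hbK.trans hKΩ) hsmall,
    h.isBubble_interp_tent hΩ.isOpen hκ hκ0 hr0 hbK hKΩ hsmall⟩

theorem volume_interior_simplexHull_le [NeZero n] (hK : K ∈ meshElements 𝒯) :
    volume (interior (simplexHull K)) ≤
      ENNReal.ofReal (unitBallVol n * (2 * simplexDiam K) ^ n) := by
  obtain ⟨x, hx⟩ := interior_simplexHull_nonempty hK
  have hd := simplexDiam_pos hK
  rw [← volume_ball_eq x (by positivity)]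
  refine measure_mono fun y hy => ?_
  have := dist_le_simplexDiam (interior_subset hy) (interior_subset hx)
  rw [Metric.mem_ball]
  linarith

end Bubble

section Fortin

variable {n : ℕ} {s L M κ : ℝ} {Ω : Set (Euc n)} {𝒯 𝒯H : Geometry.SimplicialComplex ℝ (Euc n)}

namespace IsMeshFunction

variable {g : Euc n → ℝ}

theorem hasCompactSupport (hg : IsMeshFunction 𝒯 Ω g) (hΩ : Bornology.IsBounded Ω) :
    HasCompactSupport g :=
  .intro hΩ.isCompact_closure fun x hx => hg.eq_zero x fun hxΩ => hx (subset_closure hxΩ)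

theorem memLp (hg : IsMeshFunction 𝒯 Ω g) (hΩ : Bornology.IsBounded Ω) : MemLp g 2 volume :=
  hg.continuous.memLp_of_hasCompactSupport (hg.hasCompactSupport hΩ)

end IsMeshFunction

theorem integrableOn_interior_simplexHull [NeZero n] {K : Finset (Euc n)}
    (hK : K ∈ meshElements 𝒯) {v : Euc n → ℝ} (hv : MemLp v 2 volume) :
    IntegrableOn v (interior (simplexHull K)) := by
  have : IsFiniteMeasure (volume.restrict (interior (simplexHull K))) :=
    isFiniteMeasure_restrict.2
      ((volume_interior_simplexHull_le hK).trans_lt ENNReal.ofReal_lt_top).ne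
  exact (hv.restrict _).integrable one_le_two

section BubbleCorrection

variable {ι : Type*} {I : Finset ι} {A : ι → Set (Euc n)} {b : ι → Euc n} {r : ι → ℝ}
  {φ : ι → Euc n → ℝ}

/-- The linear combination of the bubbles `φ i` that has the same integral as `e` over each of the
disjoint sets `A i`. -/
noncomputable def bubbleCorrection (I : Finset ι) (A : ι → Set (Euc n)) (φ : ι → Euc n → ℝ)
    (e : Euc n → ℝ) : Euc n → ℝ :=
  ∑ i ∈ I, ((∫ x in A i, e x) / ∫ x in A i, φ i x) • φ i

theorem isMeshFunction_bubbleCorrection (hφ : ∀ i ∈ I, IsMeshFunction 𝒯 Ω (φ i))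
    (A : ι → Set (Euc n)) (e : Euc n → ℝ) : IsMeshFunction 𝒯 Ω (bubbleCorrection I A φ e) :=
  .finset_sum I fun i hi => (hφ i hi).const_smul _

theorem setIntegral_bubbleCorrection (hA : (I : Set ι).PairwiseDisjoint A)
    (hφ : ∀ i ∈ I, IsBubble L (A i) (b i) (r i) (φ i)) (e : Euc n → ℝ) {i : ι} (hi : i ∈ I) :
    ∫ x in A i, bubbleCorrection I A φ e x = ∫ x in A i, e x := by
  have hzero : ∀ j ∈ I, j ≠ i → ∫ x in A i, φ j x = 0 := fun j hj hji =>
    setIntegral_eq_zero_of_forall_eq_zero fun x hx => by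
      by_contra hne
      exact Set.disjoint_left.1 (hA hj hi hji) ((hφ j hj).support_subset' hne) hx
  simp only [bubbleCorrection, Finset.sum_apply, Pi.smul_apply, smul_eq_mul]
  rw [integral_finsetSum _ fun j hj => ((hφ j hj).integrable.const_mul _).integrableOn]
  simp only [integral_const_mul]
  rw [Finset.sum_eq_single_of_mem i hi fun j hj hji => by rw [hzero j hj hji, mul_zero],
    div_mul_cancel₀ _ (hφ i hi).setIntegral_pos.ne']

theorem exists_gagliardo_bubbleCorrection_le [NeZero n] (ι : Type*) (hs0 : 0 < s) (hs1 : s < 1)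
    (L : ℝ) (hM : 0 < M) :
    ∃ C : ℝ, 0 < C ∧ ∀ (I : Finset ι) (A : ι → Set (Euc n)) (b : ι → Euc n) (r : ι → ℝ)
      (φ : ι → Euc n → ℝ) (e : Euc n → ℝ), (I : Set ι).PairwiseDisjoint A →
      (∀ i ∈ I, IsBubble L (A i) (b i) (r i) (φ i)) → (∀ i ∈ I, MeasurableSet (A i)) →
      (∀ i ∈ I, volume (A i) ≤ ENNReal.ofReal (M * r i ^ n)) → MemLp e 2 volume →
      gagliardo s (bubbleCorrection I A φ e) ≤ 2 * ∑ i ∈ I,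
        ENNReal.ofReal (C * (r i ^ (2 * s))⁻¹) * ∫⁻ x in A i, ENNReal.ofReal (e x ^ 2) := by
  obtain ⟨C, hC, hcorr⟩ := exists_gagliardo_correction_le (n := n) hs0 hs1 L hM
  refine ⟨C, hC, fun I A b r φ e hA hφ hmeas hvol he => ?_⟩
  set ψ : ι → Euc n → ℝ := fun i => ((∫ x in A i, e x) / ∫ x in A i, φ i x) • φ i
  have hψ : (I : Set ι).PairwiseDisjoint fun i => Function.support (ψ i) := fun i hi j hj hij =>
    (hA hi hj hij).mono
      ((Function.support_const_smul_subset _ _).trans (hφ i hi).support_subset')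
      ((Function.support_const_smul_subset _ _).trans (hφ j hj).support_subset')
  refine (gagliardo_le_two_mul_sum I s
    (fun i hi => (hφ i hi).continuous.measurable.const_smul _) fun x y => ?_).trans
    (mul_le_mul_right (Finset.sum_le_sum fun i hi =>
      hcorr _ _ _ _ _ (hφ i hi) (hmeas i hi) (hvol i hi) he) 2)
  simp only [bubbleCorrection, Finset.sum_apply]
  exact sq_sum_sub_le_of_pairwiseDisjoint_support I hψ x y

end BubbleCorrection

theorem IsQuasiInterpolant.setLIntegral_sq_sub_le {C r : ℝ} {v g : Euc n → ℝ} {A : Set (Euc n)}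
    (hg : IsQuasiInterpolant s C 𝒯 Ω v g) (h : IsTriangulation 𝒯 Ω) (hΩ : IsOpen Ω) (hs0 : 0 < s)
    (hC : 0 ≤ C) (hA : MeasurableSet A) (hAΩ : A ⊆ closure Ω)
    (hr : ∀ T ∈ meshElements 𝒯, ∀ x ∈ A, x ∈ simplexHull T → simplexDiam T ≤ r) :
    ∫⁻ x in A, ENNReal.ofReal ((v x - g x) ^ 2) ≤
      ENNReal.ofReal (C * r ^ (2 * s)) * ∫⁻ x in A, gagliardoAt s v x := by
  rw [← lintegral_const_mul' _ _ ENNReal.ofReal_ne_top]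
  refine setLIntegral_mono' hA fun x hx => ?_
  obtain ⟨T, hT, hxT⟩ := h.exists_mem_element hΩ (hAΩ hx)
  rw [← neg_sub, neg_sq]
  grw [hg.sq_sub_le T hT x hxT]
  gcongr
  · exact Metric.diam_nonneg
  · exact hr T hT x hx hxT

theorem exists_isMeshFunction_setIntegral_eq [NeZero n] (hs0 : 0 < s) (hs1 : s < 1)
    (hΩ : IsCorkscrewDomain Ω) (hκ0 : 0 < κ) :
    ∃ C : ℝ, 0 < C ∧ ∀ (𝒯 𝒯H : Geometry.SimplicialComplex ℝ (Euc n)) (_ : IsTriangulation 𝒯 Ω)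
      (hH : IsTriangulation 𝒯H Ω), IsShapeRegular κ 𝒯 → IsShapeRegular κ 𝒯H →
      MeshSizeGE (8 * κ) 𝒯H 𝒯 → ∀ e : Euc n → ℝ, MemLp e 2 volume →
      ∃ w, IsMeshFunction 𝒯 Ω w ∧
        (∀ K ∈ meshElements 𝒯H,
          ∫ x in interior (simplexHull K), w x = ∫ x in interior (simplexHull K), e x) ∧
        gagliardo s w ≤ 2 * ∑ K ∈ hH.elements, ENNReal.ofReal (C * (simplexDiam K ^ (2 * s))⁻¹) *
          ∫⁻ x in interior (simplexHull K), ENNReal.ofReal (e x ^ 2) := by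
  have hω := unitBallVol_pos n
  obtain ⟨C, hC, hcorr⟩ := exists_gagliardo_bubbleCorrection_le (n := n) (Finset (Euc n)) hs0
    hs1 κ (M := unitBallVol n * (4 * κ) ^ n) (by positivity)
  refine ⟨C * (2 * κ) ^ (2 * s), by positivity, fun 𝒯 𝒯H h hH hκ hκH hsize e he => ?_⟩
  choose! b φ hmesh hbubble using fun K (hK : K ∈ hH.elements) =>
    exists_isBubble hΩ hκ0 h hκ hH hκH hsize (hH.mem_elements.1 hK)
  have hdisj : (hH.elements : Set (Finset (Euc n))).PairwiseDisjoint
      fun K => interior (simplexHull K) := fun K hK K' hK' hne =>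
    disjoint_interior_simplexHull (hH.mem_elements.1 hK) (hH.mem_elements.1 hK') hne
  refine ⟨bubbleCorrection hH.elements _ φ e, isMeshFunction_bubbleCorrection hmesh _ e,
    fun K hK => setIntegral_bubbleCorrection hdisj hbubble e (hH.mem_elements.2 hK),
    (hcorr _ _ _ _ _ e hdisj hbubble (fun _ _ => isOpen_interior.measurableSet)
      (fun K hK => ?_) he).trans_eq ?_⟩
  · refine (volume_interior_simplexHull_le (hH.mem_elements.1 hK)).trans_eq ?_
    rw [mul_assoc, ← mul_pow]
    congr 3
    field_simp
    ring
  · congr! 4 with K hK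
    have hd := simplexDiam_pos (hH.mem_elements.1 hK)
    rw [Real.div_rpow hd.le (by positivity), inv_div, div_eq_mul_inv, mul_assoc]

theorem IsQuasiInterpolant.sum_setLIntegral_sq_sub_le [NeZero n] {C C' c : ℝ} {v g : Euc n → ℝ}
    (hg : IsQuasiInterpolant s C 𝒯 Ω v g) (h : IsTriangulation 𝒯 Ω) (hH : IsTriangulation 𝒯H Ω)
    (hΩ : IsOpen Ω) (hs0 : 0 < s) (hC : 0 ≤ C) (hC' : 0 ≤ C') (hc : 0 < c)
    (hsize : MeshSizeGE c 𝒯H 𝒯) :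
    ∑ K ∈ hH.elements, ENNReal.ofReal (C' * (simplexDiam K ^ (2 * s))⁻¹) *
      ∫⁻ x in interior (simplexHull K), ENNReal.ofReal ((v x - g x) ^ 2) ≤
        ENNReal.ofReal (C' * (C * c⁻¹ ^ (2 * s))) * gagliardo s v := by
  have helement : ∀ K ∈ hH.elements, ENNReal.ofReal (C' * (simplexDiam K ^ (2 * s))⁻¹) *
      ∫⁻ x in interior (simplexHull K), ENNReal.ofReal ((v x - g x) ^ 2) ≤
        ENNReal.ofReal (C' * (C * c⁻¹ ^ (2 * s))) *
          ∫⁻ x in simplexHull K, gagliardoAt s v x := fun K hKe => by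
    have hK := hH.mem_elements.1 hKe
    have hd := simplexDiam_pos hK
    have herr := hg.setLIntegral_sq_sub_le h hΩ hs0 hC isOpen_interior.measurableSet
      (interior_subset.trans (hH.simplexHull_subset hK)) (r := c⁻¹ * simplexDiam K)
      fun T hT x hxK hxT => (le_inv_mul_iff₀ hc).2 (hsize.le_of_mem_interior hK hT hxK hxT)
    grw [herr, interior_subset (s := simplexHull K)]
    rw [← mul_assoc, ← ENNReal.ofReal_mul (by positivity), Real.mul_rpow (by positivity) hd.le]
    refine (congrArg (ENNReal.ofReal · * _) ?_).le
    field_simp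
  grw [Finset.sum_le_sum helement, ← Finset.mul_sum, hH.sum_setLIntegral_le (gagliardoAt s v)]
  rfl

theorem exists_fortin [NeZero n] (hs0 : 0 < s) (hs1 : s < 1) (hΩ : IsCorkscrewDomain Ω)
    (hκ0 : 0 < κ) :
    ∃ C : ℝ, 0 < C ∧ ∀ 𝒯 𝒯H : Geometry.SimplicialComplex ℝ (Euc n), IsTriangulation 𝒯 Ω →
      IsTriangulation 𝒯H Ω → IsShapeRegular κ 𝒯 → IsShapeRegular κ 𝒯H →
      MeshSizeGE (8 * κ) 𝒯H 𝒯 → ∀ v : Euc n → ℝ, Measurable v → MemLp v 2 volume →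
      (∀ x, x ∉ Ω → v x = 0) → ∃ g : Euc n → ℝ, IsMeshFunction 𝒯 Ω g ∧
        (∀ K ∈ meshElements 𝒯H,
          ∫ x in interior (simplexHull K), g x = ∫ x in interior (simplexHull K), v x) ∧
        gagliardo s g ≤ ENNReal.ofReal C * gagliardo s v := by
  obtain ⟨Cq, hCq, hquasi⟩ := exists_isQuasiInterpolant hs0 hs1 hΩ hκ0
  obtain ⟨Cw, hCw, hcorr⟩ := exists_isMeshFunction_setIntegral_eq hs0 hs1 hΩ hκ0
  refine ⟨2 * (Cq + 2 * (Cw * (Cq * (8 * κ)⁻¹ ^ (2 * s)))), by positivity,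
    fun 𝒯 𝒯H h hH hκ hκH hsize v hvm hv hv0 => ?_⟩
  obtain ⟨g, hg⟩ := hquasi 𝒯 h hκ v hvm hv hv0
  have hgL := hg.memLp hΩ.isBounded
  obtain ⟨w, hw, hmean, hwen⟩ := hcorr 𝒯 𝒯H h hH hκ hκH hsize (v - g) (hv.sub hgL)
  refine ⟨g + w, hg.toIsMeshFunction.add hw, fun K hK => ?_, ?_⟩
  · have hwi := integrableOn_interior_simplexHull hK (hw.memLp hΩ.isBounded)
    have hgi := integrableOn_interior_simplexHull hK hgL
    simp only [Pi.add_apply]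
    rw [integral_add hgi hwi, hmean K hK]
    simp only [Pi.sub_apply]
    rw [integral_sub (integrableOn_interior_simplexHull hK hv) hgi, add_sub_cancel]
  have hcorrection := hg.sum_setLIntegral_sq_sub_le (C' := Cw) h hH hΩ.isOpen hs0 hCq.le hCw.le
    (by positivity) hsize
  simp only [Pi.sub_apply] at hwen
  grw [gagliardo_add_le s hg.continuous.measurable hw.continuous.measurable, hg.gagliardo_le,
    hwen, hcorrection]
  rw [ENNReal.ofReal_mul zero_le_two, ENNReal.ofReal_add hCq.le (by positivity),
    ENNReal.ofReal_mul zero_le_two, ENNReal.ofReal_ofNat, mul_assoc, add_mul, mul_assoc 2]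

end Fortin

section Main

variable {n : ℕ} {s κ : ℝ} {Ω : Set (Euc n)} {𝒯 : Geometry.SimplicialComplex ℝ (Euc n)}

theorem IsTriangulation.ae_eq_biUnion_interior (h : IsTriangulation 𝒯 Ω)
    (hΩ : IsCorkscrewDomain Ω) :
    Ω =ᵐ[volume] ⋃ K ∈ h.elements, interior (simplexHull K) := by
  refine Filter.EventuallyLE.antisymm ?_ (Set.iUnion₂_subset fun K hK =>
    (interior_mono (h.simplexHull_subset (h.mem_elements.1 hK))).trans
      hΩ.interior_closure_subset).eventuallyLE
  filter_upwards [h.ae_exists_mem_interior hΩ.isOpen] with x hx hxΩ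
  obtain ⟨K, hK, hxK⟩ := hx hxΩ
  exact Set.mem_biUnion (h.mem_elements.2 hK) hxK

theorem IsTriangulation.setIntegral_mul_eq_sum [NeZero n] (h : IsTriangulation 𝒯 Ω)
    (hΩ : IsCorkscrewDomain Ω) {g f : Euc n → ℝ} {c : Finset (Euc n) → ℝ}
    (hg : ∀ K ∈ meshElements 𝒯, ∀ x ∈ interior (simplexHull K), g x = c K)
    (hf : MemLp f 2 volume) :
    ∫ x in Ω, g x * f x = ∑ K ∈ h.elements, c K * ∫ x in interior (simplexHull K), f x := by
  have hcongr : ∀ K ∈ h.elements, Set.EqOn (fun x => c K * f x) (fun x => g x * f x)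
      (interior (simplexHull K)) := fun K hK x hx => by
    simp only [hg K (h.mem_elements.1 hK) x hx]
  rw [setIntegral_congr_set (h.ae_eq_biUnion_interior hΩ), integral_biUnion_finset]
  · refine Finset.sum_congr rfl fun K hK => ?_
    rw [← integral_const_mul, setIntegral_congr_fun isOpen_interior.measurableSet (hcongr K hK)]
  · exact fun K _ => isOpen_interior.measurableSet
  · exact fun K hK K' hK' hne =>
      disjoint_interior_simplexHull (h.mem_elements.1 hK) (h.mem_elements.1 hK') hne
  · exact fun K hK =>
      IntegrableOn.congr_fun
        ((integrableOn_interior_simplexHull (h.mem_elements.1 hK) hf).const_mul (c K))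
        (hcongr K hK) isOpen_interior.measurableSet

theorem apply_eq_of_mem_piecewiseConstant [NeZero n] (h : IsTriangulation 𝒯 Ω)
    (hΩ : IsCorkscrewDomain Ω) {μ : StrongDual ℝ (fracSobolevZero n s Ω)}
    (hμ : μ ∈ piecewiseConstant s Ω 𝒯) {v w : fracSobolevZero n s Ω}
    (hvw : ∀ K ∈ meshElements 𝒯, ∫ x in interior (simplexHull K), fracSobolevFun v x =
      ∫ x in interior (simplexHull K), fracSobolevFun w x) : μ v = μ w := by
  obtain ⟨g, hg, hμg⟩ := hμ
  choose! c hc using hg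
  rw [hμg, hμg, h.setIntegral_mul_eq_sum hΩ hc (memLp_fracSobolevFun v),
    h.setIntegral_mul_eq_sum hΩ hc (memLp_fracSobolevFun w)]
  exact Finset.sum_congr rfl fun K hK => by rw [hvw K (h.mem_elements.1 hK)]

theorem IsMeshFunction.exists_mem_piecewiseLinear {g : Euc n → ℝ} (hg : IsMeshFunction 𝒯 Ω g)
    {C : ℝ} (hC : 0 ≤ C)
    (h : (∫⁻ x, ENNReal.ofReal (g x ^ 2)) + gagliardo s g ≤ ENNReal.ofReal C) :
    ∃ v ∈ piecewiseLinear s Ω 𝒯, fracSobolevFun v =ᵐ[volume] g ∧ ‖v‖ ^ 2 ≤ C := by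
  obtain ⟨v, hv, hvC⟩ :=
    exists_fracSobolevZero_of_energy_le hg.continuous.measurable hg.eq_zero hC h
  exact ⟨v, ⟨g, hg.continuous, hg.eq_zero, hg.affine, hv⟩, hv, hvC⟩

theorem exists_fortin_piecewiseLinear [NeZero n] (hs0 : 0 < s) (hs1 : s < 1)
    (hΩ : IsCorkscrewDomain Ω) (hκ0 : 0 < κ) :
    ∃ C : ℝ, 0 < C ∧ ∀ 𝒯 𝒯H : Geometry.SimplicialComplex ℝ (Euc n), IsTriangulation 𝒯 Ω →
      IsTriangulation 𝒯H Ω → IsShapeRegular κ 𝒯 → IsShapeRegular κ 𝒯H →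
      MeshSizeGE (8 * κ) 𝒯H 𝒯 → ∀ v : fracSobolevZero n s Ω,
      ∃ z ∈ piecewiseLinear s Ω 𝒯, ‖z‖ ≤ C * ‖v‖ ∧
        ∀ μ ∈ piecewiseConstant s Ω 𝒯H, μ z = μ v := by
  obtain ⟨CF, hCF, hfortin⟩ := exists_fortin hs0 hs1 hΩ hκ0
  obtain ⟨CP, hCP, henergy⟩ := exists_energy_le_gagliardo hΩ hs0
  refine ⟨√(CP * CF), by positivity, fun 𝒯 𝒯H h hH hκ hκH hsize v => ?_⟩
  obtain ⟨v', hvm, hvL, hv0, hv⟩ := exists_representative hΩ.isOpen.measurableSet v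
  obtain ⟨g, hg, hmean, hgv⟩ := hfortin 𝒯 𝒯H h hH hκ hκH hsize v' hvm hvL hv0
  have hbound : (∫⁻ x, ENNReal.ofReal (g x ^ 2)) + gagliardo s g ≤
      ENNReal.ofReal (CP * CF * ‖v‖ ^ 2) := by
    have hsemi : gagliardo s v' ≤ ENNReal.ofReal (‖v‖ ^ 2) := by
      rw [ofReal_norm_sq_of_ae_eq hv]
      exact le_add_self
    grw [henergy g (hg.memLp hΩ.isBounded) hg.eq_zero, hgv, hsemi]
    rw [← ENNReal.ofReal_mul hCF.le, ← ENNReal.ofReal_mul hCP.le, mul_assoc]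
  obtain ⟨z, hz, hzg, hznorm⟩ := hg.exists_mem_piecewiseLinear (by positivity) hbound
  refine ⟨z, hz, ?_, fun μ hμ => apply_eq_of_mem_piecewiseConstant hH hΩ hμ fun K hK => ?_⟩
  · rw [← Real.sqrt_sq (norm_nonneg v), ← Real.sqrt_mul (by positivity)]
    exact Real.le_sqrt_of_sq_le hznorm
  · rw [integral_congr_ae hzg.restrict, hmean K hK, integral_congr_ae hv.restrict]

theorem mainTheorem8_general [NeZero n] (hs0 : 0 < s) (hs1 : s < 1) (hΩ : IsCorkscrewDomain Ω) :
    ∃ C₁ : ℝ, 0 < C₁ ∧ ∀ κ : ℝ, 0 < κ → ∃ C₀ C₂ : ℝ, 0 < C₀ ∧ 0 < C₂ ∧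
      ∀ 𝒯h 𝒯H : Geometry.SimplicialComplex ℝ (Euc n), IsTriangulation 𝒯h Ω →
        IsTriangulation 𝒯H Ω → IsShapeRegular κ 𝒯h → IsShapeRegular κ 𝒯H →
      ∀ (u : fracSobolevZero n s Ω), ∀ uh ∈ piecewiseLinear s Ω 𝒯h,
      ∀ (lam : StrongDual ℝ (fracSobolevZero n s Ω)), ∀ lamH ∈ piecewiseConstant s Ω 𝒯H,
        (∀ z ∈ piecewiseLinear s Ω 𝒯h, fracForm u z + lam z = fracForm uh z + lamH z) →
      ∀ vh ∈ piecewiseLinear s Ω 𝒯h, ∀ μH ∈ piecewiseConstant s Ω 𝒯H,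
        ‖u - uh‖ ^ 2 ≤ C₁ * (‖u - vh‖ ^ 2 + ‖lam - lamH‖ ^ 2) ∧
        (MeshSizeGE C₀ 𝒯H 𝒯h → ‖lam - lamH‖ ≤ C₂ * (‖u - uh‖ + ‖lam - μH‖)) := by
  obtain ⟨α, hα, hcoercive⟩ := exists_fracFormL_coercive hΩ hs0 hs1
  have hprimal := exists_norm_sub_sq_le_of_galerkin (fracFormL n s Ω) hα hcoercive
  obtain ⟨C₁, hC₁, hprimal⟩ := hprimal
  refine ⟨C₁, hC₁, fun κ hκ0 => ?_⟩
  have hfortin := exists_fortin_piecewiseLinear hs0 hs1 hΩ hκ0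
  obtain ⟨C, hC, hfortin⟩ := hfortin
  have hdual := exists_norm_sub_le_of_fortin (fracFormL n s Ω) hC.le
  obtain ⟨C₂, hC₂, hdual⟩ := hdual
  refine ⟨8 * κ, C₂, by positivity, hC₂, fun 𝒯h 𝒯H hh hH hκ hκH u uh huh lam lamH hlamH heq
    vh hvh μH hμH => ?_⟩
  simp only [← fracFormL_apply] at heq
  exact ⟨hprimal _ u uh huh lam lamH heq vh hvh, fun hsize =>
    hdual _ _ (hfortin 𝒯h 𝒯H hh hH hκ hκH hsize) u uh lam lamH hlamH heq μH hμH⟩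

end Main

theorem mainTheorem8 (n : ℕ) (hn : 0 < n) (s : ℝ) (hs0 : 0 < s) (hs1 : s < 1)
    (Ω : Set (EuclideanSpace ℝ (Fin n))) (hΩ : IsBoundedLipschitzDomain Ω) :
    ∃ C₁ : ℝ, 0 < C₁ ∧ ∀ κ : ℝ, 0 < κ → ∃ C₀ C₂ : ℝ, 0 < C₀ ∧ 0 < C₂ ∧
      ∀ 𝒯h 𝒯H : Geometry.SimplicialComplex ℝ (EuclideanSpace ℝ (Fin n)),
        IsTriangulation 𝒯h Ω → IsTriangulation 𝒯H Ω →
        IsShapeRegular κ 𝒯h → IsShapeRegular κ 𝒯H →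
      ∀ Λ ΛH : Set (StrongDual ℝ (fracSobolevZero n s Ω)),
        IsClosed Λ → Convex ℝ Λ → IsClosed ΛH → Convex ℝ ΛH →
        ΛH ⊆ piecewiseConstant s Ω 𝒯H → ΛH ⊆ Λ →
      ∀ (f : StrongDual ℝ (fracSobolevZero n s Ω)) (w u uh : fracSobolevZero n s Ω)
        (lam lamH : StrongDual ℝ (fracSobolevZero n s Ω)),
        IsMixedSolution Set.univ Λ f w u lam →
        IsMixedSolution (piecewiseLinear s Ω 𝒯h) ΛH f w uh lamH →
      ∀ vh ∈ piecewiseLinear s Ω 𝒯h, ∀ μH ∈ ΛH,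
        ‖u - uh‖ ^ 2 ≤ C₁ * (‖u - vh‖ ^ 2 + ‖lam - μH‖ ^ 2 + ‖lam - lamH‖ ^ 2) ∧
        (MeshSizeGE C₀ 𝒯H 𝒯h →
          ‖lam - lamH‖ ≤ C₂ * (‖u - uh‖ + ‖lam - μH‖)) := by
  have : NeZero n := ⟨hn.ne'⟩
  have hgeneral := mainTheorem8_general hs0 hs1 hΩ.isCorkscrewDomain
  obtain ⟨C₁, hC₁, hgeneral⟩ := hgeneral
  refine ⟨C₁, hC₁, fun κ hκ => ?_⟩
  have hestimate := hgeneral κ hκ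
  obtain ⟨C₀, C₂, hC₀, hC₂, hestimate⟩ := hestimate
  refine ⟨C₀, C₂, hC₀, hC₂, ?_⟩
  intro 𝒯h 𝒯H hh hH hκh hκH Λ ΛH _ _ _ _ hΛM _ f w u uh lam lamH hu huh vh hvh μH hμH
  obtain ⟨hprimal, hdual⟩ := hestimate 𝒯h 𝒯H hh hH hκh hκH u uh huh.mem_space lam lamH
    (hΛM huh.mem_multipliers)
    (fun z hz => (hu.equation z (Set.mem_univ z)).trans (huh.equation z hz).symm)
    vh hvh μH (hΛM hμH)
  exact ⟨hprimal.trans (by gcongr; exact le_add_of_nonneg_right (sq_nonneg _)), hdual⟩
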